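/- **Setting.** Let $T>0$, $r\ge 0$, $\rho>0$, and write $L^2_{-T}=L^2([-T,0];\mathbb R)$, $H=\mathbb R\times L^2_{-T}$ (with elements $\eta=(\eta_0,\eta_1)$), $H_+=(0,\infty)\times L^2_{-T}$. Assume: * $a\in W^{1,2}([-T,0];\mathbb R)$, $a\ge 0$, $a(-T)=0$; * $f_0:[0,\infty)\times\mathbb R\to\mathbb R$ is jointly concave, nondecreasing in the second variable, Lipschitz continuous with constant $C_{f_0}$ (that is, $|f_0(x,y)-f_0(x',y')|\le C_{f_0}(|x-x'|+|y-y'|)$), and $f_0(0,y)>0$ for all $y>0$; * $U_1\in C([0,\infty))\cap C^2((0,\infty))$ is bounded, $U_1'>0$, $U_1''<0$ on $(0,\infty)$, and $U_1'(0^+)=+\infty$; * $U_2\in C((0,\infty))$ is nondecreasing, concave, bounded from above, and $\int_0^\infty e^{-\rho t}U_2(e^{-C_{f_0}t})\,dt>-\infty$. For $\eta\in H_+$ and $c$, consider the state equation $$x'(t)=rx(t)+f_0\Big(x(t),\int_{-T}^0a(\xi)x(t+\xi)\,d\xi\Big)-c(t),\quad t\ge 0,\qquad x(0)=\eta_0,\quad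 x(s)=\eta_1(s)\ \text{for a.e. } s\in[-T,0),$$ understood in integral form, with $x$ continuous on $[0,\infty)$. The set $\mathcal C(\eta)$ of admissible controls consists of all $c\in L^1_{loc}([0,\infty);[0,\infty))$ for which it has a solution with $x(t)>0$ for all $t\ge 0$; this solution is unique and denoted by $x(\cdot;\eta,c)$. Put $$J(\eta;c)=\int_0^\infty e^{-\rho t}\big[U_1(c(t))+U_2(x(t;\eta,c))\big]dt\in[-\infty,\infty),\qquad V(\eta)=\sup_{c\in\mathcal C(\eta)}J(\eta;c)\quad(\sup\emptyset=-\infty),$$ $\mathcal D(V)=\{\eta\in H_+: V(\eta)>-\infty\}$. Let $V_{\eta_0}(\eta)$ be the derivative of $V$ at $\eta\in\mathcal D(V)$ in the direction $(1,0)$, and let $$C(\eta)=\operatorname*{argmax}_{c\ge 0}\big(U_1(c)-c\,V_{\eta_0}(\eta)\big),\qquad \eta\in\mathcal D(V),$$ be the feedback map; under the assumptions above the derivative exists, and the maximizer exists and is unique, at every $\eta\in\mathcal D(V)$. **Theorem (Verification).** Let $\eta\in H_+$ and let $x^*$ be a solution of the closed-loop equation $$x'(t)=rx(t)+f_0\Big(x(t),\int_{-T}^0a(\xi)x(t+\xi)\,d\xi\Big)-C\big(x(t),x(t+\cdot)|_{[-T,0]}\big),\quad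 t\ge 0,\qquad x(0)=\eta_0,\quad x(s)=\eta_1(s)\ \text{for a.e. } s\in[-T,0),$$ understood in integral form, with $x^*$ continuous on $[0,\infty)$ and $(x^*(t),x^*(t+\cdot)|_{[-T,0]})\in\mathcal D(V)$, the domain of $C$, for all $t\ge0$. Suppose that $x^*(t)>0$ for all $t\ge 0$. Then the feedback strategy $$c^*(t):=C\big(x^*(t),x^*(t+\cdot)|_{[-T,0]}\big),\qquad t\ge 0,$$ is admissible, $c^*\in\mathcal C(\eta)$, and optimal: $\eta\in\mathcal D(V)$ and $J(\eta;c^*)=V(\eta)$. -/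

import Mathlib

open MeasureTheory Set Filter Topology

noncomputable section

namespace DelayControl

/-- Lebesgue measure on the delay interval `[-T, 0]`. -/
abbrev delayMeasure (T : ℝ) : Measure ℝ := volume.restrict (Icc (-T) 0)

/-- The Hilbert space `H = ℝ × L²([-T,0]; ℝ)`, with the Hilbert (that is, `ℓ²`) product norm.
An element is written `η = (η₀, η₁)`, with `η₀ = η.fst` and `η₁ = η.snd`. -/
abbrev H (T : ℝ) : Type := WithLp 2 (ℝ × Lp ℝ 2 (delayMeasure T))

/-- `H₊ = (0,∞) × L²([-T,0]; ℝ)`. -/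
def Hplus (T : ℝ) : Set (H T) := {η | 0 < η.fst}

/-- `(x(t), x(t+ξ)|_{ξ ∈ [-T,0]})`, as an element of `H`. The second component is set to `0` when
`ξ ↦ x(t+ξ)` is not square integrable on `[-T,0]`, which does not happen for `t ≥ 0` if `x` is
continuous on `[0,∞)` and square integrable on `[-T,0]`. -/
def stateSegment (T : ℝ) (x : ℝ → ℝ) (t : ℝ) : H T :=
  open Classical in
  WithLp.toLp 2 (x t,
    if h : MemLp (fun ξ => x (t + ξ)) 2 (delayMeasure T) then h.toLp _ else 0)

/-- `a ∈ W^{1,2}([-T,0]; ℝ)`, for the continuous representative: `a` is absolutely continuous on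
`[-T,0]` with derivative `a'` in `L²`. -/
def IsW12 (T : ℝ) (a : ℝ → ℝ) : Prop :=
  ∃ a' : ℝ → ℝ, MemLp a' 2 (delayMeasure T) ∧
    ∀ ξ ∈ Icc (-T) 0, a ξ = a (-T) + ∫ s in (-T)..ξ, a' s

/-- The data of the control problem: the delay `T`, the rate `r`, the discount rate `ρ`, the
Lipschitz constant `Cf` of `f₀`, the kernel `a`, the function `f₀` (only its values on
`[0,∞) × ℝ` matter), and the utilities `U₁` (on `[0,∞)`) and `U₂` (on `(0,∞)`). -/
structure Problem where
  T : ℝ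
  r : ℝ
  ρ : ℝ
  Cf : ℝ
  a : ℝ → ℝ
  f₀ : ℝ → ℝ → ℝ
  U₁ : ℝ → ℝ
  U₂ : ℝ → ℝ

namespace Problem

/-- The standing assumptions on the data. -/
structure Standing (P : Problem) : Prop where
  T_pos : 0 < P.T
  r_nonneg : 0 ≤ P.r
  ρ_pos : 0 < P.ρ
  a_W12 : IsW12 P.T P.a
  a_nonneg : ∀ ξ ∈ Icc (-P.T) 0, 0 ≤ P.a ξ
  a_left : P.a (-P.T) = 0
  f₀_concave : ConcaveOn ℝ (Ici (0 : ℝ) ×ˢ (univ : Set ℝ)) (fun z : ℝ × ℝ => P.f₀ z.1 z.2)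
  f₀_mono : ∀ x, 0 ≤ x → Monotone (P.f₀ x)
  f₀_lipschitz : ∀ x x' y y' : ℝ, 0 ≤ x → 0 ≤ x' →
    |P.f₀ x y - P.f₀ x' y'| ≤ P.Cf * (|x - x'| + |y - y'|)
  f₀_pos : ∀ y, 0 < y → 0 < P.f₀ 0 y
  U₁_cont : ContinuousOn P.U₁ (Ici 0)
  U₁_C2 : ContDiffOn ℝ 2 P.U₁ (Ioi 0)
  U₁_deriv_pos : ∀ c, 0 < c → 0 < deriv P.U₁ c
  U₁_deriv_zero : Tendsto (deriv P.U₁) (𝓝[>] 0) atTop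
  U₁_deriv2_neg : ∀ c, 0 < c → deriv (deriv P.U₁) c < 0
  U₁_bounded : ∃ B, ∀ c, 0 ≤ c → |P.U₁ c| ≤ B
  U₂_cont : ContinuousOn P.U₂ (Ioi 0)
  U₂_mono : MonotoneOn P.U₂ (Ioi 0)
  U₂_concave : ConcaveOn ℝ (Ioi 0) P.U₂
  U₂_bddAbove : ∃ B, ∀ x, 0 < x → P.U₂ x ≤ B
  /-- `∫₀^∞ e^{-ρt} U₂(e^{-Cf t}) dt > -∞`: as `U₂` is bounded above, this is integrability. -/
  U₂_integrable : IntegrableOn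
    (fun t => Real.exp (-P.ρ * t) * P.U₂ (Real.exp (-P.Cf * t))) (Ioi 0)

variable (P : Problem)

/-- `x` solves on `[0,∞)` the delay equation
`x'(t) = r x(t) + f₀(x(t), ∫_{-T}^0 a(ξ) x(t+ξ) dξ) - c(t)`, `x(0) = η₀`, `x = η₁` on `[-T,0)`,
in integral form. -/
structure IsSolution (η : H P.T) (c x : ℝ → ℝ) : Prop where
  continuousOn : ContinuousOn x (Ici 0)
  initial : ∀ᵐ s ∂(delayMeasure P.T), x s = η.snd s
  equation : ∀ t, 0 ≤ t →
    x t = η.fst + (∫ s in (0 : ℝ)..t, P.r * x s)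
      + (∫ s in (0 : ℝ)..t, P.f₀ (x s) (∫ ξ in (-P.T)..0, P.a ξ * x (s + ξ)))
      - ∫ s in (0 : ℝ)..t, c s

/-- `x` is a solution that satisfies the state constraint `x > 0` on `[0,∞)`. -/
def IsPositiveSolution (η : H P.T) (c x : ℝ → ℝ) : Prop :=
  P.IsSolution η c x ∧ ∀ t, 0 ≤ t → 0 < x t

/-- The admissible controls `𝒞(η)`: nonnegative, locally integrable on `[0,∞)`, and such that the
state stays strictly positive. -/
def admissible (η : H P.T) : Set (ℝ → ℝ) :=
  {c | (∀ t, 0 ≤ t → 0 ≤ c t) ∧ LocallyIntegrableOn c (Ici 0) ∧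
    ∃ x, P.IsPositiveSolution η c x}

/-- The state `x(·; η, c)` for an admissible control `c`: the positive solution of the state
equation, which is unique on `[0,∞)`. -/
def state (η : H P.T) (c : ℝ → ℝ) : ℝ → ℝ :=
  Classical.epsilon (P.IsPositiveSolution η c)

/-- The running payoff `e^{-ρt} [U₁(c(t)) + U₂(x(t))]` with `x = x(·; η, c)`. -/
def payoff (η : H P.T) (c : ℝ → ℝ) (t : ℝ) : ℝ :=
  Real.exp (-P.ρ * t) * (P.U₁ (c t) + P.U₂ (P.state η c t))

/-- The functional `J(η; c) = ∫₀^∞ e^{-ρt} [U₁(c(t)) + U₂(x(t))] dt ∈ [-∞, ∞)`. For admissible `c`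
the integrand is measurable and bounded above by an integrable function, so that the integral is
`-∞` whenever the integrand is not integrable. -/
def J (η : H P.T) (c : ℝ → ℝ) : EReal :=
  open Classical in
  if IntegrableOn (P.payoff η c) (Ioi 0) then ((∫ t in Ioi (0 : ℝ), P.payoff η c t : ℝ) : EReal)
  else ⊥

/-- The value function `V(η) = sup_{c ∈ 𝒞(η)} J(η; c)`, with `sup ∅ = -∞`. -/
def V (η : H P.T) : EReal := ⨆ c ∈ P.admissible η, P.J η c

/-- The domain `𝒟(V) = {η ∈ H₊ | V(η) > -∞}`. -/
def domV : Set (H P.T) := {η | η ∈ Hplus P.T ∧ ⊥ < P.V η}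

/-- The derivative `V_{η₀}(η)` of `V` at `η` in the direction `(1, 0)`. -/
def V₀ (η : H P.T) : ℝ :=
  deriv (fun s : ℝ => (P.V (WithLp.toLp 2 (s, η.snd))).toReal) η.fst

/-- `c` maximizes `U₁(c) - c V_{η₀}(η)` over `c ≥ 0`. -/
def IsFeedbackValue (η : H P.T) (c : ℝ) : Prop :=
  0 ≤ c ∧ IsMaxOn (fun c' => P.U₁ c' - c' * P.V₀ η) (Ici 0) c

/-- The feedback map `C(η) = argmax_{c ≥ 0} (U₁(c) - c V_{η₀}(η))`; it is used for `η ∈ 𝒟(V)` only,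
where the maximizer exists and is unique. -/
def feedback (η : H P.T) : ℝ := Classical.epsilon (P.IsFeedbackValue η)

/-- The strategy `t ↦ C((x(t), x(t+·)))`. -/
def feedbackStrategy (x : ℝ → ℝ) (t : ℝ) : ℝ := P.feedback (stateSegment P.T x t)

/-- `x` solves the closed-loop equation
`x'(t) = r x(t) + f₀(x(t), ∫_{-T}^0 a(ξ) x(t+ξ) dξ) - C((x(t), x(t+·)))`, `x(0) = η₀`, `x = η₁` on
`[-T,0)`. As `C` is a map on `𝒟(V)`, this comprises `(x(t), x(t+·)) ∈ 𝒟(V)` for `t ≥ 0`. -/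
structure IsClosedLoopSolution (η : H P.T) (x : ℝ → ℝ) : Prop where
  mem_domV : ∀ t, 0 ≤ t → stateSegment P.T x t ∈ P.domV
  isSolution : P.IsSolution η (P.feedbackStrategy x) x

/-- `c` is optimal for the initial state `η`. -/
def IsOptimal (η : H P.T) (c : ℝ → ℝ) : Prop :=
  η ∈ P.domV ∧ c ∈ P.admissible η ∧ P.J η c = P.V η

end Problem

end DelayControl

end

noncomputable section

namespace DelayControl.Problem

/-! The past enters the dynamics only through its contribution to the delayed term, the function `f
s = ∫ a(u - s) η₁(u) du`. The problem is therefore posed on pairs (current state, contribution of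
the past) in the Banach space `ℝ × C([0, horizon])`. This space is larger than the image of `H`: it
also contains states that precede a given one along a prescribed short arc, whether or not a square
integrable past produces them.

There the value `val` is concave (`gain_combo`), has an open domain on which it is locally bounded
below (`exists_gain_ge_near`) and hence continuous, and is strictly increasing in the current state
(`exists_gain_add`). So it has supporting functionals `L`, and each has a positive slope `L dir`.

At a state whose past contribution is continuously differentiable, every supporting functional
satisfies the Hamilton-Jacobi-Bellman equation. Following a nearly optimal control forwards gives
one inequality (`hjb_le`). The other comes from a slightly earlier state that reaches the given one
with a control close to a constant (`le_hjb`); the earlier state is needed because `L` bounds the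
value only from above. Applying the equation to two supporting functionals and to their midpoint
forces equal slopes in the direction `dir` (`support_slope_unique`), so the value is differentiable
there, with derivative `V₀`. The hypothesis `a ∈ W^{1,2}` with `a(-T) = 0` makes every square
integrable past differentiable in this sense (`exists_isSmoothPast_pastOf`).

Along a closed-loop trajectory `z`, the control solves `U₁'(c) = V₀` and is continuous, since slopes
of supporting lines vary continuously where the value is differentiable. For a supporting functional
`L` at `z t`, concavity gives `val (z s) ≤ val (z t) + L (z s - z t)` for `s < t`. With `hjb_le` it
follows that `e^{-ρt} val (z t) + ∫₀ᵗ pay` is nondecreasing, without any derivative of `val` along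
the path. As `val` is bounded above, `t → ∞` yields a payoff of at least `val (z 0)`; the reverse
inequality holds by definition of the value. -/

theorem integrableOn_Ioi_comp_add {g : ℝ → ℝ} {τ : ℝ} (hg : IntegrableOn g (Ioi τ)) :
    IntegrableOn (fun t => g (t + τ)) (Ioi 0) := by
  have := ((measurePreserving_add_right volume τ).integrableOn_comp_preimage
    (measurableEmbedding_addRight τ)).2 hg
  rwa [preimage_add_const_Ioi, sub_self] at this

theorem integral_Ioi_comp_add (g : ℝ → ℝ) (τ : ℝ) :
    ∫ t in Ioi 0, g (t + τ) = ∫ t in Ioi τ, g t := by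
  have := (measurePreserving_add_right volume τ).setIntegral_preimage_emb
    (measurableEmbedding_addRight τ) g (Ioi τ)
  rwa [preimage_add_const_Ioi, sub_self] at this

/-! ### The kernel and the growth map -/

variable {P : Problem}

variable (P) in
/-- The kernel `a`, extended to `ℝ` by its boundary values. -/
def kern (v : ℝ) : ℝ := P.a (max (-P.T) (min v 0))

variable (P) in
/-- The delayed term at time `s` of a trajectory `x` on `[0, ∞)` whose past contributes `f`. -/
def mem (f x : ℝ → ℝ) (s : ℝ) : ℝ := f s + ∫ u in (0 : ℝ)..s, P.kern (u - s) * x u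

variable (P) in
/-- `r x + f₀(x, mem)`, with `f₀` extended to negative arguments by its boundary value. -/
def growth (x y : ℝ) : ℝ := P.r * x + P.f₀ (max x 0) y

theorem IsW12.continuousOn {T : ℝ} {a : ℝ → ℝ} (hT : 0 < T) (ha : IsW12 T a) :
    ContinuousOn a (Icc (-T) 0) := by
  obtain ⟨a', ha', h⟩ := ha
  have hi : IntegrableOn a' (Icc (-T) 0) := ha'.integrable (by norm_num)
  have h1 : ContinuousOn (fun ξ => a (-T) + ∫ s in (-T)..ξ, a' s) (Icc (-T) 0) := by
    have := intervalIntegral.continuousOn_primitive_interval (μ := volume) (f := a') (a := -T)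
      (b := 0) (by rwa [uIcc_of_le (by linarith)])
    rw [uIcc_of_le (by linarith)] at this
    exact continuousOn_const.add this
  exact h1.congr h

namespace Standing

variable (hP : P.Standing)
include hP

theorem uniformContinuous_kern : UniformContinuous P.kern := by
  have h1 : ContinuousOn P.a (Icc (-P.T) 0) := IsW12.continuousOn hP.T_pos hP.a_W12
  have h2 : UniformContinuousOn P.a (Icc (-P.T) 0) :=
    isCompact_Icc.uniformContinuousOn_of_continuous h1
  have h3 : UniformContinuous (fun v : ℝ => max (-P.T) (min v 0)) :=
    ((LipschitzWith.id.min_const 0).const_max (-P.T)).uniformContinuous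
  rw [Metric.uniformContinuous_iff] at h3 ⊢
  rw [Metric.uniformContinuousOn_iff] at h2
  have hm : ∀ v : ℝ, max (-P.T) (min v 0) ∈ Icc (-P.T) 0 := fun v =>
    ⟨le_max_left _ _, max_le (by linarith [hP.T_pos]) (min_le_right _ _)⟩
  intro ε hε
  obtain ⟨δ, hδ, h⟩ := h2 ε hε
  obtain ⟨δ', hδ', h'⟩ := h3 δ hδ
  exact ⟨δ', hδ', fun a b hab => h _ (hm a) _ (hm b) (h' hab)⟩

theorem continuous_kern : Continuous P.kern := hP.uniformContinuous_kern.continuous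

omit hP in
theorem kern_eq {v : ℝ} (hv : v ∈ Icc (-P.T) 0) : P.kern v = P.a v := by
  simp [kern, min_eq_left hv.2, max_eq_right hv.1]

theorem kern_nonneg (v : ℝ) : 0 ≤ P.kern v :=
  hP.a_nonneg _ ⟨le_max_left _ _, max_le (by linarith [hP.T_pos]) (min_le_right _ _)⟩

theorem kern_of_le {v : ℝ} (hv : v ≤ -P.T) : P.kern v = 0 := by
  have : min v 0 ≤ -P.T := (min_le_left _ _).trans hv
  simp [kern, max_eq_left this, hP.a_left]

theorem exists_kern_le : ∃ A, 0 < A ∧ ∀ v, P.kern v ≤ A := by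
  obtain ⟨B, hB⟩ := isCompact_Icc.bddAbove_image (IsW12.continuousOn hP.T_pos hP.a_W12)
  refine ⟨max B 1, by positivity, fun v => le_max_of_le_left (hB ⟨_, ?_, rfl⟩)⟩
  exact ⟨le_max_left _ _, max_le (by linarith [hP.T_pos]) (min_le_right _ _)⟩

theorem Cf_nonneg : 0 ≤ P.Cf := by
  have := hP.f₀_lipschitz 0 1 0 0 le_rfl zero_le_one
  have h2 := abs_nonneg (P.f₀ 0 0 - P.f₀ 1 0)
  norm_num at this
  linarith

theorem growth_lipschitz (x x' y y' : ℝ) :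
    |P.growth x y - P.growth x' y'| ≤ (P.r + P.Cf) * |x - x'| + P.Cf * |y - y'| := by
  have h1 := hP.f₀_lipschitz (max x 0) (max x' 0) y y' (le_max_right _ _) (le_max_right _ _)
  have h2 : |max x 0 - max x' 0| ≤ |x - x'| := abs_max_sub_max_le_abs x x' 0
  have h3 := mul_le_mul_of_nonneg_left h2 hP.Cf_nonneg
  have h4 : P.growth x y - P.growth x' y' =
      P.r * (x - x') + (P.f₀ (max x 0) y - P.f₀ (max x' 0) y') := by unfold growth; ring
  rw [h4]
  calc _ ≤ |P.r * (x - x')| + |P.f₀ (max x 0) y - P.f₀ (max x' 0) y'| := abs_add_le _ _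
    _ ≤ _ := by rw [abs_mul, abs_of_nonneg hP.r_nonneg]; linarith

theorem continuous_growth : Continuous (fun z : ℝ × ℝ => P.growth z.1 z.2) := by
  rw [continuous_iff_continuousAt]
  rintro ⟨x, y⟩
  rw [ContinuousAt, tendsto_iff_dist_tendsto_zero]
  have h : Tendsto (fun z : ℝ × ℝ => (P.r + P.Cf) * |z.1 - x| + P.Cf * |z.2 - y|) (𝓝 (x, y))
      (𝓝 0) := by
    have : Continuous (fun z : ℝ × ℝ => (P.r + P.Cf) * |z.1 - x| + P.Cf * |z.2 - y|) := by
      fun_prop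
    simpa using this.tendsto (x, y)
  exact squeeze_zero (fun _ => dist_nonneg)
    (fun z => by rw [Real.dist_eq]; exact hP.growth_lipschitz _ _ _ _) h

theorem growth_mono {x y y' : ℝ} (h : y ≤ y') : P.growth x y ≤ P.growth x y' := by
  unfold growth
  have := hP.f₀_mono (max x 0) (le_max_right _ _) h
  linarith

/-- Limit of `f₀ 0 y > 0` as `y` decreases to `0`, made quantitative by the Lipschitz constant. -/
theorem f₀_zero_nonneg : 0 ≤ P.f₀ 0 0 := by
  refine le_of_forall_pos_le_add fun ε hε => ?_
  have hC := hP.Cf_nonneg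
  have hy : 0 < ε / (P.Cf + 1) := by positivity
  have h1 := hP.f₀_lipschitz 0 0 0 (ε / (P.Cf + 1)) le_rfl le_rfl
  have h2 := hP.f₀_pos _ hy
  rw [abs_le] at h1
  have h3 : P.Cf * (|0 - 0| + |0 - ε / (P.Cf + 1)|) ≤ ε := by
    rw [sub_self, abs_zero, zero_add, zero_sub, abs_neg, abs_of_pos hy, mul_div_assoc', div_le_iff₀ (by positivity)]
    nlinarith
  linarith [h1.1]

/-- Consequence: with a nonnegative delayed term, decay at rate `Cf` is always affordable with
nonnegative consumption. This is where the integrability hypothesis on `U₂` along `e^{-Cf t}`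
becomes usable. -/
theorem growth_lower {x y : ℝ} (hx : 0 ≤ x) (hy : 0 ≤ y) : -P.Cf * x ≤ P.growth x y := by
  have h1 := hP.f₀_mono x hx hy
  have h2 := hP.f₀_lipschitz x 0 0 0 hx le_rfl
  simp only [sub_zero, abs_zero, add_zero, abs_of_nonneg hx] at h2
  have h3 := hP.f₀_zero_nonneg
  have h4 := mul_nonneg hP.r_nonneg hx
  rw [growth, max_eq_left hx]
  linarith [(abs_le.1 h2).1]

theorem growth_concave {x x' y y' s t : ℝ} (hx : 0 ≤ x) (hx' : 0 ≤ x') (hs : 0 ≤ s) (ht : 0 ≤ t)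
    (hst : s + t = 1) :
    s * P.growth x y + t * P.growth x' y' ≤ P.growth (s * x + t * x') (s * y + t * y') := by
  have := hP.f₀_concave.2 (x := (x, y)) (y := (x', y')) ⟨hx, trivial⟩ ⟨hx', trivial⟩ hs ht hst
  simp only [smul_eq_mul, Prod.smul_mk, Prod.mk_add_mk] at this
  unfold growth
  rw [max_eq_left hx, max_eq_left hx', max_eq_left (by positivity)]
  linarith

theorem continuous_conv {x : ℝ → ℝ} (hx : Continuous x) (b : ℝ) :
    Continuous (fun s => ∫ u in (0 : ℝ)..b, P.kern (u - s) * x u) := by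
  apply intervalIntegral.continuous_parametric_intervalIntegral_of_continuous' (μ := volume)
  have := hP.continuous_kern
  fun_prop

theorem continuous_mem {f x : ℝ → ℝ} (hf : Continuous f) (hx : Continuous x) :
    Continuous (P.mem f x) := by
  refine hf.add ?_
  apply intervalIntegral.continuous_parametric_intervalIntegral_of_continuous (μ := volume)
    (f := fun s u => P.kern (u - s) * x u) _ continuous_id
  have := hP.continuous_kern
  fun_prop

theorem continuous_growth_mem {f x : ℝ → ℝ} (hf : Continuous f) (hx : Continuous x) :
    Continuous (fun s => P.growth (x s) (P.mem f x s)) :=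
  hP.continuous_growth.comp (hx.prodMk (hP.continuous_mem hf hx))

/-! ### The utilities -/

theorem exists_utility_bounds : ∃ M, 0 < M ∧ (∀ c, 0 ≤ c → |P.U₁ c| ≤ M) ∧
    ∀ c x, 0 ≤ c → 0 < x → P.U₁ c + P.U₂ x ≤ M := by
  obtain ⟨B, hB⟩ := hP.U₁_bounded
  obtain ⟨B', hB'⟩ := hP.U₂_bddAbove
  refine ⟨|B| + |B'| + 1, by positivity, fun c hc => ?_, fun c x hc hx => ?_⟩
  · linarith [hB c hc, le_abs_self B, abs_nonneg B']
  · linarith [(abs_le.1 (hB c hc)).2, hB' x hx, le_abs_self B, le_abs_self B']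

theorem hasDerivAt_U₁ {c : ℝ} (hc : 0 < c) : HasDerivAt P.U₁ (deriv P.U₁ c) c := by
  have h := hP.U₁_C2.contDiffAt (Ioi_mem_nhds hc)
  exact (h.differentiableAt (by norm_num)).hasDerivAt

theorem continuousOn_deriv_U₁ : ContinuousOn (deriv P.U₁) (Ioi 0) :=
  hP.U₁_C2.continuousOn_deriv_of_isOpen isOpen_Ioi (by norm_num)

theorem strictAntiOn_deriv_U₁ : StrictAntiOn (deriv P.U₁) (Ioi 0) := by
  apply strictAntiOn_of_deriv_neg (convex_Ioi 0) hP.continuousOn_deriv_U₁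
  intro x hx
  rw [interior_Ioi] at hx
  exact hP.U₁_deriv2_neg x hx

theorem strictConcaveOn_U₁ : StrictConcaveOn ℝ (Ici 0) P.U₁ := by
  apply strictConcaveOn_of_deriv2_neg (convex_Ici 0) hP.U₁_cont
  intro x hx
  rw [interior_Ici] at hx
  exact hP.U₁_deriv2_neg x hx

theorem strictMonoOn_U₁ : StrictMonoOn P.U₁ (Ici 0) := by
  apply strictMonoOn_of_deriv_pos (convex_Ici 0) hP.U₁_cont
  intro x hx
  rw [interior_Ici] at hx
  exact hP.U₁_deriv_pos x hx

theorem U₁_le_tangent {c k : ℝ} (hc : 0 ≤ c) (hk : 0 < k) :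
    P.U₁ c ≤ P.U₁ k + deriv P.U₁ k * (c - k) := by
  have hconc := hP.strictConcaveOn_U₁.concaveOn
  have hd := hP.hasDerivAt_U₁ hk
  rcases lt_trichotomy c k with h | h | h
  · have := hconc.le_slope_of_hasDerivAt (x := c) (y := k) hc hk.le h hd
    rw [slope_def_field, le_div_iff₀ (by linarith)] at this
    linarith
  · simp [h]
  · have := hconc.slope_le_of_hasDerivAt (x := k) (y := c) hk.le hc h hd
    rw [slope_def_field, div_le_iff₀ (by linarith)] at this
    linarith

/-- `U₁'` is continuous, exceeds `p` near `0`, and cannot stay above `p` because `U₁` is bounded. -/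
theorem exists_deriv_U₁_eq {p : ℝ} (hp : 0 < p) : ∃ k, 0 < k ∧ deriv P.U₁ k = p := by
  obtain ⟨M, hM, hB, -⟩ := hP.exists_utility_bounds
  have h1 : ∃ c, 0 < c ∧ p < deriv P.U₁ c := by
    have := (hP.U₁_deriv_zero.eventually_gt_atTop p).and (self_mem_nhdsWithin)
    obtain ⟨c, h, hc⟩ := this.exists
    exact ⟨c, hc, h⟩
  obtain ⟨c₁, hc₁, h1⟩ := h1
  have h2 : ∃ c, 0 < c ∧ deriv P.U₁ c < p := by
    by_contra! hcon
    -- If `U₁' ≥ p` everywhere, the tangent at this point evaluated at `0` makes `U₁` vary by at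
    -- least `2 M + p`, more than the bound `M` on `|U₁|` permits.
    have hk : 0 < 2 * M / p + 1 := by positivity
    have ht := hP.U₁_le_tangent (c := 0) le_rfl hk
    have h3 := (abs_le.1 (hB 0 le_rfl)).1
    have h4 := (abs_le.1 (hB _ hk.le)).2
    have h5 := mul_le_mul_of_nonneg_right (hcon _ hk) hk.le
    have h6 : p * (2 * M / p + 1) = 2 * M + p := by field_simp
    linarith
  obtain ⟨c₂, hc₂, h2⟩ := h2
  have hpc : IsPreconnected (Ioi (0 : ℝ)) := isPreconnected_Ioi
  obtain ⟨k, hk, hkp⟩ := hpc.intermediate_value hc₂ hc₁ hP.continuousOn_deriv_U₁ ⟨h2.le, h1.le⟩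
  exact ⟨k, hk, hkp⟩

theorem deriv_U₁_eq_of_isMax {k p : ℝ} (hk : 0 < k)
    (h : ∀ c, 0 < c → P.U₁ c - c * p ≤ P.U₁ k - k * p) : deriv P.U₁ k = p := by
  have hloc : IsLocalMax (fun c => P.U₁ c - c * p) k := by
    filter_upwards [Ioi_mem_nhds hk] with c hc using h c hc
  have hd : HasDerivAt (fun c => P.U₁ c - c * p) (deriv P.U₁ k - 1 * p) k :=
    (hP.hasDerivAt_U₁ hk).sub ((hasDerivAt_id k).mul_const p)
  have := hloc.hasDerivAt_eq_zero hd
  linarith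

/-- The maximizers of `U₁(c) - c p` over `c ≥ 0` are interior, and are the `c` with
`U₁'(c) = p`. -/
theorem isMaxOn_U₁_sub_iff {c p : ℝ} (hc : 0 ≤ c) :
    IsMaxOn (fun c' => P.U₁ c' - c' * p) (Ici 0) c ↔ 0 < c ∧ deriv P.U₁ c = p := by
  constructor
  · intro h
    have hpos : 0 < c := by
      rcases hc.lt_or_eq with h0 | h0
      · exact h0
      · exfalso
        subst h0
        obtain ⟨d, hd1, hd⟩ := ((hP.U₁_deriv_zero.eventually_gt_atTop p).and
          (self_mem_nhdsWithin)).exists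
        have hd : 0 < d := hd
        have h1 := hP.U₁_le_tangent (c := 0) le_rfl hd
        have h2 := h (show (d : ℝ) ∈ Ici 0 from hd.le)
        simp only [mem_ofPred_eq] at h2
        nlinarith
    exact ⟨hpos, hP.deriv_U₁_eq_of_isMax hpos fun d hd => h (show d ∈ Ici 0 from hd.le)⟩
  · rintro ⟨hpos, hd⟩ d hd0
    have := hP.U₁_le_tangent (c := d) hd0 hpos
    rw [hd] at this
    simp only [mem_ofPred_eq]
    linarith

theorem continuous_U₁_max : Continuous (fun c => P.U₁ (max c 0)) :=
  hP.U₁_cont.comp_continuous (by fun_prop) fun c => mem_Ici.2 (le_max_right c 0)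

/-- The hypothesis on `U₂` along exponentially decaying states of any size. -/
theorem integrableOn_U₂_exp {m : ℝ} (hm : 0 < m) :
    IntegrableOn (fun t => Real.exp (-P.ρ * t) * P.U₂ (m * Real.exp (-P.Cf * t))) (Ioi 0) := by
  obtain ⟨B, hB⟩ := hP.U₂_bddAbove
  have hexp : IntegrableOn (fun t => Real.exp (-P.ρ * t)) (Ioi 0) :=
    integrableOn_exp_mul_Ioi (by linarith [hP.ρ_pos]) 0
  rcases hP.Cf_nonneg.eq_or_lt with h0 | h0
  · simp only [← h0, neg_zero, zero_mul, Real.exp_zero, mul_one]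
    exact hexp.mul_const _
  · have hcont : Continuous (fun t => Real.exp (-P.ρ * t) * P.U₂ (m * Real.exp (-P.Cf * t))) :=
      (by fun_prop : Continuous fun t => Real.exp (-P.ρ * t)).mul
        (hP.U₂_cont.comp_continuous (by fun_prop) fun t => mem_Ioi.2 (by positivity))
    -- A time shift absorbs the factor `m`: this `τ` gives `e^{-Cf τ} ≤ m`, so the shifted
    -- hypothesis is a lower bound by monotonicity of `U₂`.
    set τ := |Real.log m| / P.Cf with hτ
    have hτ0 : 0 ≤ τ := by positivity
    have hshift : IntegrableOn (fun t => Real.exp (P.ρ * τ) * (Real.exp (-P.ρ * (t + τ)) *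
        P.U₂ (Real.exp (-P.Cf * (t + τ))))) (Ioi 0) := by
      refine Integrable.const_mul ?_ _
      exact integrableOn_Ioi_comp_add (g := fun t => Real.exp (-P.ρ * t) *
        P.U₂ (Real.exp (-P.Cf * t))) (hP.U₂_integrable.mono_set (Ioi_subset_Ioi (by linarith)))
    refine integrable_of_le_of_le hcont.aestronglyMeasurable
      (g₁ := fun t => Real.exp (P.ρ * τ) * (Real.exp (-P.ρ * (t + τ)) *
        P.U₂ (Real.exp (-P.Cf * (t + τ))))) (g₂ := fun t => Real.exp (-P.ρ * t) * B)
      (ae_of_all _ fun t => ?_) (ae_of_all _ fun t => ?_) hshift (hexp.mul_const _)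
    · have h1 : Real.exp (P.ρ * τ) * (Real.exp (-P.ρ * (t + τ)) *
          P.U₂ (Real.exp (-P.Cf * (t + τ)))) =
          Real.exp (-P.ρ * t) * P.U₂ (Real.exp (-P.Cf * (t + τ))) := by
        rw [← mul_assoc, ← Real.exp_add]; ring_nf
      simp only [h1]
      refine mul_le_mul_of_nonneg_left (hP.U₂_mono (mem_Ioi.2 (by positivity))
        (mem_Ioi.2 (by positivity)) ?_) (by positivity)
      have h2 : Real.exp (-P.Cf * τ) ≤ m := by
        rw [← Real.le_log_iff_exp_le hm, hτ]
        have : -P.Cf * (|Real.log m| / P.Cf) = -|Real.log m| := by field_simp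
        rw [this]; exact neg_abs_le _
      calc Real.exp (-P.Cf * (t + τ)) = Real.exp (-P.Cf * τ) * Real.exp (-P.Cf * t) := by
            rw [← Real.exp_add]; ring_nf
        _ ≤ _ := by gcongr
    · exact mul_le_mul_of_nonneg_left (hB _ (by positivity)) (by positivity)

end Standing

/-! ### Trajectories, concatenation and dynamic programming -/

variable (P) in
/-- `x` is a positive trajectory on `[0,h]` with nonnegative control `c`, started at `x₀` with the
contribution `f` of the past to the delayed term. -/
structure IsArc (h x₀ : ℝ) (f c x : ℝ → ℝ) : Prop where
  cont : Continuous x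
  pos : ∀ t ∈ Icc 0 h, 0 < x t
  nonneg : ∀ t ∈ Icc 0 h, 0 ≤ c t
  int : IntervalIntegrable c volume 0 h
  eq : ∀ t ∈ Icc 0 h, x t = x₀ + ∫ s in (0 : ℝ)..t, (P.growth (x s) (P.mem f x s) - c s)

variable (P) in
/-- `x` is a positive trajectory on `[0,∞)` with nonnegative control `c`. -/
def IsFeasible (x₀ : ℝ) (f c x : ℝ → ℝ) : Prop := ∀ h, 0 ≤ h → P.IsArc h x₀ f c x

variable (P) in
/-- The running payoff along the trajectory `x` with control `c`. -/
def pay (c x : ℝ → ℝ) (t : ℝ) : ℝ := Real.exp (-P.ρ * t) * (P.U₁ (c t) + P.U₂ (x t))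

variable (P) in
/-- `j` is the finite payoff of some control. -/
def IsGain (x₀ : ℝ) (f : ℝ → ℝ) (j : ℝ) : Prop :=
  ∃ c x, P.IsFeasible x₀ f c x ∧ IntegrableOn (P.pay c x) (Ioi 0) ∧ j = ∫ t in Ioi 0, P.pay c x t

variable (P) in
/-- The contribution of the past to the delayed term after following `x` for time `h`. -/
def pastAfter (f x : ℝ → ℝ) (h s : ℝ) : ℝ := f (h + s) + ∫ u in (0 : ℝ)..h, P.kern (u - h - s) * x u

theorem mem_congr {f f' x x' : ℝ → ℝ} {s : ℝ} (hs : 0 ≤ s) (hf : f s = f' s)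
    (h : ∀ u ∈ Icc 0 s, x u = x' u) : P.mem f x s = P.mem f' x' s := by
  unfold mem
  rw [hf]
  congr 1
  refine intervalIntegral.integral_congr fun u hu => ?_
  rw [uIcc_of_le hs] at hu
  simp only [h u hu]

namespace Standing
variable (hP : P.Standing)
include hP

/-- Flow property: a trajectory can be restarted at time `h`, with the part already travelled
absorbed into the past. -/
theorem mem_add {f x : ℝ → ℝ} (hx : Continuous x) (h s : ℝ) :
    P.mem f x (h + s) = P.mem (P.pastAfter f x h) (fun u => x (h + u)) s := by
  have hk := hP.continuous_kern
  have hc : Continuous fun u => P.kern (u - (h + s)) * x u := by fun_prop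
  have h1 := intervalIntegral.integral_add_adjacent_intervals
    (hc.intervalIntegrable (μ := volume) 0 h) (hc.intervalIntegrable h (h + s))
  have h2 : ∫ u in (0 : ℝ)..s, P.kern (u - s) * x (h + u) =
      ∫ u in h..(h + s), P.kern (u - (h + s)) * x u := by
    have := intervalIntegral.integral_comp_add_left (a := 0) (b := s)
      (fun u => P.kern (u - (h + s)) * x u) h
    rw [add_zero] at this
    rw [← this]
    refine intervalIntegral.integral_congr fun u _ => ?_
    simp only [add_sub_add_left_eq_sub]
  simp only [mem, pastAfter]
  rw [h2, ← h1]
  simp only [sub_sub]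
  ring

theorem continuous_pastAfter {f x : ℝ → ℝ} (hf : Continuous f) (hx : Continuous x) (h : ℝ) :
    Continuous (P.pastAfter f x h) := by
  have := (hP.continuous_conv hx h).comp (continuous_const_add h)
  have h2 : P.pastAfter f x h = fun s => f (h + s) + ∫ u in (0 : ℝ)..h, P.kern (u - (h + s)) * x u := by
    ext s; simp only [pastAfter, sub_sub]
  rw [h2]
  exact (hf.comp (continuous_const_add h)).add this

theorem pastAfter_eq_zero {f x : ℝ → ℝ} {h S : ℝ} (hh : 0 ≤ h) (hS : P.T ≤ S)
    (hf : ∀ s, S ≤ s → f s = 0) {s : ℝ} (hs : S ≤ s) : P.pastAfter f x h s = 0 := by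
  unfold pastAfter
  rw [hf _ (by linarith), zero_add, intervalIntegral.integral_congr (g := fun _ => (0 : ℝ))]
  · simp
  · intro u hu
    rw [uIcc_of_le hh] at hu
    simp only [hP.kern_of_le (v := u - h - s) (by linarith [hu.2]), zero_mul]

end Standing

namespace IsArc
variable {h x₀ : ℝ} {f c x : ℝ → ℝ}

theorem init (hx : P.IsArc h x₀ f c x) (hh : 0 ≤ h) : x 0 = x₀ := by
  simpa using hx.eq 0 ⟨le_rfl, hh⟩

theorem mono (hx : P.IsArc h x₀ f c x) {h' : ℝ} (h0 : 0 ≤ h') (hh : h' ≤ h) :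
    P.IsArc h' x₀ f c x where
  cont := hx.cont
  pos t ht := hx.pos t ⟨ht.1, ht.2.trans hh⟩
  nonneg t ht := hx.nonneg t ⟨ht.1, ht.2.trans hh⟩
  int := hx.int.mono_set (by rw [uIcc_of_le h0, uIcc_of_le (h0.trans hh)]; exact Icc_subset_Icc_right hh)
  eq t ht := hx.eq t ⟨ht.1, ht.2.trans hh⟩

theorem congr {f' : ℝ → ℝ} (hx : P.IsArc h x₀ f c x) (hf : ∀ s, 0 ≤ s → f s = f' s) :
    P.IsArc h x₀ f' c x where
  cont := hx.cont
  pos := hx.pos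
  nonneg := hx.nonneg
  int := hx.int
  eq t ht := by
    rw [hx.eq t ht]
    congr 1
    refine intervalIntegral.integral_congr fun s hs => ?_
    rw [uIcc_of_le ht.1] at hs
    simp only [mem_congr (P := P) (x := x) hs.1 (hf s hs.1) fun _ _ => rfl]

theorem integrable_drift (hx : P.IsArc h x₀ f c x) (hP : P.Standing) (hf : Continuous f) :
    IntervalIntegrable (fun s => P.growth (x s) (P.mem f x s) - c s) volume 0 h :=
  ((hP.continuous_growth_mem hf hx.cont).intervalIntegrable _ _).sub hx.int

/-- The source of all comparison trajectories: the path is prescribed, and the control is defined as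
the growth that the path leaves unused. Admissibility then reduces to a pointwise inequality for the
drift, and no differential equation has to be solved. -/
theorem of_drift (hP : P.Standing) (hf : Continuous f) (hx : Continuous x) {d : ℝ → ℝ}
    (hd : IntervalIntegrable d volume 0 h) (heq : ∀ t ∈ Icc 0 h, x t = x₀ + ∫ s in (0 : ℝ)..t, d s)
    (hpos : ∀ t ∈ Icc 0 h, 0 < x t) (hle : ∀ t ∈ Icc 0 h, d t ≤ P.growth (x t) (P.mem f x t)) :
    P.IsArc h x₀ f (fun t => P.growth (x t) (P.mem f x t) - d t) x where
  cont := hx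
  pos := hpos
  nonneg t ht := sub_nonneg.2 (hle t ht)
  int := ((hP.continuous_growth_mem hf hx).intervalIntegrable _ _).sub hd
  eq t ht := by simpa using heq t ht

/-- An arc whose trajectory has a continuous derivative. -/
theorem of_hasDerivAt (hP : P.Standing) (hf : Continuous f) {d : ℝ → ℝ}
    (hd : Continuous d) (heq : ∀ t, HasDerivAt x (d t) t)
    (hpos : ∀ t ∈ Icc 0 h, 0 < x t) (hle : ∀ t ∈ Icc 0 h, d t ≤ P.growth (x t) (P.mem f x t)) :
    P.IsArc h (x 0) f (fun t => P.growth (x t) (P.mem f x t) - d t) x := by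
  refine of_drift hP hf ?_ (hd.intervalIntegrable _ _) (fun t _ => ?_) hpos hle
  · exact continuous_iff_continuousAt.2 fun t => (heq t).continuousAt
  · rw [intervalIntegral.integral_eq_sub_of_hasDerivAt (fun s _ => heq s)
      (hd.intervalIntegrable _ _)]
    ring

theorem integrable_U₁ (hP : P.Standing) (hx : P.IsArc h x₀ f c x) (hh : 0 ≤ h) :
    IntervalIntegrable (fun t => P.U₁ (c t)) volume 0 h := by
  obtain ⟨M, hM, hB, -⟩ := hP.exists_utility_bounds
  have h1 := hx.int.aestronglyMeasurable
  rw [intervalIntegrable_iff_integrableOn_Ioc_of_le hh]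
  have h2 : AEStronglyMeasurable (fun t => P.U₁ (max (c t) 0)) (volume.restrict (Ioc 0 h)) :=
    hP.continuous_U₁_max.comp_aestronglyMeasurable h1
  have h3 : IntegrableOn (fun t => P.U₁ (max (c t) 0)) (Ioc 0 h) := by
    refine Integrable.mono' (integrable_const M) h2 (ae_of_all _ fun t => ?_)
    exact hB _ (le_max_right _ _)
  refine h3.congr_fun (fun t ht => ?_) measurableSet_Ioc
  simp only [max_eq_left (hx.nonneg t ⟨ht.1.le, ht.2⟩)]

theorem continuousOn_U₂ (hP : P.Standing) (hx : P.IsArc h x₀ f c x) :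
    ContinuousOn (fun t => P.U₂ (x t)) (Icc 0 h) :=
  hP.U₂_cont.comp hx.cont.continuousOn fun t ht => hx.pos t ht

theorem integrable_pay (hP : P.Standing) (hx : P.IsArc h x₀ f c x) (hh : 0 ≤ h) :
    IntervalIntegrable (P.pay c x) volume 0 h := by
  have h1 : IntervalIntegrable (fun t => P.U₂ (x t)) volume 0 h :=
    ContinuousOn.intervalIntegrable (by rw [uIcc_of_le hh]; exact hx.continuousOn_U₂ hP)
  exact ((hx.integrable_U₁ hP hh).add h1).continuousOn_mul
    (by fun_prop : Continuous fun t => Real.exp (-P.ρ * t)).continuousOn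

end IsArc

namespace IsFeasible
variable {x₀ : ℝ} {f c x : ℝ → ℝ}

theorem cont (hx : P.IsFeasible x₀ f c x) : Continuous x := (hx 0 le_rfl).cont

theorem pos (hx : P.IsFeasible x₀ f c x) {t : ℝ} (ht : 0 ≤ t) : 0 < x t :=
  (hx t ht).pos t ⟨ht, le_rfl⟩

theorem nonneg (hx : P.IsFeasible x₀ f c x) {t : ℝ} (ht : 0 ≤ t) : 0 ≤ c t :=
  (hx t ht).nonneg t ⟨ht, le_rfl⟩

theorem int (hx : P.IsFeasible x₀ f c x) {a b : ℝ} (ha : 0 ≤ a) (hb : 0 ≤ b) :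
    IntervalIntegrable c volume a b :=
  (hx a ha).int.symm.trans (hx b hb).int

theorem init (hx : P.IsFeasible x₀ f c x) : x 0 = x₀ := (hx 0 le_rfl).init le_rfl

theorem eq (hx : P.IsFeasible x₀ f c x) {t : ℝ} (ht : 0 ≤ t) :
    x t = x₀ + ∫ s in (0 : ℝ)..t, (P.growth (x s) (P.mem f x s) - c s) :=
  (hx t ht).eq t ⟨ht, le_rfl⟩

theorem integrable_pay (hP : P.Standing) (hx : P.IsFeasible x₀ f c x) {a b : ℝ} (ha : 0 ≤ a)
    (hb : 0 ≤ b) : IntervalIntegrable (P.pay c x) volume a b :=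
  ((hx a ha).integrable_pay hP ha).symm.trans ((hx b hb).integrable_pay hP hb)

theorem aestronglyMeasurable_pay (hP : P.Standing) (hx : P.IsFeasible x₀ f c x) :
    AEStronglyMeasurable (P.pay c x) (volume.restrict (Ioi 0)) := by
  have h1 : Ioi (0 : ℝ) = ⋃ n : ℕ, Ioc (0 : ℝ) n := by
    ext t
    simp only [mem_Ioi, mem_iUnion, mem_Ioc]
    refine ⟨fun h => ?_, fun ⟨n, h⟩ => h.1⟩
    obtain ⟨n, hn⟩ := exists_nat_ge t
    exact ⟨n, h, hn⟩
  rw [h1, aestronglyMeasurable_iUnion_iff]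
  intro n
  have := hx.integrable_pay hP le_rfl (Nat.cast_nonneg n)
  exact this.aestronglyMeasurable

/-- Payoffs are bounded above by a multiple of `e^{-ρt}`, so only a lower bound is at stake. -/
theorem integrableOn_of_ge (hP : P.Standing) (hx : P.IsFeasible x₀ f c x) {l : ℝ → ℝ}
    (hl : IntegrableOn l (Ioi 0)) (hle : ∀ t, 0 < t → l t ≤ P.pay c x t) :
    IntegrableOn (P.pay c x) (Ioi 0) := by
  obtain ⟨M, hM, -, hB⟩ := hP.exists_utility_bounds
  have hexp : IntegrableOn (fun t => Real.exp (-P.ρ * t) * M) (Ioi 0) :=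
    (integrableOn_exp_mul_Ioi (by linarith [hP.ρ_pos]) 0).mul_const _
  refine integrable_of_le_of_le (hx.aestronglyMeasurable_pay hP) ?_ ?_ hl hexp
  · exact (ae_restrict_mem measurableSet_Ioi).mono fun t ht => hle t ht
  · refine (ae_restrict_mem measurableSet_Ioi).mono fun t ht => ?_
    have ht : 0 < t := ht
    exact mul_le_mul_of_nonneg_left (hB _ _ (hx.nonneg ht.le) (hx.pos ht.le)) (by positivity)

theorem shift (hP : P.Standing) (hf : Continuous f) (hx : P.IsFeasible x₀ f c x) {h : ℝ}
    (hh : 0 ≤ h) :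
    P.IsFeasible (x h) (P.pastAfter f x h) (fun t => c (h + t)) (fun t => x (h + t)) := by
  intro b hb
  refine ⟨hx.cont.comp (continuous_const_add h), fun t ht => hx.pos (add_nonneg hh ht.1),
    fun t ht => hx.nonneg (add_nonneg hh ht.1), ?_, fun t ht => ?_⟩
  · have := (hx.int hh (add_nonneg hh hb)).comp_add_left h
    simpa using this
  · have h1 := hx.eq (add_nonneg hh ht.1)
    have hd := (hx (h + t) (add_nonneg hh ht.1)).integrable_drift hP hf
    have hd0 := (hx h hh).integrable_drift hP hf
    rw [← intervalIntegral.integral_add_adjacent_intervals hd0 (hd0.symm.trans hd), ← add_assoc,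
      ← hx.eq hh] at h1
    rw [h1]
    congr 1
    have h2 := intervalIntegral.integral_comp_add_left (a := 0) (b := t)
      (fun s => P.growth (x s) (P.mem f x s) - c s) h
    rw [add_zero] at h2
    rw [← h2]
    simp only [hP.mem_add hx.cont]

end IsFeasible

/-- Concatenation of functions at time `h`. -/
def glue (h : ℝ) (x x' : ℝ → ℝ) (t : ℝ) : ℝ := if t ≤ h then x t else x' (t - h)

theorem glue_of_le {h t : ℝ} (x x' : ℝ → ℝ) (ht : t ≤ h) : glue h x x' t = x t := if_pos ht

theorem glue_of_gt {h t : ℝ} (x x' : ℝ → ℝ) (ht : h < t) : glue h x x' t = x' (t - h) :=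
  if_neg ht.not_ge

theorem intervalIntegrable_glue {h t : ℝ} {c c' : ℝ → ℝ} (hh : 0 ≤ h) (ht : 0 ≤ t)
    (hc : IntervalIntegrable c volume 0 h) (hc' : IntervalIntegrable c' volume 0 t) :
    IntervalIntegrable (glue h c c') volume 0 (h + t) := by
  have h1 : IntervalIntegrable (glue h c c') volume 0 h := hc.congr fun s hs => by
    rw [uIoc_of_le hh] at hs; exact (glue_of_le c c' hs.2).symm
  have h2 : IntervalIntegrable (fun s => c' (s - h)) volume h (h + t) := by
    have := hc'.comp_sub_right h
    rwa [zero_add, add_comm t h] at this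
  have h3 : IntervalIntegrable (glue h c c') volume h (h + t) := h2.congr fun s hs => by
    rw [uIoc_of_le (by linarith)] at hs; exact (glue_of_gt c c' hs.1).symm
  exact h1.trans h3

theorem continuous_glue {h : ℝ} {x x' : ℝ → ℝ} (hx : Continuous x) (hx' : Continuous x')
    (h0 : x h = x' 0) : Continuous (glue h x x') := by
  refine Continuous.if_le hx (hx'.comp (continuous_sub_right h)) continuous_id continuous_const ?_
  rintro t rfl
  simpa using h0

theorem glue_add {h t : ℝ} {x x' : ℝ → ℝ} (h0 : x h = x' 0) (ht : 0 ≤ t) :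
    glue h x x' (h + t) = x' t := by
  rcases ht.eq_or_lt with rfl | ht
  · simp [glue, h0]
  · rw [glue_of_gt _ _ (by linarith), add_sub_cancel_left]

theorem IsArc.glue (hP : P.Standing) {h x₀ : ℝ} {f c x c' x' : ℝ → ℝ} (hh : 0 ≤ h)
    (hf : Continuous f)
    (hx : P.IsArc h x₀ f c x) (hx' : P.IsFeasible (x h) (P.pastAfter f x h) c' x') :
    P.IsFeasible x₀ f (glue h c c') (glue h x x') := by
  have h0 : x h = x' 0 := hx'.init.symm
  have hcont : Continuous (Problem.glue h x x') := continuous_glue hx.cont hx'.cont h0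
  -- Causality: the past at time `h` sees only the first of the two pieces.
  have hpast : P.pastAfter f (Problem.glue h x x') h = P.pastAfter f x h := by
    ext s
    unfold pastAfter
    congr 1
    refine intervalIntegral.integral_congr fun u hu => ?_
    rw [uIcc_of_le hh] at hu
    simp only [glue_of_le _ _ hu.2]
  have hfirst : ∀ t ∈ Icc 0 h, Problem.glue h x x' t = x₀ + ∫ s in (0 : ℝ)..t,
      (P.growth (Problem.glue h x x' s) (P.mem f (Problem.glue h x x') s) -
        Problem.glue h c c' s) := by
    intro t ht
    rw [glue_of_le _ _ ht.2, hx.eq t ht]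
    congr 1
    refine intervalIntegral.integral_congr fun s hs => ?_
    rw [uIcc_of_le ht.1] at hs
    have hsh := hs.2.trans ht.2
    simp only [glue_of_le _ _ hsh]
    rw [mem_congr (P := P) (x := x) (x' := Problem.glue h x x') hs.1 rfl
      fun u hu => (glue_of_le _ _ (hu.2.trans hsh)).symm]
  have hint : ∀ t, 0 ≤ t → IntervalIntegrable (Problem.glue h c c') volume 0 (h + t) :=
    fun t ht => intervalIntegrable_glue hh ht hx.int (hx'.int le_rfl ht)
  intro b hb
  refine ⟨hcont, fun t ht => ?_, fun t ht => ?_, ?_, fun t ht => ?_⟩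
  · rcases le_or_gt t h with hth | hth
    · rw [glue_of_le _ _ hth]; exact hx.pos t ⟨ht.1, hth⟩
    · rw [glue_of_gt _ _ hth]; exact hx'.pos (by linarith)
  · rcases le_or_gt t h with hth | hth
    · rw [glue_of_le _ _ hth]; exact hx.nonneg t ⟨ht.1, hth⟩
    · rw [glue_of_gt _ _ hth]; exact hx'.nonneg (by linarith)
  · refine (hint b hb).mono_set ?_
    rw [uIcc_of_le hb, uIcc_of_le (by linarith)]
    exact Icc_subset_Icc_right (by linarith)
  · rcases le_or_gt t h with hth | hth
    · exact hfirst t ⟨ht.1, hth⟩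
    · obtain ⟨τ, rfl⟩ : ∃ τ, t = h + τ := ⟨t - h, by ring⟩
      have hτ : 0 ≤ τ := by linarith
      have hd : IntervalIntegrable (fun s => P.growth (Problem.glue h x x' s)
          (P.mem f (Problem.glue h x x') s) - Problem.glue h c c' s) volume 0 (h + τ) :=
        ((hP.continuous_growth_mem hf hcont).intervalIntegrable _ _).sub (hint τ hτ)
      have hd0 : IntervalIntegrable (fun s => P.growth (Problem.glue h x x' s)
          (P.mem f (Problem.glue h x x') s) - Problem.glue h c c' s) volume 0 h :=
        ((hP.continuous_growth_mem hf hcont).intervalIntegrable _ _).sub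
          (by simpa using hint 0 le_rfl)
      rw [← intervalIntegral.integral_add_adjacent_intervals hd0 (hd0.symm.trans hd), ← add_assoc,
        ← hfirst h ⟨hh, le_rfl⟩, glue_of_le _ _ le_rfl, glue_add h0 hτ, hx'.eq hτ]
      congr 1
      have h2 := intervalIntegral.integral_comp_add_left (a := 0) (b := τ)
        (fun s => P.growth (Problem.glue h x x' s)
          (P.mem f (Problem.glue h x x') s) - Problem.glue h c c' s) h
      rw [add_zero] at h2
      rw [← h2]
      refine intervalIntegral.integral_congr_ae (ae_of_all _ fun s hs => ?_)
      rw [uIoc_of_le hτ] at hs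
      rw [glue_add h0 hs.1.le, hP.mem_add hcont, hpast, glue_of_gt _ _ (by linarith [hs.1] : h < h + s),
        add_sub_cancel_left]
      rw [mem_congr (P := P) (x := x') (x' := fun u => Problem.glue h x x' (h + u)) hs.1.le rfl
        fun u hu => (glue_add h0 hu.1).symm]

/-- Dynamic programming: what is gained after an arc can be gained from its start. -/
theorem IsArc.isGain (hP : P.Standing) {h x₀ j : ℝ} {f c x : ℝ → ℝ} (hh : 0 ≤ h)
    (hf : Continuous f) (hx : P.IsArc h x₀ f c x) (hj : P.IsGain (x h) (P.pastAfter f x h) j) :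
    P.IsGain x₀ f ((∫ t in (0 : ℝ)..h, P.pay c x t) + Real.exp (-P.ρ * h) * j) := by
  obtain ⟨c', x', hx', hint, rfl⟩ := hj
  have hp1 : ∀ t ∈ Ioc 0 h, P.pay (Problem.glue h c c') (Problem.glue h x x') t = P.pay c x t :=
    fun t ht => by simp only [pay, glue_of_le _ _ ht.2]
  have hp2 : ∀ t ∈ Ioi h, P.pay (Problem.glue h c c') (Problem.glue h x x') t =
      Real.exp (-P.ρ * h) * P.pay c' x' (t - h) := fun t ht => by
    simp only [pay, glue_of_gt _ _ (show h < t from ht)]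
    rw [← mul_assoc, ← Real.exp_add]; ring_nf
  have hi1 : IntegrableOn (P.pay (Problem.glue h c c') (Problem.glue h x x')) (Ioc 0 h) := by
    refine IntegrableOn.congr_fun ?_ (fun t ht => (hp1 t ht).symm) measurableSet_Ioc
    exact (intervalIntegrable_iff_integrableOn_Ioc_of_le hh).1 (hx.integrable_pay hP hh)
  have hi2' : IntegrableOn (fun t => P.pay c' x' (t - h)) (Ioi h) := by
    have := ((measurePreserving_sub_right volume h).integrableOn_comp_preimage
      (measurableEmbedding_subRight h)).2 hint
    simpa [Function.comp_def] using this
  have hi2 : IntegrableOn (P.pay (Problem.glue h c c') (Problem.glue h x x')) (Ioi h) :=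
    IntegrableOn.congr_fun (hi2'.const_mul _) (fun t ht => (hp2 t ht).symm) measurableSet_Ioi
  refine ⟨_, _, hx.glue hP hh hf hx', ?_, ?_⟩
  · rw [← Ioc_union_Ioi_eq_Ioi hh]
    exact hi1.union hi2
  · rw [← Ioc_union_Ioi_eq_Ioi hh, setIntegral_union (Ioc_disjoint_Ioi le_rfl) measurableSet_Ioi
      hi1 hi2, intervalIntegral.integral_of_le hh]
    congr 1
    · exact setIntegral_congr_fun measurableSet_Ioc fun t ht => (hp1 t ht).symm
    · rw [setIntegral_congr_fun measurableSet_Ioi hp2, integral_const_mul,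
        ← integral_Ioi_comp_add, Ioc_union_Ioi_eq_Ioi hh]
      simp

/-- Dynamic programming: a payoff splits at time `h`. -/
theorem IsFeasible.exists_gain_shift (hP : P.Standing) {h x₀ : ℝ} {f c x : ℝ → ℝ} (hh : 0 ≤ h)
    (hf : Continuous f) (hx : P.IsFeasible x₀ f c x) (hint : IntegrableOn (P.pay c x) (Ioi 0)) :
    ∃ j, P.IsGain (x h) (P.pastAfter f x h) j ∧ ∫ t in Ioi 0, P.pay c x t =
      (∫ t in (0 : ℝ)..h, P.pay c x t) + Real.exp (-P.ρ * h) * j := by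
  have hp : ∀ t, P.pay (fun t => c (h + t)) (fun t => x (h + t)) t =
      Real.exp (P.ρ * h) * P.pay c x (t + h) := fun t => by
    simp only [pay]
    rw [← mul_assoc, ← Real.exp_add, add_comm t h]; ring_nf
  refine ⟨_, ⟨_, _, hx.shift hP hf hh, ?_, rfl⟩, ?_⟩
  · rw [funext hp]
    exact (integrableOn_Ioi_comp_add (hint.mono_set (Ioi_subset_Ioi hh))).const_mul _
  · rw [← Ioc_union_Ioi_eq_Ioi hh, setIntegral_union (Ioc_disjoint_Ioi le_rfl) measurableSet_Ioi
      (hint.mono_set Ioc_subset_Ioi_self) (hint.mono_set (Ioi_subset_Ioi hh)),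
      intervalIntegral.integral_of_le hh, Ioc_union_Ioi_eq_Ioi hh]
    simp only [hp]
    rw [integral_const_mul, integral_Ioi_comp_add, ← mul_assoc, ← Real.exp_add]
    simp

/-! ### A priori estimates and comparison of gains -/

theorem integral_exp_mul_eq {b : ℝ} (hb : b ≠ 0) (t : ℝ) :
    ∫ u in (0 : ℝ)..t, Real.exp (b * u) = (Real.exp (b * t) - 1) / b := by
  rw [intervalIntegral.integral_comp_mul_left (fun x => Real.exp x) hb, integral_exp]
  simp [div_eq_inv_mul]

/-- The factor `1 / b` is the point: in the norm weighted by `e^{-bt}`, integration in time is small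
when `b` is large. This replaces Gronwall's inequality below. -/
theorem integral_mul_exp_le {b N t : ℝ} (hb : 1 ≤ b) (hN : 0 ≤ N) :
    ∫ u in (0 : ℝ)..t, N * Real.exp (b * u) ≤ N * Real.exp (b * t) / b ∧
    ∫ u in (0 : ℝ)..t, N * Real.exp (b * u) ≤ N * Real.exp (b * t) := by
  have h0 : 0 < b := by linarith
  have h1 : ∫ u in (0 : ℝ)..t, N * Real.exp (b * u) ≤ N * Real.exp (b * t) / b := by
    rw [intervalIntegral.integral_const_mul, integral_exp_mul_eq h0.ne', mul_div_assoc]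
    gcongr
    linarith
  refine ⟨h1, h1.trans (div_le_self (by positivity) hb)⟩

namespace Standing
variable (hP : P.Standing)
include hP

theorem exists_gain_le : ∃ K, 0 < K ∧ ∀ x₀ f j, P.IsGain x₀ f j → j ≤ K := by
  obtain ⟨M, hM, -, hB⟩ := hP.exists_utility_bounds
  have hexp : IntegrableOn (fun t => Real.exp (-P.ρ * t) * M) (Ioi 0) :=
    (integrableOn_exp_mul_Ioi (by linarith [hP.ρ_pos]) 0).mul_const _
  refine ⟨max (∫ t in Ioi 0, Real.exp (-P.ρ * t) * M) 1, by positivity, fun x₀ f j hj => ?_⟩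
  obtain ⟨c, x, hx, hint, rfl⟩ := hj
  refine le_max_of_le_left (setIntegral_mono_on hint hexp measurableSet_Ioi fun t ht => ?_)
  have ht : 0 < t := ht
  exact mul_le_mul_of_nonneg_left (hB _ _ (hx.nonneg ht.le) (hx.pos ht.le)) (by positivity)

/-- Uniform lower bound on what can be gained if the past contributes nonnegatively. -/
theorem exists_gain_ge {m : ℝ} (hm : 0 < m) : ∃ K, ∀ x₀ f, m ≤ x₀ → Continuous f →
    (∀ s, 0 ≤ s → 0 ≤ f s) → ∃ j, K ≤ j ∧ P.IsGain x₀ f j := by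
  obtain ⟨M, hM, hB, -⟩ := hP.exists_utility_bounds
  set l : ℝ → ℝ := fun t => Real.exp (-P.ρ * t) * -M +
    Real.exp (-P.ρ * t) * P.U₂ (m * Real.exp (-P.Cf * t)) with hl
  have hlint : IntegrableOn l (Ioi 0) :=
    ((integrableOn_exp_mul_Ioi (by linarith [hP.ρ_pos]) 0).mul_const _).add
      (hP.integrableOn_U₂_exp hm)
  refine ⟨∫ t in Ioi 0, l t, fun x₀ f hx₀ hf hf0 => ?_⟩
  have hx₀' : 0 < x₀ := hm.trans_le hx₀
  -- The path decaying at rate `Cf` is affordable by `growth_lower`.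
  set x : ℝ → ℝ := fun t => x₀ * Real.exp (-P.Cf * t) with hx
  set d : ℝ → ℝ := fun t => -P.Cf * (x₀ * Real.exp (-P.Cf * t)) with hd
  have hxpos : ∀ t, 0 < x t := fun t => by positivity
  have hder : ∀ t, HasDerivAt x (d t) t := fun t => by
    have := (((hasDerivAt_id t).const_mul (-P.Cf)).exp).const_mul x₀
    refine this.congr_deriv ?_
    simp only [hd, id_eq]; ring
  have hfeas : P.IsFeasible x₀ f (fun t => P.growth (x t) (P.mem f x t) - d t) x := by
    intro h hh
    have := IsArc.of_hasDerivAt (h := h) hP hf (by fun_prop : Continuous d) hder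
      (fun t _ => hxpos t) fun t ht => ?_
    · simpa [hx] using this
    · refine hP.growth_lower (hxpos t).le ?_
      refine add_nonneg (hf0 t ht.1) (intervalIntegral.integral_nonneg ht.1 fun u _ => ?_)
      exact mul_nonneg (hP.kern_nonneg _) (hxpos u).le
  have hle : ∀ t, 0 < t → l t ≤ P.pay (fun t => P.growth (x t) (P.mem f x t) - d t) x t := by
    intro t ht
    simp only [hl, pay]
    rw [← mul_add]
    refine mul_le_mul_of_nonneg_left (add_le_add ?_ ?_) (by positivity)
    · exact (abs_le.1 (hB _ (hfeas.nonneg ht.le))).1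
    · refine hP.U₂_mono (mem_Ioi.2 (by positivity)) (mem_Ioi.2 (hxpos t)) ?_
      simp only [hx]; gcongr
  have hint := hfeas.integrableOn_of_ge hP hlint hle
  exact ⟨_, setIntegral_mono_on hlint hint measurableSet_Ioi hle, _, _, hfeas, hint, rfl⟩

/-- The growth is Lipschitz along trajectories in exponentially weighted norms. That `C` does not
depend on `b` lets `b` be chosen in terms of `C` afterwards. -/
theorem exists_growth_bound : ∃ C, 0 ≤ C ∧ ∀ {f f' x x' : ℝ → ℝ} {N b t φ : ℝ}, Continuous x →
    Continuous x' → 1 ≤ b → 0 ≤ N → 0 ≤ t → (∀ u ∈ Icc 0 t, |x' u - x u| ≤ N * Real.exp (b * u)) →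
    |f' t - f t| ≤ φ → |P.growth (x' t) (P.mem f' x' t) - P.growth (x t) (P.mem f x t)| ≤
      P.Cf * φ + C * (N * Real.exp (b * t)) := by
  obtain ⟨A, hA, hkA⟩ := hP.exists_kern_le
  have hC := hP.Cf_nonneg
  have hr := hP.r_nonneg
  refine ⟨P.r + P.Cf + P.Cf * A, by positivity, ?_⟩
  intro f f' x x' N b t φ hx hx' hb hN ht hxx hff
  have hk := hP.continuous_kern
  have h1 : |P.mem f' x' t - P.mem f x t| ≤ φ + A * (N * Real.exp (b * t)) := by
    have e : P.mem f' x' t - P.mem f x t =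
        (f' t - f t) + ∫ u in (0 : ℝ)..t, P.kern (u - t) * (x' u - x u) := by
      simp only [mem, mul_sub]
      rw [intervalIntegral.integral_sub]
      · ring
      · exact Continuous.intervalIntegrable (by fun_prop) _ _
      · exact Continuous.intervalIntegrable (by fun_prop) _ _
    rw [e]
    refine (abs_add_le _ _).trans (add_le_add hff ?_)
    calc |∫ u in (0 : ℝ)..t, P.kern (u - t) * (x' u - x u)|
        ≤ ∫ u in (0 : ℝ)..t, A * (N * Real.exp (b * u)) := by
          rw [← Real.norm_eq_abs]
          refine intervalIntegral.norm_integral_le_of_norm_le ht (ae_of_all _ fun u hu => ?_)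
            (Continuous.intervalIntegrable (by fun_prop) _ _)
          rw [Real.norm_eq_abs, abs_mul, abs_of_nonneg (hP.kern_nonneg _)]
          exact mul_le_mul (hkA _) (hxx u ⟨hu.1.le, hu.2⟩) (abs_nonneg _) hA.le
      _ ≤ _ := by
          rw [intervalIntegral.integral_const_mul]
          exact mul_le_mul_of_nonneg_left (integral_mul_exp_le hb hN).2 hA.le
  have h2 := hP.growth_lipschitz (x' t) (x t) (P.mem f' x' t) (P.mem f x t)
  have h3 := hxx t ⟨ht, le_rfl⟩
  have h4 := mul_le_mul_of_nonneg_left h1 hC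
  have h5 := mul_le_mul_of_nonneg_left h3 (add_nonneg hr hC)
  nlinarith

/-- The weighted distance `N` of the two trajectories is attained at some `t₀`. Integrating the
equation up to `t₀` bounds it by `C / b` times itself, and `C / b < 1`. -/
theorem arc_unique {h x₀ : ℝ} {f c x x' : ℝ → ℝ} (hf : Continuous f)
    (hx : P.IsArc h x₀ f c x) (hx' : P.IsArc h x₀ f c x') {t : ℝ} (ht : t ∈ Icc 0 h) :
    x' t = x t := by
  have hh : 0 ≤ h := ht.1.trans ht.2
  obtain ⟨C, hC, hg⟩ := hP.exists_growth_bound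
  set b := 2 * C + 1 with hb
  have hxc := hx.cont
  have hxc' := hx'.cont
  obtain ⟨t₀, ht₀, hmax⟩ := isCompact_Icc.exists_isMaxOn (nonempty_Icc.2 hh)
    (by fun_prop : Continuous fun t => |x' t - x t| * Real.exp (-b * t)).continuousOn
  set N := |x' t₀ - x t₀| * Real.exp (-b * t₀) with hN
  have hN0 : 0 ≤ N := by positivity
  have hle : ∀ u ∈ Icc 0 h, |x' u - x u| ≤ N * Real.exp (b * u) := fun u hu => by
    have h1 : |x' u - x u| * Real.exp (-b * u) ≤ N := hmax hu
    have h2 := mul_le_mul_of_nonneg_right h1 (Real.exp_pos (b * u)).le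
    rwa [mul_assoc, ← Real.exp_add, neg_mul, neg_add_cancel, Real.exp_zero, mul_one] at h2
  have heq : |x' t₀ - x t₀| = N * Real.exp (b * t₀) := by
    rw [hN, mul_assoc, ← Real.exp_add, neg_mul, neg_add_cancel, Real.exp_zero, mul_one]
  have hdx := (hx.mono ht₀.1 ht₀.2).integrable_drift hP hf
  have hdx' := (hx'.mono ht₀.1 ht₀.2).integrable_drift hP hf
  have hb1 : 1 ≤ b := by linarith
  have hb0 : 0 < b := by linarith
  have h3 : |x' t₀ - x t₀| ≤ C * (N * Real.exp (b * t₀) / b) := by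
    rw [hx.eq t₀ ht₀, hx'.eq t₀ ht₀, add_sub_add_left_eq_sub, ← intervalIntegral.integral_sub hdx' hdx,
      ← Real.norm_eq_abs]
    calc _ ≤ ∫ u in (0 : ℝ)..t₀, C * (N * Real.exp (b * u)) := by
          refine intervalIntegral.norm_integral_le_of_norm_le ht₀.1 (ae_of_all _ fun u hu => ?_)
            (Continuous.intervalIntegrable (by fun_prop) _ _)
          have := hg (f := f) (f' := f) (φ := 0) hxc hxc' hb1 hN0 hu.1.le
            (fun v hv => hle v ⟨hv.1, hv.2.trans (hu.2.trans ht₀.2)⟩) (by simp)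
          rw [Real.norm_eq_abs]
          convert this using 1
          · congr 1; ring
          · ring
      _ ≤ _ := by
          rw [intervalIntegral.integral_const_mul]
          exact mul_le_mul_of_nonneg_left (integral_mul_exp_le hb1 hN0).1 hC
  have h4 : N * Real.exp (b * t₀) = 0 := by
    rw [heq, mul_div_assoc', le_div_iff₀ hb0] at h3
    have : 0 ≤ N * Real.exp (b * t₀) := by positivity
    nlinarith
  have h5 : N = 0 := by
    rcases mul_eq_zero.1 h4 with h | h
    · exact h
    · exact absurd h (Real.exp_pos _).ne'
  have h6 := hle t ht
  rw [h5, zero_mul] at h6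
  exact sub_eq_zero.1 (abs_nonpos_iff.1 h6)

/-- A priori bounds on trajectories over a unit time span. -/
theorem exists_arc_bound (x₀ : ℝ) {f : ℝ → ℝ} (hf : Continuous f) : ∃ R, 0 < R ∧
    ∀ h c x, 0 ≤ h → h ≤ 1 → P.IsArc h x₀ f c x → ∀ t ∈ Icc 0 h,
      |P.growth (x t) (P.mem f x t)| ≤ R := by
  obtain ⟨C, hC, hg⟩ := hP.exists_growth_bound
  set b := 2 * C + 1 with hb
  have hb1 : 1 ≤ b := by linarith
  have hb0 : 0 < b := by linarith
  obtain ⟨F, hF⟩ := (isCompact_Icc (a := (0 : ℝ)) (b := 1)).bddAbove_image (f := fun s => |f s|)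
    (by fun_prop)
  have hF' : ∀ s ∈ Icc (0 : ℝ) 1, |f s| ≤ F := fun s hs => hF ⟨s, hs, rfl⟩
  have hF0 : 0 ≤ F := (abs_nonneg _).trans (hF' 0 ⟨le_rfl, zero_le_one⟩)
  have hmem0 : ∀ t, P.mem (fun _ => 0) (fun _ => 0) t = 0 := fun t => by simp [mem]
  have hg0 : P.growth 0 0 = P.f₀ 0 0 := by simp [growth]
  have hf00 := hP.f₀_zero_nonneg
  have hCf := hP.Cf_nonneg
  set G := P.f₀ 0 0 + P.Cf * F with hG
  have hG0 : 0 ≤ G := by positivity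
  refine ⟨G + C * (2 * (|x₀| + G) * Real.exp b) + 1, by positivity, ?_⟩
  intro h c x hh hh1 hx t ht
  have hxc := hx.cont
  obtain ⟨t₀, ht₀, hmax⟩ := isCompact_Icc.exists_isMaxOn (nonempty_Icc.2 hh)
    (by fun_prop : Continuous fun t => x t * Real.exp (-b * t)).continuousOn
  set N := x t₀ * Real.exp (-b * t₀) with hN
  have hN0 : 0 ≤ N := mul_nonneg (hx.pos t₀ ht₀).le (by positivity)
  have hle : ∀ u ∈ Icc 0 h, x u ≤ N * Real.exp (b * u) := fun u hu => by
    have h1 : x u * Real.exp (-b * u) ≤ N := hmax hu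
    have h2 := mul_le_mul_of_nonneg_right h1 (Real.exp_pos (b * u)).le
    rwa [mul_assoc, ← Real.exp_add, neg_mul, neg_add_cancel, Real.exp_zero, mul_one] at h2
  have heq : x t₀ = N * Real.exp (b * t₀) := by
    rw [hN, mul_assoc, ← Real.exp_add, neg_mul, neg_add_cancel, Real.exp_zero, mul_one]
  have hgr : ∀ u ∈ Icc 0 h, |P.growth (x u) (P.mem f x u)| ≤ G + C * (N * Real.exp (b * u)) := by
    intro u hu
    have := hg (f := fun _ => 0) (f' := f) (x := fun _ => 0) (x' := x) (φ := F) (N := N) (b := b)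
      (t := u) continuous_const hxc hb1 hN0 hu.1
      (fun v hv => by
        have hv' : v ∈ Icc 0 h := ⟨hv.1, hv.2.trans hu.2⟩
        rw [sub_zero, abs_of_pos (hx.pos v hv')]
        exact hle v hv') (by simpa using hF' u ⟨hu.1, hu.2.trans hh1⟩)
    rw [hmem0, hg0] at this
    have h2 := abs_sub_abs_le_abs_sub (P.growth (x u) (P.mem f x u)) (P.f₀ 0 0)
    rw [abs_of_nonneg hf00] at h2
    linarith
  -- The weighted maximum is estimated by itself with the factor `C / b ≤ 1 / 2` and absorbed.
  -- Positivity of `x` and `c ≥ 0` make a one-sided estimate sufficient.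
  have hN2 : N ≤ 2 * (|x₀| + G) := by
    have hint := (hx.mono ht₀.1 ht₀.2).int
    have h3 : x t₀ ≤ x₀ + (G + C * (N * Real.exp (b * t₀) / b)) := by
      conv_lhs => rw [hx.eq t₀ ht₀]
      gcongr
      calc _ ≤ ∫ u in (0 : ℝ)..t₀, (G + C * (N * Real.exp (b * u))) := by
            refine intervalIntegral.integral_mono_on ht₀.1
              ((hx.mono ht₀.1 ht₀.2).integrable_drift hP hf)
              (Continuous.intervalIntegrable (by fun_prop) _ _) fun u hu => ?_
            have hu' : u ∈ Icc 0 h := ⟨hu.1, hu.2.trans ht₀.2⟩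
            linarith [hgr u hu', hx.nonneg u hu', le_abs_self (P.growth (x u) (P.mem f x u))]
        _ = t₀ * G + C * ∫ u in (0 : ℝ)..t₀, N * Real.exp (b * u) := by
            rw [intervalIntegral.integral_add (by simp)
              (Continuous.intervalIntegrable (by fun_prop) _ _), intervalIntegral.integral_const_mul]
            simp
        _ ≤ _ := by
            have := mul_le_mul_of_nonneg_left (integral_mul_exp_le (t := t₀) hb1 hN0).1 hC
            have h4 : t₀ * G ≤ 1 * G := by gcongr; exact ht₀.2.trans hh1
            linarith
    have h5 : C * (N * Real.exp (b * t₀) / b) ≤ N * Real.exp (b * t₀) / 2 := by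
      have : 0 ≤ N * Real.exp (b * t₀) := by positivity
      rw [mul_div_assoc', div_le_div_iff₀ hb0 two_pos]
      nlinarith
    have h6 : N ≤ N * Real.exp (b * t₀) :=
      le_mul_of_one_le_right hN0 (Real.one_le_exp (mul_nonneg hb0.le ht₀.1))
    linarith [le_abs_self x₀]
  have h7 : N * Real.exp (b * t) ≤ 2 * (|x₀| + G) * Real.exp b := by
    have : b * t ≤ b := mul_le_of_le_one_right hb0.le (ht.2.trans hh1)
    gcongr
  have := mul_le_mul_of_nonneg_left h7 hC
  linarith [hgr t ht]

/-- Small perturbations of the initial data preserve a lower bound on what can be gained. -/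
theorem exists_gain_ge_near {S x₀ : ℝ} {f c x : ℝ → ℝ} (hS : 0 ≤ S) (hf : Continuous f)
    (hx : P.IsArc S x₀ f c x) : ∃ ε K, 0 < ε ∧ ∀ x₀' f', Continuous f' → |x₀' - x₀| ≤ ε →
      (∀ s ∈ Icc 0 S, |f' s - f s| ≤ ε) → (∀ s, S ≤ s → f' s = 0) →
      ∃ j, K ≤ j ∧ P.IsGain x₀' f' j := by
  obtain ⟨C, hC, hg⟩ := hP.exists_growth_bound
  obtain ⟨M, hM, hB, -⟩ := hP.exists_utility_bounds
  obtain ⟨t₀, ht₀, hmin⟩ := isCompact_Icc.exists_isMinOn (nonempty_Icc.2 hS) hx.cont.continuousOn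
  set m := x t₀ with hm
  have hm0 : 0 < m := hx.pos t₀ ht₀
  have hCf := hP.Cf_nonneg
  -- The perturbed path is `x + z`, with `z` losing `ε b e^{bt}` per unit time. With this `b` the
  -- loss dominates the change of the growth, at most `Cf ε + C ε e^{bt}`, so the control stays
  -- above `c`. The choice of `ε` keeps `|z| ≤ m / 2` up to time `S`. From then on the past
  -- contributes nonnegatively and `exists_gain_ge` applies.
  set b := C + P.Cf + 1 with hb
  have hb1 : 1 ≤ b := by linarith
  set ε := m / 2 * Real.exp (-b * S) with hε
  have hε0 : 0 < ε := by positivity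
  have hεe : ∀ t ≤ S, ε * Real.exp (b * t) ≤ m / 2 := fun t ht => by
    rw [hε, mul_assoc, ← Real.exp_add]
    refine mul_le_of_le_one_right (by positivity) (Real.exp_le_one_iff.2 ?_)
    nlinarith
  obtain ⟨K, hK⟩ := hP.exists_gain_ge (half_pos hm0)
  refine ⟨ε, (∫ t in (0 : ℝ)..S, Real.exp (-P.ρ * t) * (-M + P.U₂ (m / 2))) +
    Real.exp (-P.ρ * S) * K, hε0, fun x₀' f' hf' hx₀' hff' hf0' => ?_⟩
  set z : ℝ → ℝ := fun t => (x₀' - x₀) + ε - ε * Real.exp (b * t) with hz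
  have hzle : ∀ t, 0 ≤ t → |z t| ≤ ε * Real.exp (b * t) := fun t ht => by
    have h1 : 1 ≤ Real.exp (b * t) := Real.one_le_exp (by positivity)
    have h2 := abs_le.1 hx₀'
    simp only [hz]
    rw [abs_le]
    constructor <;> nlinarith
  set d : ℝ → ℝ := fun s => P.growth (x s) (P.mem f x s) - c s with hd
  have hdint : IntervalIntegrable d volume 0 S := hx.integrable_drift hP hf
  have hx'c : Continuous fun t => x t + z t := hx.cont.add (by fun_prop)
  have hpos' : ∀ t ∈ Icc 0 S, m / 2 ≤ x t + z t := fun t ht => by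
    have h1 : m ≤ x t := hmin ht
    linarith [(abs_le.1 (hzle t ht.1)).1, hεe t ht.2]
  have harc := IsArc.of_drift (P := P) (h := S) (x₀ := x₀') (f := f') (x := fun t => x t + z t)
    (d := fun t => d t + -(ε * b * Real.exp (b * t))) hP hf' hx'c
    (hdint.add (Continuous.intervalIntegrable (by fun_prop) _ _))
    (fun t ht => by
      rw [intervalIntegral.integral_add (hdint.mono_set (by
        rw [uIcc_of_le ht.1, uIcc_of_le hS]; exact Icc_subset_Icc_right ht.2))
        (Continuous.intervalIntegrable (by fun_prop) _ _)]
      rw [intervalIntegral.integral_neg, intervalIntegral.integral_const_mul,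
        integral_exp_mul_eq (by linarith)]
      have := hx.eq t ht
      simp only [hz]
      rw [this]
      field_simp
      ring)
    (fun t ht => by linarith [hpos' t ht])
    (fun t ht => by
      have h1 := hg (f := f) (f' := f') (φ := ε) hx.cont hx'c hb1 hε0.le ht.1
        (fun u hu => by simpa using hzle u hu.1) (hff' t ht)
      have h2 := (abs_le.1 h1).1
      have h3 := hx.nonneg t ht
      have h4 : ε * 1 ≤ ε * Real.exp (b * t) := by
        gcongr; exact Real.one_le_exp (by nlinarith [ht.1])
      have h5 := mul_le_mul_of_nonneg_left h4 hCf
      simp only [hd]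
      have h6 : ε * b * Real.exp (b * t) = C * (ε * Real.exp (b * t)) +
        P.Cf * (ε * Real.exp (b * t)) + ε * Real.exp (b * t) := by rw [hb]; ring
      have h7 : 0 < ε * Real.exp (b * t) := by positivity
      linarith)
  obtain ⟨j, hKj, hj⟩ := hK (x S + z S) (P.pastAfter f' (fun t => x t + z t) S)
    (hpos' S ⟨hS, le_rfl⟩) (hP.continuous_pastAfter hf' hx'c S) (fun s hs => by
      unfold pastAfter
      rw [hf0' _ (by linarith), zero_add]
      refine intervalIntegral.integral_nonneg hS fun u hu => mul_nonneg (hP.kern_nonneg _) ?_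
      linarith [hpos' u hu])
  refine ⟨_, ?_, harc.isGain hP hS hf' hj⟩
  refine add_le_add ?_ (mul_le_mul_of_nonneg_left hKj (by positivity))
  refine intervalIntegral.integral_mono_on hS (Continuous.intervalIntegrable (by fun_prop) _ _)
    (harc.integrable_pay hP hS) fun t ht => ?_
  refine mul_le_mul_of_nonneg_left (add_le_add ?_ ?_) (by positivity)
  · exact (abs_le.1 (hB _ (harc.nonneg t ht))).1
  · exact hP.U₂_mono (mem_Ioi.2 (by positivity)) (mem_Ioi.2 (harc.pos t ht)) (hpos' t ht)

theorem mem_combo {f f' x x' : ℝ → ℝ} (hx : Continuous x) (hx' : Continuous x') (s t u : ℝ) :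
    P.mem (fun v => s * f v + t * f' v) (fun v => s * x v + t * x' v) u =
      s * P.mem f x u + t * P.mem f' x' u := by
  have hk := hP.continuous_kern
  have e : ∀ v, P.kern (v - u) * (s * x v + t * x' v) =
      s * (P.kern (v - u) * x v) + t * (P.kern (v - u) * x' v) := fun v => by ring
  simp only [mem, e]
  rw [intervalIntegral.integral_add (Continuous.intervalIntegrable (by fun_prop) _ _)
    (Continuous.intervalIntegrable (by fun_prop) _ _), intervalIntegral.integral_const_mul,
    intervalIntegral.integral_const_mul]
  ring

/-- The combination of the two trajectories is itself a trajectory: by joint concavity of the growth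
it leaves at least the combined consumption available. Concavity of both utilities and monotonicity
of `U₁` then compare the payoffs. -/
theorem gain_combo {x₀ x₀' j j' s t : ℝ} {f f' : ℝ → ℝ} (hf : Continuous f) (hf' : Continuous f')
    (hj : P.IsGain x₀ f j) (hj' : P.IsGain x₀' f' j') (hs : 0 ≤ s) (ht : 0 ≤ t) (hst : s + t = 1) :
    ∃ k, s * j + t * j' ≤ k ∧
      P.IsGain (s * x₀ + t * x₀') (fun v => s * f v + t * f' v) k := by
  obtain ⟨c, x, hx, hint, rfl⟩ := hj
  obtain ⟨c', x', hx', hint', rfl⟩ := hj'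
  set y : ℝ → ℝ := fun v => s * x v + t * x' v with hy
  set g : ℝ → ℝ := fun v => s * f v + t * f' v with hg
  set d : ℝ → ℝ := fun v => s * (P.growth (x v) (P.mem f x v) - c v) +
    t * (P.growth (x' v) (P.mem f' x' v) - c' v) with hd
  have hgc : Continuous g := by fun_prop
  have hxc := hx.cont
  have hxc' := hx'.cont
  have hpos : ∀ v, 0 ≤ v → 0 < y v := fun v hv =>
    (convex_Ioi (0 : ℝ)) (hx.pos hv) (hx'.pos hv) hs ht hst
  have hgrow : ∀ v, 0 ≤ v → s * P.growth (x v) (P.mem f x v) +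
      t * P.growth (x' v) (P.mem f' x' v) ≤ P.growth (y v) (P.mem g y v) := fun v hv => by
    rw [hy, hg, hP.mem_combo hxc hxc']
    exact hP.growth_concave (hx.pos hv).le (hx'.pos hv).le hs ht hst
  have hcle : ∀ v, 0 ≤ v → s * c v + t * c' v ≤ P.growth (y v) (P.mem g y v) - d v := fun v hv => by
    have := hgrow v hv
    simp only [hd]
    linarith
  have hcc : ∀ v, 0 ≤ v → 0 ≤ s * c v + t * c' v := fun v hv =>
    add_nonneg (mul_nonneg hs (hx.nonneg hv)) (mul_nonneg ht (hx'.nonneg hv))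
  have hfeas : P.IsFeasible (s * x₀ + t * x₀') g
      (fun v => P.growth (y v) (P.mem g y v) - d v) y := by
    intro h hh
    have hi := (hx h hh).integrable_drift hP hf
    have hi' := (hx' h hh).integrable_drift hP hf'
    refine IsArc.of_drift hP hgc (by fun_prop) ((hi.const_mul s).add (hi'.const_mul t))
      (fun v hv => ?_) (fun v hv => hpos v hv.1) (fun v hv => ?_)
    · have h1 := (hx v hv.1).integrable_drift hP hf
      have h1' := (hx' v hv.1).integrable_drift hP hf'
      simp only [hd]
      rw [intervalIntegral.integral_add (h1.const_mul s) (h1'.const_mul t),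
        intervalIntegral.integral_const_mul, intervalIntegral.integral_const_mul]
      simp only [hy]
      rw [hx.eq hv.1, hx'.eq hv.1]
      ring
    · linarith [hcle v hv.1, hcc v hv.1]
  have hle : ∀ v, 0 < v → s * P.pay c x v + t * P.pay c' x' v ≤
      P.pay (fun v => P.growth (y v) (P.mem g y v) - d v) y v := by
    intro v hv
    have h1 : s * P.U₁ (c v) + t * P.U₁ (c' v) ≤ P.U₁ (P.growth (y v) (P.mem g y v) - d v) :=
      (hP.strictConcaveOn_U₁.concaveOn.2 (mem_Ici.2 (hx.nonneg hv.le))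
        (mem_Ici.2 (hx'.nonneg hv.le)) hs ht hst).trans
        (hP.strictMonoOn_U₁.monotoneOn (mem_Ici.2 (hcc v hv.le))
          (mem_Ici.2 (hfeas.nonneg hv.le)) (hcle v hv.le))
    have h2 : s * P.U₂ (x v) + t * P.U₂ (x' v) ≤ P.U₂ (y v) :=
      hP.U₂_concave.2 (mem_Ioi.2 (hx.pos hv.le)) (mem_Ioi.2 (hx'.pos hv.le)) hs ht hst
    have h3 := mul_le_mul_of_nonneg_left (add_le_add h1 h2) (Real.exp_pos (-P.ρ * v)).le
    simp only [pay]
    linarith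
  have hli := (hint.const_mul s).add (hint'.const_mul t)
  have hint2 := hfeas.integrableOn_of_ge hP hli hle
  refine ⟨_, ?_, _, _, hfeas, hint2, rfl⟩
  rw [← integral_const_mul, ← integral_const_mul, ← integral_add (hint.const_mul s)
    (hint'.const_mul t)]
  exact setIntegral_mono_on hli hint2 measurableSet_Ioi hle

/-- Below `k`, increments of a concave function are at least the one at `k`; above `k` the left side
is nonpositive. A bound affine in `c` can be integrated knowing only `∫ c`. -/
theorem U₁_increment {c k δ : ℝ} (hc : 0 ≤ c) (hk : 0 < k) (hδ : 0 < δ) :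
    (P.U₁ (k + δ) - P.U₁ k) * (1 - c / k) ≤ P.U₁ (c + δ) - P.U₁ c := by
  have hG : 0 < P.U₁ (k + δ) - P.U₁ k :=
    sub_pos.2 (hP.strictMonoOn_U₁ (mem_Ici.2 hk.le) (mem_Ici.2 (by positivity)) (by linarith))
  have hG' : 0 < P.U₁ (c + δ) - P.U₁ c :=
    sub_pos.2 (hP.strictMonoOn_U₁ (mem_Ici.2 hc) (mem_Ici.2 (by positivity)) (by linarith))
  rcases le_or_gt k c with h | h
  · have : 1 ≤ c / k := (one_le_div hk).2 h
    nlinarith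
  · have h1 : P.U₁ (k + δ) - P.U₁ k ≤ P.U₁ (c + δ) - P.U₁ c := by
      have hD : 0 < k + δ - c := by linarith
      have hθ0 : 0 ≤ δ / (k + δ - c) := by positivity
      have hθ1 : 0 ≤ (k - c) / (k + δ - c) := div_nonneg (by linarith) hD.le
      have hsum : (k - c) / (k + δ - c) + δ / (k + δ - c) = 1 := by field_simp; ring
      have e1 := hP.strictConcaveOn_U₁.concaveOn.2 (mem_Ici.2 hc)
        (mem_Ici.2 (by positivity : 0 ≤ k + δ)) hθ1 hθ0 hsum
      have e2 := hP.strictConcaveOn_U₁.concaveOn.2 (mem_Ici.2 hc)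
        (mem_Ici.2 (by positivity : 0 ≤ k + δ)) hθ0 hθ1 (by rw [add_comm]; exact hsum)
      simp only [smul_eq_mul] at e1 e2
      have a1 : (k - c) / (k + δ - c) * c + δ / (k + δ - c) * (k + δ) = c + δ := by
        field_simp; ring
      have a2 : δ / (k + δ - c) * c + (k - c) / (k + δ - c) * (k + δ) = k := by
        field_simp; ring
      rw [a1] at e1
      rw [a2] at e2
      have a3 : (k - c) / (k + δ - c) = 1 - δ / (k + δ - c) := by linarith
      rw [a3] at e1 e2
      linarith
    have h2 : 1 - c / k ≤ 1 := by linarith [div_nonneg hc hk.le]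
    nlinarith

/-- A larger initial state gains strictly more, uniformly over the controls. -/
theorem exists_gain_add {x₀ τ : ℝ} {f : ℝ → ℝ} (hf : Continuous f) (hτ : 0 < τ) : ∃ γ, 0 < γ ∧
    ∀ j, P.IsGain x₀ f j → ∃ j', j + γ ≤ j' ∧ P.IsGain (x₀ + τ) f j' := by
  obtain ⟨R, hR, hRb⟩ := hP.exists_arc_bound x₀ hf
  have hr := hP.r_nonneg
  have hCf := hP.Cf_nonneg
  have hkc := hP.continuous_kern
  -- The surplus `z = τ e^{-bt}` decays fast enough to cover the Lipschitz loss `(r + Cf) z` and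
  -- still release `z` as extra consumption. On `[0, 1]` this is at least `δ`.
  set b := P.r + P.Cf + 1 with hb
  have hb0 : 0 < b := by positivity
  -- Twice the bound on `∫₀¹ c`, valid for every control, so that `1 - c / k` has mean at least `1 /
  -- 2` on `[0, 1]`. This makes the improvement `γ` uniform.
  set k := 2 * (|x₀| + R) with hk
  have hk0 : 0 < k := by positivity
  set δ := τ * Real.exp (-b) with hδ
  have hδ0 : 0 < δ := by positivity
  set G := P.U₁ (k + δ) - P.U₁ k with hG
  have hG0 : 0 < G :=
    sub_pos.2 (hP.strictMonoOn_U₁ (mem_Ici.2 hk0.le) (mem_Ici.2 (by positivity)) (by linarith))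
  refine ⟨Real.exp (-P.ρ) * G * (1 / 2), by positivity, fun j hj => ?_⟩
  obtain ⟨c, x, hx, hint, rfl⟩ := hj
  have hxc := hx.cont
  set z : ℝ → ℝ := fun t => τ * Real.exp (-b * t) with hz
  have hzpos : ∀ t, 0 < z t := fun t => by positivity
  set y : ℝ → ℝ := fun t => x t + z t with hy
  set d : ℝ → ℝ := fun t => (P.growth (x t) (P.mem f x t) - c t) + -b * (τ * Real.exp (-b * t))
    with hd
  have hyc : Continuous y := by fun_prop
  have hcle : ∀ t, 0 ≤ t → c t + z t ≤ P.growth (y t) (P.mem f y t) - d t := fun t ht => by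
    have h1 : P.mem f x t ≤ P.mem f y t := by
      unfold mem
      gcongr
      refine intervalIntegral.integral_mono_on ht (Continuous.intervalIntegrable (by fun_prop) _ _)
        (Continuous.intervalIntegrable (by fun_prop) _ _) fun u hu => ?_
      refine mul_le_mul_of_nonneg_left ?_ (hP.kern_nonneg _)
      simp only [hy]; linarith [hzpos u]
    have h2 := hP.growth_mono (x := y t) h1
    have h3 := (abs_le.1 (hP.growth_lipschitz (y t) (x t) (P.mem f x t) (P.mem f x t))).1
    have h4 : |y t - x t| = z t := by simp only [hy, add_sub_cancel_left]; exact abs_of_pos (hzpos t)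
    rw [h4, sub_self, abs_zero, mul_zero, add_zero] at h3
    have h5 : -b * (τ * Real.exp (-b * t)) = -(P.r + P.Cf) * z t - z t := by
      simp only [hz]; rw [hb]; ring
    simp only [hd]
    rw [h5]
    linarith
  have hfeas : P.IsFeasible (x₀ + τ) f (fun t => P.growth (y t) (P.mem f y t) - d t) y := by
    intro h hh
    refine IsArc.of_drift hP hf hyc (((hx h hh).integrable_drift hP hf).add
      (Continuous.intervalIntegrable (by fun_prop) _ _)) (fun t ht => ?_)
      (fun t ht => add_pos (hx.pos ht.1) (hzpos t))
      fun t ht => by linarith [hcle t ht.1, hx.nonneg ht.1, hzpos t]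
    simp only [hd]
    rw [intervalIntegral.integral_add ((hx t ht.1).integrable_drift hP hf)
      (Continuous.intervalIntegrable (by fun_prop) _ _), intervalIntegral.integral_const_mul,
      intervalIntegral.integral_const_mul, integral_exp_mul_eq (by linarith)]
    simp only [hy, hz]
    rw [hx.eq ht.1]
    field_simp
    ring
  set e : ℝ → ℝ := fun t => Real.exp (-P.ρ) * (G * (1 - c t / k)) with he
  have heint : IntervalIntegrable e volume 0 1 :=
    (((intervalIntegrable_const).sub ((hx.int le_rfl zero_le_one).div_const k)).const_mul G).const_mul _
  have heint' : IntegrableOn e (Ioc 0 1) :=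
    (intervalIntegrable_iff_integrableOn_Ioc_of_le zero_le_one).1 heint
  have hli : IntegrableOn (fun t => P.pay c x t + (Ioc 0 1).indicator e t) (Ioi 0) := by
    refine hint.add ?_
    exact (heint'.integrable_indicator measurableSet_Ioc).integrableOn
  have hle : ∀ t, 0 < t → P.pay c x t + (Ioc 0 1).indicator e t ≤
      P.pay (fun t => P.growth (y t) (P.mem f y t) - d t) y t := by
    intro t ht
    have hU2 : P.U₂ (x t) ≤ P.U₂ (y t) := hP.U₂_mono (mem_Ioi.2 (hx.pos ht.le))
      (mem_Ioi.2 (hfeas.pos ht.le)) (by simp only [hy]; linarith [hzpos t])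
    have hc0 := hx.nonneg ht.le
    have hU1 : ∀ w, 0 ≤ w → w ≤ z t → P.U₁ (c t + w) ≤
        P.U₁ (P.growth (y t) (P.mem f y t) - d t) := fun w hw hwz =>
      hP.strictMonoOn_U₁.monotoneOn (mem_Ici.2 (by positivity)) (mem_Ici.2 (hfeas.nonneg ht.le))
        (by linarith [hcle t ht.le])
    have hexp := Real.exp_pos (-P.ρ * t)
    by_cases ht1 : t ∈ Ioc (0 : ℝ) 1
    · rw [indicator_of_mem ht1]
      have hδz : δ ≤ z t := by
        simp only [hδ, hz]
        have : -b ≤ -b * t := by nlinarith [ht1.2]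
        gcongr
      have h1 := hU1 δ hδ0.le hδz
      have h2 := hP.U₁_increment (c := c t) hc0 hk0 hδ0
      have h3 : 0 ≤ P.U₁ (c t + δ) - P.U₁ (c t) := sub_nonneg.2
        (hP.strictMonoOn_U₁.monotoneOn (mem_Ici.2 hc0) (mem_Ici.2 (by positivity)) (by linarith))
      have h4 : Real.exp (-P.ρ) ≤ Real.exp (-P.ρ * t) :=
        Real.exp_le_exp.2 (by nlinarith [ht1.2, hP.ρ_pos])
      have h5 : e t ≤ Real.exp (-P.ρ * t) * (P.U₁ (c t + δ) - P.U₁ (c t)) :=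
        (mul_le_mul_of_nonneg_left h2 (Real.exp_pos _).le).trans
          (mul_le_mul_of_nonneg_right h4 h3)
      have h6 := mul_le_mul_of_nonneg_left (add_le_add h1 hU2) hexp.le
      simp only [pay]
      linarith
    · rw [indicator_of_notMem ht1, add_zero]
      have := hU1 0 le_rfl (hzpos t).le
      rw [add_zero] at this
      exact mul_le_mul_of_nonneg_left (add_le_add this hU2) hexp.le
  have hint2 := hfeas.integrableOn_of_ge hP hli hle
  refine ⟨_, ?_, _, _, hfeas, hint2, rfl⟩
  refine le_trans ?_ (setIntegral_mono_on hli hint2 measurableSet_Ioi hle)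
  rw [integral_add hint (heint'.integrable_indicator measurableSet_Ioc).integrableOn,
    setIntegral_indicator measurableSet_Ioc, inter_eq_right.2 Ioc_subset_Ioi_self,
    ← intervalIntegral.integral_of_le zero_le_one]
  gcongr
  have hcint : ∫ t in (0 : ℝ)..1, c t ≤ |x₀| + R := by
    have h1 := hx.eq zero_le_one
    rw [intervalIntegral.integral_sub ((hP.continuous_growth_mem hf hxc).intervalIntegrable _ _)
      (hx.int le_rfl zero_le_one)] at h1
    have h2 : ∫ s in (0 : ℝ)..1, P.growth (x s) (P.mem f x s) ≤ ∫ s in (0 : ℝ)..1, R := by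
      refine intervalIntegral.integral_mono_on zero_le_one
        ((hP.continuous_growth_mem hf hxc).intervalIntegrable _ _) (by simp) fun s hs => ?_
      exact (le_abs_self _).trans (hRb 1 c x zero_le_one le_rfl (hx 1 zero_le_one) s hs)
    simp only [intervalIntegral.integral_const, sub_zero, smul_eq_mul, one_mul] at h2
    linarith [hx.pos zero_le_one, le_abs_self x₀]
  simp only [he]
  rw [intervalIntegral.integral_const_mul, intervalIntegral.integral_const_mul,
    intervalIntegral.integral_sub (by simp) ((hx.int le_rfl zero_le_one).div_const k),
    intervalIntegral.integral_div, mul_assoc]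
  gcongr
  simp only [intervalIntegral.integral_const, sub_zero, smul_eq_mul, one_mul]
  have : (∫ t in (0 : ℝ)..1, c t) / k ≤ 1 / 2 := by
    rw [div_le_div_iff₀ hk0 two_pos, hk]; linarith
  linarith

end Standing

/-! ### Supporting slopes and functionals of concave functions -/

/-- A concave function with at most one supporting slope at an interior point is differentiable
there, and its derivative is a supporting slope. -/
theorem exists_hasDerivAt_of_support_unique {S : Set ℝ} {φ : ℝ → ℝ} {x : ℝ} (hφ : ConcaveOn ℝ S φ)
    (hx : x ∈ interior S)
    (huniq : ∀ p q : ℝ, (∀ y ∈ S, φ y ≤ φ x + p * (y - x)) → (∀ y ∈ S, φ y ≤ φ x + q * (y - x)) →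
      p = q) : ∃ p, HasDerivAt φ p x ∧ ∀ y ∈ S, φ y ≤ φ x + p * (y - x) := by
  have hg : ConvexOn ℝ S (-φ) := hφ.neg
  set r := derivWithin (-φ) (Ioi x) x with hr
  set l := derivWithin (-φ) (Iio x) x with hl
  have hlr : l ≤ r := hg.leftDeriv_le_rightDeriv_of_mem_interior hx
  have hdr : HasDerivWithinAt (-φ) r (Ioi x) x := hg.hasDerivWithinAt_rightDeriv_of_mem_interior hx
  have hdl : HasDerivWithinAt (-φ) l (Iio x) x := hg.hasDerivWithinAt_leftDeriv_of_mem_interior hx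
  have h1 : ∀ y ∈ S, x < y → φ y ≤ φ x + -r * (y - x) := fun y hy hxy => by
    have := hg.le_slope_of_hasDerivWithinAt_Ioi (interior_subset hx) hy hxy hdr
    rw [slope_def_field, le_div_iff₀ (by linarith)] at this
    simp only [Pi.neg_apply] at this
    linarith
  have h2 : ∀ y ∈ S, y < x → φ y ≤ φ x + -l * (y - x) := fun y hy hxy => by
    have := hg.slope_le_of_hasDerivWithinAt_Iio hy (interior_subset hx) hxy hdl
    rw [slope_def_field, div_le_iff₀ (by linarith)] at this
    simp only [Pi.neg_apply] at this
    linarith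
  -- Since `l ≤ r`, both one-sided derivatives support `φ` on both sides of `x`; uniqueness makes
  -- them equal.
  have hsr : ∀ y ∈ S, φ y ≤ φ x + -r * (y - x) := fun y hy => by
    rcases lt_trichotomy x y with h | h | h
    · exact h1 y hy h
    · simp [h]
    · have := h2 y hy h
      nlinarith
  have hsl : ∀ y ∈ S, φ y ≤ φ x + -l * (y - x) := fun y hy => by
    rcases lt_trichotomy x y with h | h | h
    · have := h1 y hy h
      nlinarith
    · simp [h]
    · exact h2 y hy h
  have hrl : r = l := by have := huniq _ _ hsr hsl; linarith
  refine ⟨-r, ?_, hsr⟩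
  rw [← hrl] at hdl
  have h3 : HasDerivWithinAt (-φ) r (Iic x ∪ Ici x) x := hdl.Iic_of_Iio.union hdr.Ici_of_Ioi
  rw [Iic_union_Ici, hasDerivWithinAt_univ] at h3
  simpa using h3.neg

/-- A supporting slope along a line extends to a supporting functional. -/
theorem exists_support_extending {E : Type*} [NormedAddCommGroup E] [NormedSpace ℝ E] {D : Set E}
    {v : E → ℝ} (hD : IsOpen D) (hv : ConcaveOn ℝ D v) (hc : ContinuousOn v D) {z e : E} {p : ℝ}
    (hz : z ∈ D) (hp : ∀ τ : ℝ, z + τ • e ∈ D → v (z + τ • e) ≤ v z + p * τ) :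
    ∃ L : StrongDual ℝ E, L e = p ∧ ∀ y ∈ D, v y ≤ v z + L (y - z) := by
  -- Hahn-Banach separates the open strict hypograph from the graph of the supporting line. The
  -- separating functional, normalized by its vertical component `β > 0`, is the support sought.
  set s : Set (E × ℝ) := {y | y.1 ∈ D ∧ y.2 < v y.1} with hs
  set t : Set (E × ℝ) := range (fun τ : ℝ => (z + τ • e, v z + p * τ)) with ht
  have hs1 : Convex ℝ s := hv.convex_strict_hypograph
  have hs2 : IsOpen s := by
    have h1 : ContinuousOn (fun y : E × ℝ => v y.1 - y.2) (D ×ˢ univ) :=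
      (hc.comp continuousOn_fst fun y hy => hy.1).sub continuousOn_snd
    have h2 := h1.isOpen_inter_preimage (hD.prod isOpen_univ) (isOpen_Ioi (a := (0 : ℝ)))
    convert h2 using 1
    ext y
    simp [hs]
  have ht1 : Convex ℝ t := by
    rintro _ ⟨τ, rfl⟩ _ ⟨σ, rfl⟩ a b - - hab
    refine ⟨a * τ + b * σ, ?_⟩
    obtain rfl : b = 1 - a := by linarith
    ext
    · simp only [Prod.smul_mk, Prod.mk_add_mk]; module
    · simp only [Prod.smul_mk, Prod.mk_add_mk, smul_eq_mul]; ring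
  have hdisj : Disjoint s t := by
    rw [Set.disjoint_left]
    rintro _ ⟨h1, h2⟩ ⟨τ, rfl⟩
    exact absurd h2 (hp τ h1).not_gt
  obtain ⟨f, u, hfs, hft⟩ := geometric_hahn_banach_open hs1 hs2 ht1 hdisj
  have hdec : ∀ (y : E) (a : ℝ), f (y, a) = f (y, 0) + a * f (0, 1) := fun y a => by
    have h : ((y, a) : E × ℝ) = (y, 0) + a • ((0, 1) : E × ℝ) := by
      ext <;> simp
    rw [h, map_add, map_smul, smul_eq_mul]
  set β := f (0, 1) with hβ
  have hline : ∀ τ : ℝ, u ≤ f (z, 0) + v z * β + τ * (f (e, 0) + p * β) := fun τ => by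
    have h1 := hft _ ⟨τ, rfl⟩
    simp only at h1
    rw [hdec] at h1
    have h2 : f (z + τ • e, 0) = f (z, 0) + τ * f (e, 0) := by
      have h : ((z + τ • e, 0) : E × ℝ) = (z, 0) + τ • ((e, 0) : E × ℝ) := by ext <;> simp
      rw [h, map_add, map_smul, smul_eq_mul]
    rw [h2] at h1
    linarith
  have hβ0 : 0 < β := by
    have h1 := hfs (z, v z - 1) ⟨hz, by simp⟩
    rw [hdec] at h1
    have h2 := hline 0
    linarith
  -- An affine function of `τ` bounded below on all of `ℝ` has zero slope; this says that the
  -- support extends the given line.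
  have he : f (e, 0) + p * β = 0 := by
    by_contra hne
    have h1 := hline ((u - 1 - (f (z, 0) + v z * β)) / (f (e, 0) + p * β))
    rw [div_mul_cancel₀ _ hne] at h1
    linarith
  refine ⟨(-β⁻¹) • f.comp (ContinuousLinearMap.inl ℝ E ℝ), ?_, fun y hy => ?_⟩
  · simp only [_root_.smul_apply, ContinuousLinearMap.comp_apply,
      ContinuousLinearMap.inl_apply, smul_eq_mul]
    field_simp
    linarith
  · have h1 : v y * β ≤ f (z, 0) + v z * β - f (y, 0) := by
      refine le_of_forall_pos_le_add fun ε hε => ?_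
      have h1 := hfs (y, v y - ε / β) ⟨hy, by simp; positivity⟩
      have h2 := hline 0
      rw [hdec] at h1
      have h3 : (v y - ε / β) * β = v y * β - ε := by field_simp
      linarith
    have h2 : f (y - z, 0) = f (y, 0) - f (z, 0) := by
      rw [← map_sub]; simp
    simp only [_root_.smul_apply, ContinuousLinearMap.comp_apply,
      ContinuousLinearMap.inl_apply, smul_eq_mul]
    rw [h2]
    have h3 : v y ≤ (f (z, 0) + v z * β - f (y, 0)) / β := (le_div_iff₀ hβ0).2 h1
    refine h3.trans (le_of_eq ?_)
    field_simp
    ring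

/-! ### The value as a function on a Banach space -/

variable {P : Problem}

variable (P) in
/-- A time beyond which the past does not contribute to the delayed term. -/
def horizon : ℝ := |P.T| + 1

theorem horizon_nonneg : 0 ≤ P.horizon := by unfold horizon; positivity

variable (P) in
/-- Current states together with contributions of the past to the delayed term. -/
abbrev State : Type := ℝ × C(Icc (0 : ℝ) P.horizon, ℝ)

/-- The function on `[0,∞)` represented by `w`; it vanishes beyond the horizon. -/
def forcing (w : C(Icc (0 : ℝ) P.horizon, ℝ)) (t : ℝ) : ℝ :=
  w (projIcc 0 P.horizon horizon_nonneg t) - w ⟨P.horizon, horizon_nonneg, le_rfl⟩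

variable (P) in
/-- Restriction of a continuous function to `[0, horizon]`. -/
def restr (f : ℝ → ℝ) (hf : Continuous f) : C(Icc (0 : ℝ) P.horizon, ℝ) :=
  ⟨fun s => f s, hf.comp continuous_subtype_val⟩

theorem continuous_forcing (w : C(Icc (0 : ℝ) P.horizon, ℝ)) : Continuous (forcing w) := by
  unfold forcing
  exact (w.continuous.comp continuous_projIcc).sub continuous_const

theorem forcing_of_ge (w : C(Icc (0 : ℝ) P.horizon, ℝ)) {t : ℝ} (ht : P.horizon ≤ t) :
    forcing w t = 0 := by
  rw [forcing, projIcc_of_right_le _ ht, sub_self]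

theorem abs_forcing_sub_le (w w' : C(Icc (0 : ℝ) P.horizon, ℝ)) (t : ℝ) :
    |forcing w t - forcing w' t| ≤ 2 * ‖w - w'‖ := by
  have h1 := (w - w').norm_coe_le_norm (projIcc 0 P.horizon horizon_nonneg t)
  have h2 := (w - w').norm_coe_le_norm ⟨P.horizon, horizon_nonneg, le_rfl⟩
  rw [ContinuousMap.sub_apply, Real.norm_eq_abs] at h1 h2
  have e : forcing w t - forcing w' t = (w (projIcc 0 P.horizon horizon_nonneg t) -
      w' (projIcc 0 P.horizon horizon_nonneg t)) - (w ⟨P.horizon, horizon_nonneg, le_rfl⟩ -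
      w' ⟨P.horizon, horizon_nonneg, le_rfl⟩) := by unfold forcing; ring
  rw [e]
  exact (abs_sub _ _).trans (by linarith)

theorem forcing_restr {f : ℝ → ℝ} (hf : Continuous f) (h0 : ∀ s, P.horizon ≤ s → f s = 0) {t : ℝ}
    (ht : 0 ≤ t) : forcing (P.restr f hf) t = f t := by
  simp only [forcing, restr, ContinuousMap.coe_mk]
  rw [h0 P.horizon le_rfl, sub_zero]
  rcases le_or_gt t P.horizon with h | h
  · rw [projIcc_of_mem _ ⟨ht, h⟩]
  · rw [projIcc_of_right_le _ h.le, h0 t h.le, h0 _ le_rfl]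

theorem restr_congr {f g : ℝ → ℝ} {hf : Continuous f} {hg : Continuous g}
    (h : ∀ s, 0 ≤ s → f s = g s) : P.restr f hf = P.restr g hg :=
  ContinuousMap.ext fun s => h s s.2.1

theorem IsFeasible.congr {x₀ : ℝ} {f f' c x : ℝ → ℝ} (hx : P.IsFeasible x₀ f c x)
    (hf : ∀ s, 0 ≤ s → f s = f' s) : P.IsFeasible x₀ f' c x := fun h hh => (hx h hh).congr hf

theorem IsGain.congr {x₀ j : ℝ} {f f' : ℝ → ℝ} (hj : P.IsGain x₀ f j)
    (hf : ∀ s, 0 ≤ s → f s = f' s) : P.IsGain x₀ f' j := by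
  obtain ⟨c, x, hx, h⟩ := hj
  exact ⟨c, x, hx.congr hf, h⟩

variable (P) in
/-- The states from which a finite payoff is possible. -/
def dom : Set P.State := {z | ∃ j, P.IsGain z.1 (forcing z.2) j}

variable (P) in
/-- The supremum of the finite payoffs. -/
def val (z : P.State) : ℝ := sSup {j | P.IsGain z.1 (forcing z.2) j}

variable (P) in
/-- The direction in which only the current state moves. -/
def dir : P.State := (1, 0)

theorem add_smul_dir (z : P.State) (τ : ℝ) : z + τ • P.dir = (z.1 + τ, z.2) := by
  ext1 <;> simp [dir]

namespace Standing
variable (hP : P.Standing)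
include hP

theorem horizon_eq : P.horizon = P.T + 1 := by rw [horizon, abs_of_pos hP.T_pos]

theorem bddAbove_gains (z : P.State) : BddAbove {j | P.IsGain z.1 (forcing z.2) j} := by
  obtain ⟨K, -, hK⟩ := hP.exists_gain_le
  exact ⟨K, fun j hj => hK _ _ _ hj⟩

theorem le_val {z : P.State} {j : ℝ} (hj : P.IsGain z.1 (forcing z.2) j) : j ≤ P.val z :=
  le_csSup (hP.bddAbove_gains z) hj

omit hP in
theorem exists_gain_gt {z : P.State} (hz : z ∈ P.dom) {a : ℝ} (ha : a < P.val z) :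
    ∃ j, P.IsGain z.1 (forcing z.2) j ∧ a < j := exists_lt_of_lt_csSup hz ha

omit hP in
theorem val_le {z : P.State} (hz : z ∈ P.dom) {K : ℝ}
    (h : ∀ j, P.IsGain z.1 (forcing z.2) j → j ≤ K) : P.val z ≤ K := csSup_le hz h

theorem concaveOn_val : ConcaveOn ℝ P.dom P.val := by
  have hforce : ∀ (z z' : P.State) (s t v : ℝ),
      s * forcing z.2 v + t * forcing z'.2 v = forcing (s • z + t • z').2 v := by
    intro z z' s t v
    simp only [forcing, Prod.snd_add, Prod.smul_snd, ContinuousMap.add_apply,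
      ContinuousMap.smul_apply, smul_eq_mul]
    ring
  have key : ∀ z ∈ P.dom, ∀ z' ∈ P.dom, ∀ s t : ℝ, 0 ≤ s → 0 ≤ t → s + t = 1 → ∀ j j',
      P.IsGain z.1 (forcing z.2) j → P.IsGain z'.1 (forcing z'.2) j' →
      ∃ k, s * j + t * j' ≤ k ∧ P.IsGain (s • z + t • z').1 (forcing (s • z + t • z').2) k := by
    intro z _ z' _ s t hs ht hst j j' hj hj'
    obtain ⟨k, hk, hg⟩ := hP.gain_combo (continuous_forcing z.2) (continuous_forcing z'.2) hj hj' hs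
      ht hst
    exact ⟨k, hk, by simpa using hg.congr fun v _ => hforce z z' s t v⟩
  refine ⟨fun z hz z' hz' s t hs ht hst => ?_, fun z hz z' hz' s t hs ht hst => ?_⟩
  · obtain ⟨j, hj⟩ := hz
    obtain ⟨j', hj'⟩ := hz'
    obtain ⟨k, -, hk⟩ := key z ⟨j, hj⟩ z' ⟨j', hj'⟩ s t hs ht hst j j' hj hj'
    exact ⟨k, hk⟩
  · refine le_of_forall_pos_le_add fun ε hε => ?_
    obtain ⟨j, hj, hjε⟩ := exists_gain_gt hz (a := P.val z - ε) (by linarith)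
    obtain ⟨j', hj', hjε'⟩ := exists_gain_gt hz' (a := P.val z' - ε) (by linarith)
    obtain ⟨k, hk, hg⟩ := key z hz z' hz' s t hs ht hst j j' hj hj'
    have h1 := hP.le_val hg
    simp only [smul_eq_mul]
    have h2 := mul_le_mul_of_nonneg_left hjε.le hs
    have h3 := mul_le_mul_of_nonneg_left hjε'.le ht
    have h4 : s * ε + t * ε = ε := by rw [← add_mul, hst, one_mul]
    linarith

theorem exists_ball_val_ge {z : P.State} (hz : z ∈ P.dom) : ∃ ε K, 0 < ε ∧
    ∀ y, dist y z < ε → y ∈ P.dom ∧ K ≤ P.val y := by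
  obtain ⟨j, c, x, hx, -⟩ := hz
  obtain ⟨ε, K, hε, h⟩ := hP.exists_gain_ge_near horizon_nonneg (continuous_forcing z.2)
    (hx P.horizon horizon_nonneg)
  refine ⟨ε / 2, K, half_pos hε, fun y hy => ?_⟩
  rw [Prod.dist_eq, max_lt_iff, Real.dist_eq, dist_eq_norm] at hy
  obtain ⟨k, hk, hg⟩ := h y.1 (forcing y.2) (continuous_forcing _) (by linarith [hy.1])
    (fun s _ => (abs_forcing_sub_le _ _ s).trans (by linarith [hy.2]))
    (fun s hs => forcing_of_ge _ hs)
  exact ⟨⟨k, hg⟩, hk.trans (hP.le_val hg)⟩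

theorem isOpen_dom : IsOpen P.dom := by
  rw [Metric.isOpen_iff]
  intro z hz
  obtain ⟨ε, K, hε, h⟩ := hP.exists_ball_val_ge hz
  exact ⟨ε, hε, fun y hy => (h y hy).1⟩

/-- A concave function on an open set that is bounded below near one point is continuous. -/
theorem continuousOn_val : ContinuousOn P.val P.dom := by
  rcases P.dom.eq_empty_or_nonempty with h | h
  · rw [h]; exact continuousOn_empty _
  · refine ((hP.concaveOn_val.continuousOn_tfae hP.isOpen_dom h).out 1 3).2 ?_
    obtain ⟨z, hz⟩ := h
    obtain ⟨ε, K, hε, h⟩ := hP.exists_ball_val_ge hz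
    refine ⟨z, hz, K, ?_⟩
    rw [eventually_map]
    filter_upwards [Metric.ball_mem_nhds z hε] with y hy using (h y hy).2

/-- Strictness survives the supremum because the gap `γ` does not depend on the control. -/
theorem val_lt_add {z : P.State} (hz : z ∈ P.dom) {τ : ℝ} (hτ : 0 < τ) :
    z + τ • P.dir ∈ P.dom ∧ P.val z < P.val (z + τ • P.dir) := by
  obtain ⟨γ, hγ, h⟩ := hP.exists_gain_add (x₀ := z.1) (continuous_forcing z.2) hτ
  rw [add_smul_dir]
  refine ⟨?_, ?_⟩
  · obtain ⟨j, hj⟩ := hz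
    obtain ⟨j', -, hj'⟩ := h j hj
    exact ⟨j', hj'⟩
  · obtain ⟨j, hj, hjγ⟩ := exists_gain_gt hz (a := P.val z - γ) (by linarith)
    obtain ⟨j', hle, hj'⟩ := h j hj
    have := hP.le_val (z := (z.1 + τ, z.2)) hj'
    linarith

theorem support_slope_pos {z : P.State} (hz : z ∈ P.dom) {L : StrongDual ℝ P.State}
    (hL : ∀ y ∈ P.dom, P.val y ≤ P.val z + L (y - z)) : 0 < L P.dir := by
  obtain ⟨h1, h2⟩ := hP.val_lt_add hz one_pos
  have := hL _ h1
  rw [one_smul] at this h2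
  rw [add_sub_cancel_left] at this
  linarith

theorem exists_support {z : P.State} (hz : z ∈ P.dom) {p : ℝ}
    (hp : ∀ τ : ℝ, z + τ • P.dir ∈ P.dom → P.val (z + τ • P.dir) ≤ P.val z + p * τ) :
    ∃ L : StrongDual ℝ P.State, L P.dir = p ∧ ∀ y ∈ P.dom, P.val y ≤ P.val z + L (y - z) :=
  exists_support_extending hP.isOpen_dom hP.concaveOn_val hP.continuousOn_val hz hp

/-- If all supporting functionals agree in the direction `dir`, the value is differentiable in that
direction. -/
theorem exists_hasDerivAt_val {z : P.State} (hz : z ∈ P.dom)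
    (huniq : ∀ L L' : StrongDual ℝ P.State, (∀ y ∈ P.dom, P.val y ≤ P.val z + L (y - z)) →
      (∀ y ∈ P.dom, P.val y ≤ P.val z + L' (y - z)) → L P.dir = L' P.dir) :
    ∃ L : StrongDual ℝ P.State, (∀ y ∈ P.dom, P.val y ≤ P.val z + L (y - z)) ∧
      HasDerivAt (fun s : ℝ => P.val (s, z.2)) (L P.dir) z.1 := by
  set S : Set ℝ := {s | (s, z.2) ∈ P.dom} with hS
  have hSo : IsOpen S := hP.isOpen_dom.preimage (by fun_prop)
  have hφ : ConcaveOn ℝ S (fun s : ℝ => P.val (s, z.2)) := by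
    have hc : ∀ s s' a b : ℝ, a + b = 1 → ((a • s + b • s', z.2) : P.State) =
        a • (s, z.2) + b • (s', z.2) := fun s s' a b hab => by
      ext1
      · simp
      · simp [← add_smul, hab]
    refine ⟨fun s hs s' hs' a b ha hb hab => ?_, fun s hs s' hs' a b ha hb hab => ?_⟩
    · simp only [hS, mem_ofPred_eq]
      rw [hc _ _ _ _ hab]
      exact hP.concaveOn_val.1 hs hs' ha hb hab
    · simp only [hc _ _ _ _ hab]
      exact hP.concaveOn_val.2 hs hs' ha hb hab
  have hext : ∀ p, (∀ y ∈ S, P.val (y, z.2) ≤ P.val (z.1, z.2) + p * (y - z.1)) →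
      ∃ L : StrongDual ℝ P.State, L P.dir = p ∧ ∀ y ∈ P.dom, P.val y ≤ P.val z + L (y - z) := by
    intro p hp
    refine hP.exists_support hz fun τ hτ => ?_
    rw [add_smul_dir] at hτ ⊢
    simpa using hp (z.1 + τ) hτ
  obtain ⟨p, hp, hsup⟩ := exists_hasDerivAt_of_support_unique hφ
    (x := z.1) (by rw [hSo.interior_eq]; exact hz) (fun p q hp hq => by
      obtain ⟨L, rfl, hL⟩ := hext p hp
      obtain ⟨L', rfl, hL'⟩ := hext q hq
      exact huniq L L' hL hL')
  obtain ⟨L, rfl, hL⟩ := hext p hsup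
  exact ⟨L, hL, hp⟩

end Standing

/-! ### Smooth pasts and first-order expansion of the state -/

variable (P) in
/-- `f`, with derivative `f'`, is a contribution of the past that is smooth up to uniform errors. -/
structure IsSmoothPast (f f' : ℝ → ℝ) : Prop where
  deriv : ∀ s, HasDerivAt f (f' s) s
  unif : UniformContinuous f'
  zero : ∀ s, P.T ≤ s → f s = 0

theorem IsSmoothPast.continuous {f f' : ℝ → ℝ} (hf : P.IsSmoothPast f f') : Continuous f :=
  continuous_iff_continuousAt.2 fun s => (hf.deriv s).continuousAt

theorem IsSmoothPast.increment {f f' : ℝ → ℝ} (hf : P.IsSmoothPast f f') {ε : ℝ} (hε : 0 < ε) :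
    ∃ δ, 0 < δ ∧ ∀ h, |h| < δ → ∀ s, |f (s + h) - f s - h * f' s| ≤ ε * |h| := by
  obtain ⟨δ, hδ, hu⟩ := Metric.uniformContinuous_iff.1 hf.unif ε hε
  refine ⟨δ, hδ, fun h hh s => ?_⟩
  have := Convex.norm_image_sub_le_of_norm_hasDerivWithin_le (f := fun u => f u - u * f' s)
    (f' := fun u => f' u - 1 * f' s) (s := uIcc s (s + h)) (x := s) (y := s + h) (C := ε)
    (fun u _ => ((hf.deriv u).sub ((hasDerivAt_id u).mul_const (f' s))).hasDerivWithinAt)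
    (fun u hu' => by
      rw [one_mul, ← dist_eq_norm]
      refine (hu ?_).le
      rw [Real.dist_eq]
      have := abs_sub_left_of_mem_uIcc hu'
      rw [add_sub_cancel_left] at this
      linarith)
    (convex_uIcc _ _) left_mem_uIcc right_mem_uIcc
  rw [add_sub_cancel_left, Real.norm_eq_abs, Real.norm_eq_abs] at this
  convert this using 2
  ring

theorem eventually_mul_le (K : ℝ) {ε : ℝ} (hε : 0 < ε) : ∀ᶠ h in 𝓝[>] (0 : ℝ), K * h ≤ ε := by
  have h1 : Tendsto (fun h : ℝ => K * h) (𝓝[>] 0) (𝓝 (K * 0)) :=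
    ((continuous_const_mul K).tendsto 0).mono_left nhdsWithin_le_nhds
  rw [mul_zero] at h1
  exact h1.eventually_le_const hε

variable (P) in
/-- The rate of change of the contribution of the past. -/
def pastRate (x₀ : ℝ) (f' : ℝ → ℝ) (s : ℝ) : ℝ := f' s + x₀ * P.kern (-s)

theorem tendsto_one_sub_exp_div (a : ℝ) :
    Tendsto (fun h : ℝ => (1 - Real.exp (-a * h)) / h) (𝓝[>] 0) (𝓝 a) := by
  have hd : HasDerivAt (fun h : ℝ => 1 - Real.exp (-a * h)) a 0 := by
    have := (((hasDerivAt_id (0 : ℝ)).const_mul (-a)).exp).const_sub 1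
    refine this.congr_deriv ?_
    simp
  have := hd.tendsto_slope_zero_right
  refine this.congr fun h => ?_
  simp [div_eq_inv_mul]

theorem exp_mul_bounds {a h t y : ℝ} (ha : 0 ≤ a) (ht : 0 ≤ t) (hth : t ≤ h) :
    |Real.exp (-a * t) * y - y| ≤ a * h * |y| := by
  have h1 : 1 - a * h ≤ Real.exp (-a * t) := by
    have := Real.add_one_le_exp (-a * t)
    nlinarith
  have h2 : Real.exp (-a * t) ≤ 1 := Real.exp_le_one_iff.2 (by nlinarith)
  have e : Real.exp (-a * t) * y - y = -((1 - Real.exp (-a * t)) * y) := by ring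
  rw [e, abs_neg, abs_mul, abs_of_nonneg (by linarith)]
  gcongr
  linarith

namespace Standing
variable (hP : P.Standing)
include hP

theorem continuous_pastRate {x₀ : ℝ} {f f' : ℝ → ℝ} (hf : P.IsSmoothPast f f') :
    Continuous (P.pastRate x₀ f') :=
  hf.unif.continuous.add (continuous_const.mul (hP.continuous_kern.comp continuous_neg))

/-- Over a short time, the trajectory adds to the memory nearly `h` times `x₀ kern(-s)`, uniformly
in `s`. The offset `θ` covers both directions of time: `θ = -h` forwards and `θ = 0` backwards. -/
theorem conv_short : ∃ A, 0 < A ∧ (∀ v, P.kern v ≤ A) ∧ ∀ ε, 0 < ε → ∀ᶠ h in 𝓝[>] (0 : ℝ),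
    ∀ (x₀ η θ s : ℝ) (x : ℝ → ℝ), Continuous x → |θ| ≤ h → (∀ u ∈ Icc 0 h, |x u - x₀| ≤ η) →
    |(∫ u in (0 : ℝ)..h, P.kern (u + θ - s) * x u) - h * (x₀ * P.kern (-s))| ≤
      h * (A * η + |x₀| * ε) := by
  obtain ⟨A, hA, hkA⟩ := hP.exists_kern_le
  refine ⟨A, hA, hkA, fun ε hε => ?_⟩
  obtain ⟨δ, hδ, hu⟩ := Metric.uniformContinuous_iff.1 hP.uniformContinuous_kern ε hε
  have hk := hP.continuous_kern
  filter_upwards [Ioo_mem_nhdsGT (half_pos hδ)] with h hh x₀ η θ s x hx hθ hxη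
  have hh0 : 0 ≤ h := hh.1.le
  have e : (∫ u in (0 : ℝ)..h, P.kern (u + θ - s) * x u) - h * (x₀ * P.kern (-s)) =
      ∫ u in (0 : ℝ)..h, (P.kern (u + θ - s) * x u - x₀ * P.kern (-s)) := by
    rw [intervalIntegral.integral_sub (Continuous.intervalIntegrable (by fun_prop) _ _) (by simp)]
    simp only [intervalIntegral.integral_const, sub_zero, smul_eq_mul]
  rw [e, ← Real.norm_eq_abs]
  refine (intervalIntegral.norm_integral_le_of_norm_le_const (C := A * η + |x₀| * ε)
    fun u hu' => ?_).trans (le_of_eq ?_)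
  · rw [uIoc_of_le hh0] at hu'
    have e2 : P.kern (u + θ - s) * x u - x₀ * P.kern (-s) =
        P.kern (u + θ - s) * (x u - x₀) + x₀ * (P.kern (u + θ - s) - P.kern (-s)) := by ring
    rw [e2, Real.norm_eq_abs]
    refine (abs_add_le _ _).trans (add_le_add ?_ ?_)
    · rw [abs_mul, abs_of_nonneg (hP.kern_nonneg _)]
      exact mul_le_mul (hkA _) (hxη u ⟨hu'.1.le, hu'.2⟩) (abs_nonneg _) hA.le
    · rw [abs_mul]
      refine mul_le_mul_of_nonneg_left ?_ (abs_nonneg _)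
      rw [← Real.dist_eq]
      refine (hu ?_).le
      rw [Real.dist_eq, show u + θ - s - -s = u + θ by ring]
      refine (abs_add_le _ _).trans_lt ?_
      rw [abs_of_pos hu'.1]
      linarith [hu'.2, hh.2]
  · rw [sub_zero, abs_of_nonneg hh0, mul_comm]

/-- This function inverts `pastAfter`: it is the past contribution which, after `x` has been
followed for time `h`, becomes `f`. -/
theorem continuous_backward {f : ℝ → ℝ} (hf : Continuous f) {x : ℝ → ℝ}
    (hx : Continuous x) (h : ℝ) :
    Continuous (fun s => f (s - h) - ∫ u in (0 : ℝ)..h, P.kern (u - s) * x u) :=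
  (hf.comp (continuous_sub_right h)).sub (hP.continuous_conv hx h)

theorem backward_increment {x₀ : ℝ} {f f' : ℝ → ℝ} (hf : P.IsSmoothPast f f') :
    ∃ A, 0 < A ∧ ∀ ε, 0 < ε → ∀ᶠ h in 𝓝[>] (0 : ℝ), ∀ (η : ℝ) (x : ℝ → ℝ) (hx : Continuous x),
      (∀ u ∈ Icc 0 h, |x u - x₀| ≤ η) →
      ‖P.restr _ (hP.continuous_backward hf.continuous hx h) - P.restr f hf.continuous +
        h • P.restr _ (hP.continuous_pastRate (x₀ := x₀) hf)‖ ≤ h * (A * η + ε) := by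
  obtain ⟨A, hA, -, hc⟩ := hP.conv_short
  refine ⟨A, hA, fun ε hε => ?_⟩
  obtain ⟨δ, hδ, hinc⟩ := hf.increment (half_pos hε)
  have hε' : 0 < ε / (2 * (|x₀| + 1)) := by positivity
  filter_upwards [hc _ hε', Ioo_mem_nhdsGT hδ] with h hch hh η x hx hxη
  have hη : 0 ≤ η := (abs_nonneg _).trans (hxη 0 ⟨le_rfl, hh.1.le⟩)
  have hh0 := hh.1
  rw [ContinuousMap.norm_le _ (by positivity)]
  intro s
  simp only [restr, ContinuousMap.add_apply, ContinuousMap.sub_apply, ContinuousMap.smul_apply,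
    ContinuousMap.coe_mk, smul_eq_mul, pastRate, Real.norm_eq_abs]
  have h1 := hinc (-h) (by rw [abs_neg, abs_of_pos hh0]; exact hh.2) s
  have h2 := hch x₀ η 0 s x hx (by simpa using hh0.le) hxη
  simp only [add_zero] at h2
  rw [abs_neg, abs_of_pos hh0] at h1
  have e : f (s - h) - (∫ u in (0 : ℝ)..h, P.kern (u - s) * x u) - f s +
      h * (f' s + x₀ * P.kern (-s)) = (f (s + -h) - f s - -h * f' s) -
      ((∫ u in (0 : ℝ)..h, P.kern (u - s) * x u) - h * (x₀ * P.kern (-s))) := by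
    rw [← sub_eq_add_neg]; ring
  rw [e]
  refine (abs_sub _ _).trans ((add_le_add h1 h2).trans ?_)
  have h3 : |x₀| * (ε / (2 * (|x₀| + 1))) ≤ ε / 2 := by
    rw [mul_div_assoc', div_le_div_iff₀ (by positivity) two_pos]
    nlinarith [abs_nonneg x₀]
  have h4 := mul_le_mul_of_nonneg_left h3 hh0.le
  nlinarith

/-- The error retains the total consumption `∫ c`, since nothing prevents an arbitrary control from
consuming a non-negligible amount in a short time. The quantifiers make the expansion uniform over
all controls. -/
theorem forward_increment {x₀ : ℝ} {f f' : ℝ → ℝ} (hf : P.IsSmoothPast f f') :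
    ∃ C, 0 < C ∧ ∀ ε, 0 < ε → ∀ᶠ h in 𝓝[>] (0 : ℝ), ∀ (c x : ℝ → ℝ) (hx : P.IsArc h x₀ f c x),
      (∀ u ∈ Icc 0 h, x u ≤ x₀ + C * h) ∧
      |x h - x₀ - (h * P.growth x₀ (f 0) - ∫ u in (0 : ℝ)..h, c u)| ≤
        h * (C * (∫ u in (0 : ℝ)..h, c u) + ε) ∧
      ‖P.restr _ (hP.continuous_pastAfter hf.continuous hx.cont h) - P.restr f hf.continuous -
        h • P.restr _ (hP.continuous_pastRate (x₀ := x₀) hf)‖ ≤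
        h * (C * (∫ u in (0 : ℝ)..h, c u) + ε) := by
  obtain ⟨A, hA, hkA, hc⟩ := hP.conv_short
  obtain ⟨R, hR, hRb⟩ := hP.exists_arc_bound x₀ hf.continuous
  have hr := hP.r_nonneg
  have hCf := hP.Cf_nonneg
  have hk := hP.continuous_kern
  refine ⟨P.r + P.Cf + R + A, by positivity, fun ε hε => ?_⟩
  obtain ⟨δ, hδ, hinc⟩ := hf.increment (ε := ε / 4) (by positivity)
  have hε' : 0 < ε / (4 * (|x₀| + 1)) := by positivity
  have hεC : 0 < ε / (4 * (P.Cf + 1)) := by positivity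
  have hfc : ∀ᶠ h in 𝓝[>] (0 : ℝ), ∀ u ∈ Icc 0 h, |f u - f 0| ≤ ε / (4 * (P.Cf + 1)) := by
    obtain ⟨δ', hδ', hu⟩ := Metric.continuousAt_iff.1 (hf.continuous.continuousAt (x := 0)) _ hεC
    filter_upwards [Ioo_mem_nhdsGT hδ'] with h hh u hu'
    rw [← Real.dist_eq]
    refine (hu ?_).le
    rw [Real.dist_eq, sub_zero, abs_of_nonneg hu'.1]
    exact hu'.2.trans_lt hh.2
  filter_upwards [hc _ hε', Ioo_mem_nhdsGT hδ, Ioo_mem_nhdsGT one_pos, hfc,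
    eventually_mul_le (A * R) (ε := ε / 4) (by positivity),
    eventually_mul_le ((P.r + P.Cf) * R + P.Cf * (A * (|x₀| + R))) (ε := ε / 4) (by positivity)]
    with h hch hh hh1 hfh hAR hK c x hx
  have hh0 := hh.1
  have hxc := hx.cont
  set d := ∫ u in (0 : ℝ)..h, c u with hd
  have hd0 : 0 ≤ d := intervalIntegral.integral_nonneg hh0.le fun u hu => hx.nonneg u hu
  have hgi : ∀ a b, IntervalIntegrable (fun s => P.growth (x s) (P.mem f x s)) volume a b :=
    fun a b => (hP.continuous_growth_mem hf.continuous hxc).intervalIntegrable _ _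
  have hgrow : ∀ u ∈ Icc 0 h, |∫ s in (0 : ℝ)..u, P.growth (x s) (P.mem f x s)| ≤ R * h :=
    fun u hu => by
      rw [← Real.norm_eq_abs]
      refine (intervalIntegral.norm_integral_le_of_norm_le_const (C := R) fun s hs => ?_).trans ?_
      · rw [uIoc_of_le hu.1] at hs
        exact hRb h c x hh0.le hh1.2.le hx s ⟨hs.1.le, hs.2.trans hu.2⟩
      · rw [sub_zero, abs_of_nonneg hu.1]
        exact mul_le_mul_of_nonneg_left hu.2 hR.le
  have hxe : ∀ u ∈ Icc 0 h, x u - x₀ = (∫ s in (0 : ℝ)..u, P.growth (x s) (P.mem f x s)) -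
      ∫ s in (0 : ℝ)..u, c s := fun u hu => by
    rw [hx.eq u hu, intervalIntegral.integral_sub (hgi _ _) (hx.mono hu.1 hu.2).int]
    ring
  have hcu : ∀ u ∈ Icc 0 h, 0 ≤ ∫ s in (0 : ℝ)..u, c s := fun u hu =>
    intervalIntegral.integral_nonneg hu.1 fun s hs => hx.nonneg s ⟨hs.1, hs.2.trans hu.2⟩
  have hcd : ∀ u ∈ Icc 0 h, ∫ s in (0 : ℝ)..u, c s ≤ d := fun u hu => by
    have h1 := (hx.mono hu.1 hu.2).int
    rw [hd, ← intervalIntegral.integral_add_adjacent_intervals h1 (h1.symm.trans hx.int)]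
    have := intervalIntegral.integral_nonneg (f := c) (μ := volume) hu.2
      fun s hs => hx.nonneg s ⟨hu.1.trans hs.1, hs.2⟩
    linarith
  have hxu : ∀ u ∈ Icc 0 h, x u ≤ x₀ + R * h := fun u hu => by
    linarith [hxe u hu, (abs_le.1 (hgrow u hu)).2, hcu u hu]
  have hxd : ∀ u ∈ Icc 0 h, |x u - x₀| ≤ R * h + d := fun u hu => by
    have h1 := abs_le.1 (hgrow u hu)
    rw [hxe u hu, abs_le]
    constructor <;> linarith [hcu u hu, hcd u hu]
  refine ⟨fun u hu => (hxu u hu).trans ?_, ?_, ?_⟩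
  · gcongr; linarith
  · have hdiff : ∀ u ∈ Icc 0 h, |P.growth (x u) (P.mem f x u) - P.growth x₀ (f 0)| ≤
        (P.r + P.Cf) * d + ε / 2 := fun u hu => by
      have h1 := hP.growth_lipschitz (x u) x₀ (P.mem f x u) (f 0)
      have h2 : |P.mem f x u - f 0| ≤ ε / (4 * (P.Cf + 1)) + A * (|x₀| + R) * h := by
        have e : P.mem f x u - f 0 = (f u - f 0) + ∫ s in (0 : ℝ)..u, P.kern (s - u) * x s := by
          unfold mem; ring
        rw [e]
        refine (abs_add_le _ _).trans (add_le_add (hfh u hu) ?_)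
        rw [← Real.norm_eq_abs]
        refine (intervalIntegral.norm_integral_le_of_norm_le_const (C := A * (|x₀| + R))
          fun s hs => ?_).trans ?_
        · rw [uIoc_of_le hu.1] at hs
          have hs' : s ∈ Icc 0 h := ⟨hs.1.le, hs.2.trans hu.2⟩
          rw [Real.norm_eq_abs, abs_mul, abs_of_nonneg (hP.kern_nonneg _),
            abs_of_pos (hx.pos s hs')]
          refine mul_le_mul (hkA _) ?_ (hx.pos s hs').le hA.le
          have := hxu s hs'
          nlinarith [le_abs_self x₀, hh1.2]
        · rw [sub_zero, abs_of_nonneg hu.1]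
          exact mul_le_mul_of_nonneg_left hu.2 (by positivity)
      have h3 := mul_le_mul_of_nonneg_left (hxd u hu) (add_nonneg hr hCf)
      have h4 := mul_le_mul_of_nonneg_left h2 hCf
      have h5 : P.Cf * (ε / (4 * (P.Cf + 1))) ≤ ε / 4 := by
        rw [mul_div_assoc', div_le_div_iff₀ (by positivity) (by positivity)]
        nlinarith
      nlinarith
    have e : x h - x₀ - (h * P.growth x₀ (f 0) - d) =
        ∫ u in (0 : ℝ)..h, (P.growth (x u) (P.mem f x u) - P.growth x₀ (f 0)) := by
      rw [hxe h ⟨hh0.le, le_rfl⟩, intervalIntegral.integral_sub (hgi _ _) (by simp)]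
      simp [hd]
    rw [e, ← Real.norm_eq_abs]
    refine (intervalIntegral.norm_integral_le_of_norm_le_const
      (C := (P.r + P.Cf) * d + ε / 2) fun u hu => ?_).trans ?_
    · rw [uIoc_of_le hh0.le] at hu
      exact hdiff u ⟨hu.1.le, hu.2⟩
    · rw [sub_zero, abs_of_pos hh0, mul_comm]
      refine mul_le_mul_of_nonneg_left ?_ hh0.le
      have : 0 ≤ (R + A) * d := by positivity
      nlinarith
  · rw [ContinuousMap.norm_le _ (by positivity)]
    intro s
    simp only [restr, ContinuousMap.sub_apply, ContinuousMap.smul_apply,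
      ContinuousMap.coe_mk, smul_eq_mul, pastRate, pastAfter, Real.norm_eq_abs]
    have h1 := hinc h (by rw [abs_of_pos hh0]; exact hh.2) s
    have h2 := hch x₀ (R * h + d) (-h) s x hxc (by rw [abs_neg, abs_of_pos hh0]) hxd
    simp only [← sub_eq_add_neg] at h2
    rw [abs_of_pos hh0] at h1
    have e : f (h + s) + (∫ u in (0 : ℝ)..h, P.kern (u - h - s) * x u) - f s -
        h * (f' s + x₀ * P.kern (-s)) = (f (s + h) - f s - h * f' s) +
        ((∫ u in (0 : ℝ)..h, P.kern (u - h - s) * x u) - h * (x₀ * P.kern (-s))) := by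
      rw [add_comm h s]; ring
    rw [e]
    refine (abs_add_le _ _).trans ((add_le_add h1 h2).trans ?_)
    have h3 : |x₀| * (ε / (4 * (|x₀| + 1))) ≤ ε / 4 := by
      rw [mul_div_assoc', div_le_div_iff₀ (by positivity) (by positivity)]
      nlinarith [abs_nonneg x₀]
    have h5 : ε / 4 + (A * (R * h + d) + |x₀| * (ε / (4 * (|x₀| + 1)))) ≤
        (P.r + P.Cf + R + A) * d + ε := by
      have : 0 ≤ (P.r + P.Cf + R) * d := by positivity
      nlinarith
    calc _ = h * (ε / 4 + (A * (R * h + d) + |x₀| * (ε / (4 * (|x₀| + 1))))) := by ring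
      _ ≤ _ := mul_le_mul_of_nonneg_left h5 hh0.le

/-! ### The Hamilton-Jacobi-Bellman equation for supporting functionals -/

omit hP in
theorem pos_of_mem_dom {z : P.State} (hz : z ∈ P.dom) : 0 < z.1 := by
  obtain ⟨j, c, x, hx, -⟩ := hz
  rw [← hx.init]
  exact hx.pos le_rfl

theorem forcing_restr_of_past {f f' : ℝ → ℝ} (hf : P.IsSmoothPast f f') {t : ℝ} (ht : 0 ≤ t) :
    forcing (P.restr f hf.continuous) t = f t :=
  forcing_restr _ (fun s hs => hf.zero s (by rw [hP.horizon_eq] at hs; linarith)) ht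

omit hP in
theorem functional_prod (L : StrongDual ℝ P.State) (a : ℝ) (w : C(Icc (0 : ℝ) P.horizon, ℝ)) :
    L (a, w) = a * L P.dir + L (0, w) := by
  have : ((a, w) : P.State) = a • P.dir + (0, w) := by ext1 <;> simp [dir]
  conv_lhs => rw [this, map_add, map_smul, smul_eq_mul]

omit hP in
theorem abs_functional_sub_le (L : StrongDual ℝ P.State) {w w' : C(Icc (0 : ℝ) P.horizon, ℝ)}
    {K : ℝ} (h : ‖w - w'‖ ≤ K) : |L (0, w) - L (0, w')| ≤ ‖L‖ * K := by
  rw [← map_sub, ← Real.norm_eq_abs]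
  refine (L.le_opNorm _).trans (mul_le_mul_of_nonneg_left ?_ (norm_nonneg _))
  simpa [Prod.norm_def] using h

-- A nearly optimal control consumes only `O(h)` on `[0, h]`: consumption `d` costs `p d` in
-- continuation value, whereas the payoff on the interval is at most `h M`. The discount leaves at
-- least `p d / 2` of that cost and the error term takes at most `p d / 4`, hence the factor `4 /
-- p`.
omit hP in
theorem cost_le_of_increment {v h p d e Λ C ε Q M ρ I : ℝ} (hp0 : 0 < p) (hΛ0 : 0 ≤ Λ)
    (hh0 : 0 < h) (hh1 : h ≤ 1) (hd0 : 0 ≤ d) (hε : 0 ≤ ε) (hε1 : ε ≤ 1) (hexp0 : 0 < e)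
    (hexp1 : e ≤ 1) (hexp2 : 1 / 2 ≤ e) (hexp3 : 1 - ρ * h ≤ e) (hΛh : Λ * C * h ≤ p / 4)
    (hmain : v - h ^ 2 ≤ I + e * (v + (h * Q - p * d + h * (Λ * (C * d + ε)))))
    (hpay1 : I ≤ h * M) :
    d ≤ 4 * (M + 1 + ρ * |v| + |Q| + Λ) / p * h := by
  have h1 : e * (h * (Λ * (C * d + ε))) ≤ e * (p / 4 * d) + h * Λ := by
    have a1 : h * (Λ * (C * d)) ≤ p / 4 * d := by
      have := mul_le_mul_of_nonneg_right hΛh hd0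
      linarith
    have a2 : h * (Λ * ε) ≤ h * Λ := by
      have : Λ * ε ≤ Λ := mul_le_of_le_one_right hΛ0 hε1
      exact mul_le_mul_of_nonneg_left this hh0.le
    have a3 : e * (h * (Λ * ε)) ≤ h * (Λ * ε) :=
      mul_le_of_le_one_left (by positivity) hexp1
    have a4 := mul_le_mul_of_nonneg_left a1 hexp0.le
    nlinarith
  have h2 : e * (h * Q) ≤ h * |Q| := by
    have b1 : e * (h * Q) ≤ e * (h * |Q|) := by gcongr; exact le_abs_self Q
    exact b1.trans (mul_le_of_le_one_left (by positivity) hexp1)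
  have h3 : (e - 1) * v ≤ ρ * h * |v| := by
    have b1 : (e - 1) * v ≤ (1 - e) * |v| := by
      nlinarith [neg_abs_le v]
    refine b1.trans (mul_le_mul_of_nonneg_right (by linarith) (abs_nonneg _))
  have h4 : 1 / 2 * (p * d) ≤ e * (p * d) := by gcongr
  have h5 : h ^ 2 ≤ h * 1 := by rw [sq]; gcongr
  have h6 : e * (p / 4 * d) ≤ p / 4 * d := mul_le_of_le_one_left (by positivity) hexp1
  rw [div_mul_eq_mul_div, le_div_iff₀ hp0]
  nlinarith

-- Once `d = O(h)`, the terms `(1 - e) p d` and `h Λ C d` are of second order, and the `p d` in the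
-- bound on the payoff cancels the cost of consumption.
omit hP in
theorem rate_le_of_increment {v h p d e Λ C C₃ ε Q ρ I G : ℝ} (hp0 : 0 < p) (hρ : 0 ≤ ρ)
    (hΛ0 : 0 ≤ Λ) (hC : 0 ≤ C) (hh0 : 0 < h) (hd0 : 0 ≤ d) (hε : 0 ≤ ε)
    (hexp1 : e ≤ 1) (hexp3 : 1 - ρ * h ≤ e) (hdle : d ≤ C₃ * h)
    (hmain : v - h ^ 2 ≤ I + e * (v + (h * Q - p * d + h * (Λ * (C * d + ε)))))
    (hpay2 : I ≤ h * G + p * d) :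
    (1 - e) * v ≤ (G + h + e * Q + p * C₃ * (ρ * h) + Λ * (C * (C₃ * h)) + Λ * ε) * h := by
  have h1 : (1 - e) * (p * d) ≤ ρ * h * (p * (C₃ * h)) := by
    have b1 : p * d ≤ p * (C₃ * h) := by gcongr
    exact mul_le_mul (by linarith) b1 (by positivity) (by positivity)
  have h2 : e * (h * (Λ * (C * d + ε))) ≤ h * (Λ * (C * (C₃ * h) + ε)) := by
    have b1 : h * (Λ * (C * d + ε)) ≤ h * (Λ * (C * (C₃ * h) + ε)) := by gcongr
    exact (mul_le_of_le_one_left (by positivity) hexp1).trans b1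
  nlinarith

/-- The Hamilton-Jacobi-Bellman inequality for supporting functionals of the value that follows
from optimality: no control does better than the value. -/
theorem hjb_le {x₀ k : ℝ} {f f' : ℝ → ℝ} (hf : P.IsSmoothPast f f')
    (hz : (x₀, P.restr f hf.continuous) ∈ P.dom) {L : StrongDual ℝ P.State}
    (hL : ∀ y ∈ P.dom, P.val y ≤ P.val (x₀, P.restr f hf.continuous) +
      L (y - (x₀, P.restr f hf.continuous))) (hk : 0 < k) (hkL : deriv P.U₁ k = L P.dir) :
    P.ρ * P.val (x₀, P.restr f hf.continuous) - P.U₂ x₀ ≤ P.U₁ k - k * L P.dir +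
      P.growth x₀ (f 0) * L P.dir + L (0, P.restr _ (hP.continuous_pastRate (x₀ := x₀) hf)) := by
  set w := P.restr f hf.continuous with hw
  set σ := P.restr _ (hP.continuous_pastRate (x₀ := x₀) hf) with hσ
  set v := P.val (x₀, w) with hv
  set p := L P.dir with hp
  have hp0 : 0 < p := hP.support_slope_pos hz hL
  have hx₀ : 0 < x₀ := pos_of_mem_dom hz
  obtain ⟨C, hC, hinc⟩ := hP.forward_increment (x₀ := x₀) hf
  obtain ⟨M, hM, hB, hBM⟩ := hP.exists_utility_bounds
  have hρ := hP.ρ_pos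
  set Q := P.growth x₀ (f 0) * p + L (0, σ) with hQ
  set Λ := ‖L‖ + p with hΛ
  have hΛ0 : 0 ≤ Λ := add_nonneg (norm_nonneg L) hp0.le
  set W : ℝ → ℝ := fun h => P.U₂ (x₀ + C * h) with hW
  have hWlim : Tendsto W (𝓝[>] 0) (𝓝 (P.U₂ x₀)) := by
    have h1 : ContinuousAt P.U₂ (x₀ + C * 0) := by
      rw [mul_zero, add_zero]
      exact hP.U₂_cont.continuousAt (Ioi_mem_nhds hx₀)
    have h2 : ContinuousAt W 0 :=
      ContinuousAt.comp (f := fun h => x₀ + C * h) h1 (by fun_prop)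
    have := h2.tendsto.mono_left (nhdsWithin_le_nhds (s := Ioi 0))
    simpa [hW] using this
  set C₃ := 4 * (M + 1 + P.ρ * |v| + |Q| + Λ) / p with hC₃
  have hC₃0 : 0 ≤ C₃ := by positivity
  suffices hmain : ∀ ε, 0 < ε → ε ≤ 1 →
      P.ρ * v ≤ P.U₁ k - p * k + P.U₂ x₀ + Q + Λ * ε by
    have hlim : Tendsto (fun ε => P.U₁ k - p * k + P.U₂ x₀ + Q + Λ * ε) (𝓝[>] 0)
        (𝓝 (P.U₁ k - p * k + P.U₂ x₀ + Q + Λ * 0)) :=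
      ((by fun_prop : Continuous fun ε => P.U₁ k - p * k + P.U₂ x₀ + Q + Λ * ε).tendsto
        0).mono_left nhdsWithin_le_nhds
    have := ge_of_tendsto hlim (by
      filter_upwards [Ioo_mem_nhdsGT one_pos] with ε hε using hmain ε hε.1 hε.2.le)
    linarith
  intro ε hε hε1
  have hev : ∀ᶠ h in 𝓝[>] (0 : ℝ), (1 - Real.exp (-P.ρ * h)) / h * v ≤
      P.U₁ k - p * k + W h + P.ρ * h * (M + |W h|) + h + Real.exp (-P.ρ * h) * Q +
        p * C₃ * (P.ρ * h) + Λ * (C * (C₃ * h)) + Λ * ε := by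
    filter_upwards [hinc ε hε, Ioo_mem_nhdsGT one_pos,
      eventually_mul_le P.ρ (ε := 1 / 2) (by norm_num),
      eventually_mul_le (Λ * C) (ε := p / 4) (by positivity)] with h hh hh1 hρh hΛh
    have hh0 := hh1.1
    -- The optimality gap `h ^ 2` disappears after division by `h`.
    obtain ⟨j, ⟨c, x, hx, hint, rfl⟩, hj⟩ := exists_gain_gt hz (a := v - h ^ 2)
      (by have : 0 < h ^ 2 := by positivity
          linarith)
    have hxf : P.IsFeasible x₀ f c x := hx.congr fun s hs => hP.forcing_restr_of_past hf hs
    have harc := hxf h hh0.le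
    have hxc := hxf.cont
    obtain ⟨j', hj', hsplit⟩ := hxf.exists_gain_shift hP hh0.le hf.continuous hint
    obtain ⟨hxu, hxh, hwh⟩ := hh c x harc
    set d := ∫ u in (0 : ℝ)..h, c u with hd
    have hd0 : 0 ≤ d := intervalIntegral.integral_nonneg hh0.le fun u hu => harc.nonneg u hu
    set w' := P.restr _ (hP.continuous_pastAfter hf.continuous hxc h) with hw'
    have hpz : ∀ u, P.horizon ≤ u → P.pastAfter f x h u = 0 := fun u hu =>
      hP.pastAfter_eq_zero hh0.le le_rfl hf.zero (by rw [hP.horizon_eq] at hu; linarith)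
    have hgain : P.IsGain ((x h, w') : P.State).1 (forcing ((x h, w') : P.State).2) j' :=
      hj'.congr fun s hs => (forcing_restr (hP.continuous_pastAfter hf.continuous hxc h) hpz hs).symm
    have hle1 := hP.le_val hgain
    have hle2 := hL _ ⟨_, hgain⟩
    have hLinc : L ((x h, w') - (x₀, w)) ≤ h * Q - p * d + h * (Λ * (C * d + ε)) := by
      have e1 : ((x h, w') - (x₀, w) : P.State) = (x h - x₀, w' - w) := rfl
      rw [e1, functional_prod]
      have h1 := (abs_le.1 (abs_functional_sub_le L hwh)).2
      have e2 : L (0, h • σ) = h * L (0, σ) := by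
        rw [← smul_eq_mul, ← map_smul]; simp
      rw [e2] at h1
      have h2 := mul_le_mul_of_nonneg_right (abs_le.1 hxh).2 hp0.le
      have e3 : h * (Λ * (C * d + ε)) = ‖L‖ * (h * (C * d + ε)) + h * (C * d + ε) * p := by
        rw [hΛ]; ring
      rw [e3, hQ]
      linarith
    have hexp1 : Real.exp (-P.ρ * h) ≤ 1 := Real.exp_le_one_iff.2 (by nlinarith)
    have hexp2 : 1 / 2 ≤ Real.exp (-P.ρ * h) := by
      have := Real.add_one_le_exp (-P.ρ * h)
      linarith
    have hexp3 : 1 - P.ρ * h ≤ Real.exp (-P.ρ * h) := by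
      have := Real.add_one_le_exp (-P.ρ * h)
      linarith
    have hexp0 := Real.exp_pos (-P.ρ * h)
    set e := Real.exp (-P.ρ * h) with he
    have hmain : v - h ^ 2 ≤ (∫ t in (0 : ℝ)..h, P.pay c x t) +
        e * (v + (h * Q - p * d + h * (Λ * (C * d + ε)))) := by
      have := mul_le_mul_of_nonneg_left (hle1.trans (hle2.trans (add_le_add_right hLinc _)))
        hexp0.le
      linarith
    have hpay1 : ∫ t in (0 : ℝ)..h, P.pay c x t ≤ h * M := by
      have : ∫ t in (0 : ℝ)..h, P.pay c x t ≤ ∫ t in (0 : ℝ)..h, M := by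
        refine intervalIntegral.integral_mono_on hh0.le (harc.integrable_pay hP hh0.le) (by simp)
          fun t ht => ?_
        have h1 := hBM (c t) (x t) (harc.nonneg t ht) (harc.pos t ht)
        have h2 : Real.exp (-P.ρ * t) ≤ 1 := Real.exp_le_one_iff.2 (by nlinarith [ht.1])
        have h3 := Real.exp_pos (-P.ρ * t)
        simp only [pay]
        nlinarith
      simpa using this
    have hdle : d ≤ C₃ * h :=
      cost_le_of_increment hp0 hΛ0 hh0 hh1.2.le hd0 hε.le hε1 hexp0 hexp1 hexp2 hexp3 hΛh hmain hpay1
    -- The tangent to `U₁` at `k` has slope `p`, so `U₁ c ≤ U₁ k - p k + p c` whatever the control.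
    -- The state utility is bounded by its value at the largest reachable state.
    have hpay2 : ∫ t in (0 : ℝ)..h, P.pay c x t ≤
        h * (P.U₁ k - p * k + W h + P.ρ * h * (M + |W h|)) + p * d := by
      have hcint := harc.int
      have : ∫ t in (0 : ℝ)..h, P.pay c x t ≤ ∫ t in (0 : ℝ)..h,
          ((P.U₁ k - p * k + W h + P.ρ * h * (M + |W h|)) + p * c t) := by
        refine intervalIntegral.integral_mono_on hh0.le (harc.integrable_pay hP hh0.le)
          ((by simp : IntervalIntegrable _ volume 0 h).add (hcint.const_mul p)) fun t ht => ?_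
        have hc0 := harc.nonneg t ht
        have h1 : P.U₁ (c t) + P.U₂ (x t) ≤ P.U₁ (c t) + W h := by
          gcongr
          exact hP.U₂_mono (mem_Ioi.2 (harc.pos t ht)) (mem_Ioi.2 (by positivity)) (hxu t ht)
        have h2 := (abs_le.1 (exp_mul_bounds (y := P.U₁ (c t) + W h) hρ.le ht.1 ht.2)).2
        have h3 : |P.U₁ (c t) + W h| ≤ M + |W h| :=
          (abs_add_le _ _).trans (by linarith [hB _ hc0])
        have h4 := mul_le_mul_of_nonneg_left h3 (by positivity : 0 ≤ P.ρ * h)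
        have h5 := hP.U₁_le_tangent hc0 hk
        rw [hkL] at h5
        have h6 := mul_le_mul_of_nonneg_left h1 (Real.exp_pos (-P.ρ * t)).le
        simp only [pay]
        linarith
      rw [intervalIntegral.integral_add (by simp) (hcint.const_mul p),
        intervalIntegral.integral_const_mul] at this
      rwa [intervalIntegral.integral_const, sub_zero, smul_eq_mul] at this
    rw [div_mul_eq_mul_div, div_le_iff₀ hh0]
    exact rate_le_of_increment hp0 hρ.le hΛ0 hC.le hh0 hd0 hε.le hexp1 hexp3 hdle hmain
      hpay2
  have hlhs : Tendsto (fun h : ℝ => (1 - Real.exp (-P.ρ * h)) / h * v) (𝓝[>] 0) (𝓝 (P.ρ * v)) :=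
    (tendsto_one_sub_exp_div P.ρ).mul_const v
  have hid : Tendsto (fun h : ℝ => h) (𝓝[>] 0) (𝓝 0) := nhdsWithin_le_nhds
  have hexpl : Tendsto (fun h : ℝ => Real.exp (-P.ρ * h)) (𝓝[>] 0) (𝓝 1) := by
    have := ((by fun_prop : Continuous fun h : ℝ => Real.exp (-P.ρ * h)).tendsto 0).mono_left
      (nhdsWithin_le_nhds (s := Ioi 0))
    simpa using this
  have hrhs : Tendsto (fun h => P.U₁ k - p * k + W h + P.ρ * h * (M + |W h|) + h +
      Real.exp (-P.ρ * h) * Q + p * C₃ * (P.ρ * h) + Λ * (C * (C₃ * h)) + Λ * ε) (𝓝[>] 0)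
      (𝓝 (P.U₁ k - p * k + P.U₂ x₀ + P.ρ * 0 * (M + |P.U₂ x₀|) + 0 + 1 * Q + p * C₃ * (P.ρ * 0) +
        Λ * (C * (C₃ * 0)) + Λ * ε)) :=
    (((((((tendsto_const_nhds.add hWlim).add ((hid.const_mul _).mul
      (tendsto_const_nhds.add hWlim.abs))).add hid).add (hexpl.mul_const _)).add
      ((hid.const_mul _).const_mul _)).add (((hid.const_mul _).const_mul _).const_mul _)).add
      tendsto_const_nhds)
  have := le_of_tendsto_of_tendsto hlhs hrhs hev
  linarith

/-- The Hamilton-Jacobi-Bellman inequality for supporting functionals of the value that follows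
from moving to the given state with a nearly constant control. -/
theorem le_hjb {x₀ k : ℝ} {f f' : ℝ → ℝ} (hf : P.IsSmoothPast f f')
    (hz : (x₀, P.restr f hf.continuous) ∈ P.dom) {L : StrongDual ℝ P.State}
    (hL : ∀ y ∈ P.dom, P.val y ≤ P.val (x₀, P.restr f hf.continuous) +
      L (y - (x₀, P.restr f hf.continuous))) (hk : 0 < k) :
    P.U₁ k - k * L P.dir +
      P.growth x₀ (f 0) * L P.dir + L (0, P.restr _ (hP.continuous_pastRate (x₀ := x₀) hf)) ≤
    P.ρ * P.val (x₀, P.restr f hf.continuous) - P.U₂ x₀ := by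
  set w := P.restr f hf.continuous with hw
  set σ := P.restr _ (hP.continuous_pastRate (x₀ := x₀) hf) with hσ
  set v := P.val (x₀, w) with hv
  set p := L P.dir with hp
  set b := P.growth x₀ (f 0) with hb
  have hx₀ : 0 < x₀ := pos_of_mem_dom hz
  have hρ := hP.ρ_pos
  have hr := hP.r_nonneg
  have hCf := hP.Cf_nonneg
  obtain ⟨A, hA, hback⟩ := hP.backward_increment (x₀ := x₀) hf
  obtain ⟨A', hA', hkA', -⟩ := hP.conv_short
  have hkc := hP.continuous_kern
  set β := |b - k| with hβ
  have hβ0 : 0 ≤ β := abs_nonneg _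
  -- The control along the straight path below equals `k` only up to `ε`; as `U₁` is increasing, `U₁
  -- (k - ε)` bounds its utility from below.
  suffices hmain : ∀ ε, 0 < ε → ε < k →
      P.U₁ (k - ε) + P.U₂ x₀ + (p * (b - k) + L (0, σ)) - ‖L‖ * ε ≤ P.ρ * v by
    have h1 : ContinuousAt P.U₁ (k - 0) := by
      rw [sub_zero]; exact (hP.hasDerivAt_U₁ hk).continuousAt
    have h2 : ContinuousAt (fun ε => P.U₁ (k - ε) + P.U₂ x₀ + (p * (b - k) + L (0, σ)) - ‖L‖ * ε)
        0 := by
      have : ContinuousAt (fun ε => P.U₁ (k - ε)) 0 :=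
        ContinuousAt.comp (f := fun ε => k - ε) h1 (by fun_prop)
      exact ((this.add continuousAt_const).add continuousAt_const).sub (by fun_prop)
    have := le_of_tendsto (h2.tendsto.mono_left (nhdsWithin_le_nhds (s := Ioi 0))) (by
      filter_upwards [Ioo_mem_nhdsGT hk] with ε hε using hmain ε hε.1 hε.2)
    simp only [sub_zero, mul_zero] at this
    linarith
  intro ε hε hεk
  set W : ℝ → ℝ := fun h => P.U₁ (k - ε) + P.U₂ (x₀ - β * h) with hW
  have hWlim : Tendsto W (𝓝[>] 0) (𝓝 (P.U₁ (k - ε) + P.U₂ x₀)) := by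
    have h1 : ContinuousAt P.U₂ (x₀ - β * 0) := by
      rw [mul_zero, sub_zero]
      exact hP.U₂_cont.continuousAt (Ioi_mem_nhds hx₀)
    have h2 : ContinuousAt (fun h => P.U₂ (x₀ - β * h)) 0 :=
      ContinuousAt.comp (f := fun h => x₀ - β * h) h1 (by fun_prop)
    have := (h2.tendsto.mono_left (nhdsWithin_le_nhds (s := Ioi 0))).const_add (P.U₁ (k - ε))
    simpa [hW] using this
  have hfc : ∀ᶠ h in 𝓝[>] (0 : ℝ), ∀ u ∈ Icc 0 h, |f (u - h) - f 0| ≤ ε / (4 * (P.Cf + 1)) := by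
    obtain ⟨δ', hδ', hu⟩ := Metric.continuousAt_iff.1 (hf.continuous.continuousAt (x := 0))
      (ε / (4 * (P.Cf + 1))) (by positivity)
    filter_upwards [Ioo_mem_nhdsGT hδ'] with h hh u hu'
    rw [← Real.dist_eq]
    refine (hu ?_).le
    rw [Real.dist_eq, sub_zero, abs_lt]
    constructor <;> linarith [hu'.1, hu'.2, hh.1, hh.2]
  have hev : ∀ᶠ h in 𝓝[>] (0 : ℝ), W h - P.ρ * h * |W h| + (p * (b - k) + L (0, σ)) - ‖L‖ * ε ≤
      (1 - Real.exp (-P.ρ * h)) / h * v := by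
    filter_upwards [hback (ε / 2) (half_pos hε), Ioo_mem_nhdsGT one_pos, hfc,
      eventually_mul_le (A * β) (ε := ε / 2) (half_pos hε),
      eventually_mul_le β (ε := x₀ / 2) (half_pos hx₀),
      eventually_mul_le ((P.r + P.Cf) * β + P.Cf * (A' * (2 * x₀))) (ε := ε / 2) (half_pos hε)]
      with h hbk hh1 hfh hAβ hβx hK
    have hh0 := hh1.1
    -- A straight path that arrives at `x₀` at time `h`, with the drift that consumption `k`
    -- produces there.
    set x : ℝ → ℝ := fun u => x₀ + (u - h) * (b - k) with hx
    have hxc : Continuous x := by fun_prop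
    have hxd : ∀ u ∈ Icc 0 h, |x u - x₀| ≤ β * h := fun u hu => by
      simp only [hx, add_sub_cancel_left, abs_mul]
      rw [mul_comm, abs_of_nonpos (by linarith [hu.2] : u - h ≤ 0)]
      exact mul_le_mul_of_nonneg_left (by linarith [hu.1]) hβ0
    have hxpos : ∀ u ∈ Icc 0 h, x₀ - β * h ≤ x u ∧ x u ≤ 2 * x₀ := fun u hu => by
      have := abs_le.1 (hxd u hu)
      constructor <;> linarith
    -- The past from which this path arrives with past contribution exactly `f`. Evaluating `f (s -
    -- h)` uses smoothness of `f` at negative times as well.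
    set g : ℝ → ℝ := fun s => f (s - h) - ∫ u in (0 : ℝ)..h, P.kern (u - s) * x u with hg
    have hgc : Continuous g := hP.continuous_backward hf.continuous hxc h
    have hgz : ∀ s, P.horizon ≤ s → g s = 0 := fun s hs => by
      rw [hP.horizon_eq] at hs
      simp only [hg]
      rw [hf.zero _ (by linarith [hh1.2]), zero_sub, neg_eq_zero,
        intervalIntegral.integral_congr (g := fun _ => (0 : ℝ))]
      · simp
      · intro u hu
        rw [uIcc_of_le hh0.le] at hu
        simp only [hP.kern_of_le (v := u - s) (by linarith [hu.2, hh1.2]), zero_mul]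
    have hgrow : ∀ u ∈ Icc 0 h, |P.growth (x u) (P.mem g x u) - b| ≤ ε := fun u hu => by
      have e : P.mem g x u - f 0 = (f (u - h) - f 0) - ∫ s in u..h, P.kern (s - u) * x s := by
        have hi : ∀ a c, IntervalIntegrable (fun s => P.kern (s - u) * x s) volume a c :=
          fun a c => Continuous.intervalIntegrable (by fun_prop) _ _
        have := intervalIntegral.integral_add_adjacent_intervals (hi 0 u) (hi u h)
        simp only [mem, hg]
        linarith
      have h1 : |P.mem g x u - f 0| ≤ ε / (4 * (P.Cf + 1)) + A' * (2 * x₀) * h := by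
        rw [e]
        refine (abs_sub _ _).trans (add_le_add (hfh u hu) ?_)
        rw [← Real.norm_eq_abs]
        refine (intervalIntegral.norm_integral_le_of_norm_le_const (C := A' * (2 * x₀))
          fun s hs => ?_).trans ?_
        · rw [uIoc_of_le hu.2] at hs
          have hs' : s ∈ Icc 0 h := ⟨hu.1.trans hs.1.le, hs.2⟩
          have := hxpos s hs'
          rw [Real.norm_eq_abs, abs_mul, abs_of_nonneg (hP.kern_nonneg _),
            abs_of_nonneg (by linarith)]
          exact mul_le_mul (hkA' _) this.2 (by linarith) hA'.le
        · rw [abs_of_nonneg (by linarith [hu.2])]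
          exact mul_le_mul_of_nonneg_left (by linarith [hu.1]) (by positivity)
      have h2 := hP.growth_lipschitz (x u) x₀ (P.mem g x u) (f 0)
      have h3 := mul_le_mul_of_nonneg_left (hxd u hu) (add_nonneg hr hCf)
      have h4 := mul_le_mul_of_nonneg_left h1 hCf
      have h5 : P.Cf * (ε / (4 * (P.Cf + 1))) ≤ ε / 4 := by
        rw [mul_div_assoc', div_le_div_iff₀ (by positivity) (by positivity)]
        nlinarith
      nlinarith
    have hder : ∀ t, HasDerivAt x (b - k) t := fun t => by
      have := (((hasDerivAt_id t).sub_const h).mul_const (b - k)).const_add x₀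
      simpa [hx] using this
    have harc := IsArc.of_hasDerivAt (P := P) (h := h) (f := g) (x := x) (d := fun _ => b - k) hP hgc
      continuous_const hder (fun t ht => by linarith [(hxpos t ht).1])
      (fun t ht => by linarith [(abs_le.1 (hgrow t ht)).1])
    have hpast : ∀ s, 0 ≤ s → forcing w s = P.pastAfter g x h s := fun s hs => by
      rw [hw, hP.forcing_restr_of_past hf hs]
      simp only [pastAfter, hg, add_sub_cancel_left, sub_sub, sub_add_cancel]
    have hxh : x h = x₀ := by simp [hx]
    set z' : P.State := (x 0, P.restr g hgc) with hz'
    have hgain : ∀ j, P.IsGain x₀ (forcing w) j → P.IsGain z'.1 (forcing z'.2)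
        ((∫ t in (0 : ℝ)..h, P.pay (fun t => P.growth (x t) (P.mem g x t) - (b - k)) x t) +
          Real.exp (-P.ρ * h) * j) := fun j hj => by
      have h1 := hj.congr hpast
      rw [← hxh] at h1
      exact (harc.isGain hP hh0.le hgc h1).congr fun s hs => (forcing_restr hgc hgz hs).symm
    have hz'd : z' ∈ P.dom := by
      obtain ⟨j, hj⟩ := hz
      exact ⟨_, hgain j hj⟩
    set I := ∫ t in (0 : ℝ)..h, P.pay (fun t => P.growth (x t) (P.mem g x t) - (b - k)) x t with hI
    -- Dynamic programming at the earlier state bounds its value from below. The supporting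
    -- functional at the later state bounds the same value from above.
    have hvle : I + Real.exp (-P.ρ * h) * v ≤ P.val z' := by
      have hexp := Real.exp_pos (-P.ρ * h)
      have : v ≤ (P.val z' - I) / Real.exp (-P.ρ * h) := by
        refine val_le hz fun j hj => ?_
        rw [le_div_iff₀ hexp]
        linarith [hP.le_val (hgain j hj)]
      rw [le_div_iff₀ hexp] at this
      linarith
    have hLinc : L (z' - (x₀, w)) ≤ -(h * (p * (b - k) + L (0, σ))) + h * (‖L‖ * ε) := by
      have e1 : (z' - (x₀, w) : P.State) = (x 0 - x₀, P.restr g hgc - w) := rfl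
      rw [e1, functional_prod]
      have h1 := hbk (β * h) x hxc hxd
      have e2 : P.restr g hgc - w + h • σ = (P.restr g hgc - w) - (-h) • σ := by
        rw [neg_smul, sub_neg_eq_add]
      rw [← hw, ← hσ, e2] at h1
      have h2 := (abs_le.1 (abs_functional_sub_le L h1)).2
      have e3 : L (0, (-h) • σ) = -h * L (0, σ) := by
        rw [← smul_eq_mul, ← map_smul]; simp
      rw [e3] at h2
      have h3 : h * (A * (β * h) + ε / 2) ≤ h * ε :=
        mul_le_mul_of_nonneg_left (by linarith) hh0.le
      have h4 := mul_le_mul_of_nonneg_left h3 (norm_nonneg L)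
      have e4 : x 0 - x₀ = -h * (b - k) := by simp [hx]
      rw [e4]
      linarith
    have hIge : h * (W h - P.ρ * h * |W h|) ≤ I := by
      have : ∫ t in (0 : ℝ)..h, (W h - P.ρ * h * |W h|) ≤ I := by
        refine intervalIntegral.integral_mono_on hh0.le (by simp) (harc.integrable_pay hP hh0.le)
          fun t ht => ?_
        have h2 := (abs_le.1 (exp_mul_bounds (y := W h) hρ.le ht.1 ht.2)).1
        have h3 : W h ≤ P.U₁ (P.growth (x t) (P.mem g x t) - (b - k)) + P.U₂ (x t) := by
          have hgt := (abs_le.1 (hgrow t ht)).1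
          refine add_le_add (hP.strictMonoOn_U₁.monotoneOn (mem_Ici.2 (by linarith))
            (mem_Ici.2 (by linarith)) (by linarith)) (hP.U₂_mono (mem_Ioi.2 (by linarith))
            (mem_Ioi.2 (by linarith [(hxpos t ht).1])) (hxpos t ht).1)
        have h4 := mul_le_mul_of_nonneg_left h3 (Real.exp_pos (-P.ρ * t)).le
        simp only [pay]
        linarith
      rwa [intervalIntegral.integral_const, sub_zero, smul_eq_mul] at this
    have hfin := hL z' hz'd
    rw [div_mul_eq_mul_div, le_div_iff₀ hh0]
    linarith
  have hlhs : Tendsto (fun h : ℝ => (1 - Real.exp (-P.ρ * h)) / h * v) (𝓝[>] 0) (𝓝 (P.ρ * v)) :=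
    (tendsto_one_sub_exp_div P.ρ).mul_const v
  have hid : Tendsto (fun h : ℝ => h) (𝓝[>] 0) (𝓝 0) := nhdsWithin_le_nhds
  have hrhs : Tendsto (fun h => W h - P.ρ * h * |W h| + (p * (b - k) + L (0, σ)) - ‖L‖ * ε) (𝓝[>] 0)
      (𝓝 (P.U₁ (k - ε) + P.U₂ x₀ - P.ρ * 0 * |P.U₁ (k - ε) + P.U₂ x₀| +
        (p * (b - k) + L (0, σ)) - ‖L‖ * ε)) :=
    (((hWlim.sub ((hid.const_mul _).mul hWlim.abs)).add tendsto_const_nhds).sub tendsto_const_nhds)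
  have := le_of_tendsto_of_tendsto hrhs hlhs hev
  linarith

/-- The midpoint of two supports is a support. At its critical `k`, `hjb_le` for the midpoint is
compared with the average of `le_hjb` for `L` at an arbitrary `c` and for `L'` at `k`. What remains
says that `k` maximizes `U₁ c - c L dir`; by symmetry it also maximizes the expression for `L'`, so
both slopes equal `U₁' k`. -/
theorem support_slope_unique {x₀ : ℝ} {f f' : ℝ → ℝ} (hf : P.IsSmoothPast f f')
    (hz : (x₀, P.restr f hf.continuous) ∈ P.dom) {L L' : StrongDual ℝ P.State}
    (hL : ∀ y ∈ P.dom, P.val y ≤ P.val (x₀, P.restr f hf.continuous) +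
      L (y - (x₀, P.restr f hf.continuous)))
    (hL' : ∀ y ∈ P.dom, P.val y ≤ P.val (x₀, P.restr f hf.continuous) +
      L' (y - (x₀, P.restr f hf.continuous))) : L P.dir = L' P.dir := by
  set N : StrongDual ℝ P.State := (1 / 2 : ℝ) • (L + L') with hN
  have hNv : ∀ y, N y = (L y + L' y) / 2 := fun y => by simp [hN]; ring
  have hNs : ∀ y ∈ P.dom, P.val y ≤ P.val (x₀, P.restr f hf.continuous) +
      N (y - (x₀, P.restr f hf.continuous)) := fun y hy => by
    rw [hNv]; linarith [hL y hy, hL' y hy]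
  obtain ⟨k, hk, hkN⟩ := hP.exists_deriv_U₁_eq (hP.support_slope_pos hz hNs)
  have h1 := hP.hjb_le hf hz hNs hk hkN
  rw [hNv, hNv] at h1
  have a1 : deriv P.U₁ k = L P.dir := hP.deriv_U₁_eq_of_isMax hk fun c hc => by
    linarith [hP.le_hjb hf hz hL hc, hP.le_hjb hf hz hL' hk]
  have a2 : deriv P.U₁ k = L' P.dir := hP.deriv_U₁_eq_of_isMax hk fun c hc => by
    linarith [hP.le_hjb hf hz hL' hc, hP.le_hjb hf hz hL hk]
  rw [← a1, a2]

/-- The value is differentiable in the direction `dir`, and the derivative is attained by a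
supporting functional. -/
theorem exists_hasDerivAt_val_of_past {x₀ : ℝ} {f f' : ℝ → ℝ} (hf : P.IsSmoothPast f f')
    (hz : (x₀, P.restr f hf.continuous) ∈ P.dom) :
    ∃ L : StrongDual ℝ P.State, (∀ y ∈ P.dom, P.val y ≤ P.val (x₀, P.restr f hf.continuous) +
        L (y - (x₀, P.restr f hf.continuous))) ∧
      HasDerivAt (fun s : ℝ => P.val (s, P.restr f hf.continuous)) (L P.dir) x₀ :=
  hP.exists_hasDerivAt_val hz fun _ _ hL hL' => hP.support_slope_unique hf hz hL hL'

end Standing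

/-! ### Smoothness of the contribution of the past -/

theorem memLp_two_restrict_Icc {f : ℝ → ℝ} {a b : ℝ} (hf : ContinuousOn f (Icc a b)) :
    MemLp f 2 (volume.restrict (Icc a b)) := by
  obtain ⟨B, hB⟩ := isCompact_Icc.exists_bound_of_continuousOn hf
  exact MemLp.of_bound (hf.aestronglyMeasurable measurableSet_Icc) B
    ((ae_restrict_iff' measurableSet_Icc).2 (Eventually.of_forall hB))

/-- Young's inequality with weight `l`, together with translation invariance, which makes the bound
uniform in `s`. -/
theorem abs_integral_shift_mul_le {φ g : ℝ → ℝ} (hφ : MemLp φ 2) (hg : MemLp g 2) {l : ℝ}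
    (hl : 0 < l) (s : ℝ) :
    |∫ u, φ (u - s) * g u| ≤ (l * (∫ u, g u ^ 2) + (∫ u, φ u ^ 2) / l) / 2 := by
  have hφs : MemLp (fun u => φ (u - s)) 2 :=
    hφ.comp_measurePreserving (measurePreserving_sub_right volume s)
  have e : ∫ u, φ u ^ 2 = ∫ u, φ (u - s) ^ 2 :=
    (integral_sub_right_eq_self (fun u => φ u ^ 2) s).symm
  rw [e, ← integral_const_mul, ← integral_div, ← integral_add (hg.integrable_sq.const_mul l)
    (hφs.integrable_sq.div_const l), ← integral_div, ← Real.norm_eq_abs]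
  refine norm_integral_le_of_norm_le
    (((hg.integrable_sq.const_mul l).add (hφs.integrable_sq.div_const l)).div_const 2)
    (Eventually.of_forall fun u => ?_)
  rw [Real.norm_eq_abs, le_div_iff₀ two_pos, ← mul_le_mul_iff_of_pos_left hl]
  have : l * (l * g u ^ 2 + φ (u - s) ^ 2 / l) = l ^ 2 * g u ^ 2 + φ (u - s) ^ 2 := by
    field_simp
  rw [this, abs_mul]
  nlinarith [sq_nonneg (l * |g u| - |φ (u - s)|), sq_abs (g u), sq_abs (φ (u - s))]

/-- `φ` is approximated in `L²` by a compactly supported continuous function, for which uniform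
continuity is immediate; the error is uniform in the shift. -/
theorem uniformContinuous_integral_shift_mul {φ g : ℝ → ℝ} (hφ : MemLp φ 2) (hg : MemLp g 2)
    (hg1 : Integrable g) : UniformContinuous fun s => ∫ u, φ (u - s) * g u := by
  have h2 : ENNReal.ofReal 2 = 2 := by norm_num
  have hmul : ∀ {ψ : ℝ → ℝ}, MemLp ψ 2 → ∀ s, Integrable fun u => ψ (u - s) * g u := fun hψ s =>
    (hψ.comp_measurePreserving (measurePreserving_sub_right volume s)).integrable_mul hg
  rw [Metric.uniformContinuous_iff]
  intro ε hε
  set N := ∫ u, g u ^ 2 with hN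
  have hN0 : 0 ≤ N := integral_nonneg fun u => sq_nonneg _
  set N₁ := ∫ u, |g u| with hN₁
  have hN10 : 0 ≤ N₁ := integral_nonneg fun u => abs_nonneg _
  set l := ε / (4 * (N + 1)) with hl
  have hl0 : 0 < l := by positivity
  obtain ⟨β, hβc, hβ, hβcont, hβL⟩ :=
    MemLp.exists_hasCompactSupport_integral_rpow_sub_le (p := 2) (f := φ) two_pos (by rwa [h2])
      (by positivity : 0 < l * (ε / 4))
  rw [h2] at hβL
  have hd : MemLp (fun u => φ u - β u) 2 := hφ.sub hβL
  have happ : ∀ s, |(∫ u, φ (u - s) * g u) - ∫ u, β (u - s) * g u| ≤ ε / 4 := fun s => by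
    rw [← integral_sub (hmul hφ s) (hmul hβL s)]
    have e : ∀ u, φ (u - s) * g u - β (u - s) * g u = (φ (u - s) - β (u - s)) * g u :=
      fun u => by ring
    simp only [e]
    refine (abs_integral_shift_mul_le hd hg hl0 s).trans ?_
    have e2 : (∫ u, (φ u - β u) ^ 2) ≤ l * (ε / 4) := by
      simpa using hβ
    have e3 : (∫ u, (φ u - β u) ^ 2) / l ≤ ε / 4 := by
      rw [div_le_iff₀ hl0]; linarith
    have e4 : l * N ≤ ε / 4 := by
      rw [hl, div_mul_eq_mul_div, div_le_div_iff₀ (by positivity) (by positivity)]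
      nlinarith
    linarith
  obtain ⟨δ, hδ, hu⟩ := Metric.uniformContinuous_iff.1
    (hβc.uniformContinuous_of_continuous hβcont) (ε / (4 * (N₁ + 1))) (by positivity)
  refine ⟨δ, hδ, fun s s' hss => ?_⟩
  have hmid : |(∫ u, β (u - s) * g u) - ∫ u, β (u - s') * g u| ≤ ε / 4 := by
    rw [← integral_sub (hmul hβL s) (hmul hβL s'), ← Real.norm_eq_abs]
    refine (norm_integral_le_of_norm_le (hg1.abs.const_mul (ε / (4 * (N₁ + 1))))
      (Eventually.of_forall fun u => ?_)).trans ?_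
    · rw [← sub_mul, norm_mul, Real.norm_eq_abs (g u), ← dist_eq_norm]
      refine mul_le_mul_of_nonneg_right (hu ?_).le (abs_nonneg _)
      rwa [dist_sub_left]
    · rw [integral_const_mul, div_mul_eq_mul_div, div_le_div_iff₀ (by positivity) (by positivity)]
      nlinarith
  rw [Real.dist_eq]
  have a1 := abs_le.1 (happ s)
  have a2 := abs_le.1 (happ s')
  have a3 := abs_le.1 hmid
  rw [abs_lt]
  constructor <;> linarith [a1.1, a1.2, a2.1, a2.2, a3.1, a3.2]

variable (P) in
/-- The contribution of the past `g` to the delayed term. -/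
def pastOf (g : ℝ → ℝ) (s : ℝ) : ℝ := ∫ u, P.kern (u - s) * g u

namespace Standing
variable (hP : P.Standing)
include hP

/-- The extended kernel is absolutely continuous on the whole line because `a(-T) = 0` excludes a
jump at `-T` and the extension is constant beyond `0`. -/
theorem exists_rate_kern : ∃ α : ℝ → ℝ, MemLp α 2 ∧ Integrable α ∧
    ∀ u v, P.kern v - P.kern u = ∫ τ in u..v, α τ := by
  obtain ⟨a', ha', h⟩ := hP.a_W12
  have hT := hP.T_pos
  have hi : IntegrableOn a' (Icc (-P.T) 0) := ha'.integrable (by norm_num)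
  set α := (Icc (-P.T) 0).indicator a' with hα
  have hαi : Integrable α := (integrable_indicator_iff measurableSet_Icc).2 hi
  have hint : ∀ a b, IntervalIntegrable α volume a b := fun a b => hαi.intervalIntegrable
  have hz : ∀ {u v : ℝ}, u ≤ v → (v ≤ -P.T ∨ 0 ≤ u) → ∫ τ in u..v, α τ = 0 := fun {u v} huv hc => by
    rw [intervalIntegral.integral_congr_ae (g := fun _ => (0 : ℝ)), intervalIntegral.integral_zero]
    have h0 : ∀ᵐ τ : ℝ, τ ≠ -P.T := Measure.ae_ne volume _
    filter_upwards [h0] with τ hτ hτ'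
    rw [uIoc_of_le huv] at hτ'
    refine indicator_of_notMem (s := Icc (-P.T) 0) (f := a') (fun hm => ?_)
    rcases hc with hc | hc
    · exact hτ (le_antisymm (hτ'.2.trans hc) hm.1)
    · linarith [hτ'.1, hm.2]
  have hbase : ∀ v, P.kern v = ∫ τ in (-P.T)..v, α τ := fun v => by
    rcases le_total v (-P.T) with hv | hv
    · rw [hP.kern_of_le hv, intervalIntegral.integral_symm, hz hv (Or.inl le_rfl), neg_zero]
    have key : ∀ w ∈ Icc (-P.T) 0, P.a w = ∫ τ in (-P.T)..w, α τ := fun w hw => by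
      rw [h w hw, hP.a_left, zero_add]
      refine intervalIntegral.integral_congr fun τ hτ => ?_
      rw [uIcc_of_le hw.1] at hτ
      exact (indicator_of_mem (s := Icc (-P.T) 0) ⟨hτ.1, hτ.2.trans hw.2⟩ a').symm
    rcases le_total v 0 with hv0 | hv0
    · rw [kern_eq ⟨hv, hv0⟩, key v ⟨hv, hv0⟩]
    · have : P.kern v = P.a 0 := by
        simp [kern, min_eq_right hv0, max_eq_right (by linarith : -P.T ≤ 0)]
      rw [this, key 0 ⟨by linarith, le_rfl⟩, ← intervalIntegral.integral_add_adjacent_intervals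
        (hint (-P.T) 0) (hint 0 v), hz hv0 (Or.inr le_rfl), add_zero]
  refine ⟨α, (MeasureTheory.memLp_indicator_iff_restrict measurableSet_Icc).2 ha', hαi, fun u v => ?_⟩
  rw [hbase v, hbase u, intervalIntegral.integral_interval_sub_left (hint _ _) (hint _ _)]

theorem integrable_kern_mul {g : ℝ → ℝ} (hg : Integrable g) (s : ℝ) :
    Integrable fun u => P.kern (u - s) * g u := by
  obtain ⟨A, hA, hkA⟩ := hP.exists_kern_le
  have hk := hP.continuous_kern
  refine hg.bdd_mul (c := A) (Continuous.aestronglyMeasurable (by fun_prop))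
    (Eventually.of_forall fun u => ?_)
  rw [Real.norm_eq_abs, abs_of_nonneg (hP.kern_nonneg _)]
  exact hkA _

/-- The derivative falls on the kernel, and Fubini's theorem turns the increment of `pastOf` into
the integral of a uniformly continuous rate. The past `g` itself need not be regular. -/
theorem exists_isSmoothPast_pastOf {g : ℝ → ℝ} (hg : MemLp g 2) (hg1 : Integrable g)
    (hg0 : ∀ u, 0 < u → g u = 0) : ∃ f', P.IsSmoothPast (P.pastOf g) f' := by
  obtain ⟨α, hα, hα1, hkα⟩ := hP.exists_rate_kern
  have hu := uniformContinuous_integral_shift_mul hα hg hg1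
  refine ⟨fun s => -∫ u, α (u - s) * g u, fun s => ?_, hu.neg, fun s hs => ?_⟩
  · have hF : P.pastOf g = fun t => P.pastOf g s - ∫ τ in s..t, ∫ u, α (u - τ) * g u := by
      funext t
      rw [intervalIntegral_integral_swap]
      · simp only [pastOf, intervalIntegral.integral_mul_const]
        have e : ∀ u, ∫ τ in s..t, α (u - τ) = P.kern (u - s) - P.kern (u - t) := fun u => by
          rw [intervalIntegral.integral_comp_sub_left (fun τ => α τ), hkα]
        simp only [e, sub_mul]
        rw [integral_sub (hP.integrable_kern_mul hg1 s) (hP.integrable_kern_mul hg1 t)]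
        ring
      · have := Integrable.convolution_integrand (μ := (volume : Measure ℝ))
          (ν := (volume : Measure ℝ)) (ContinuousLinearMap.mul ℝ ℝ) hg1 hα1.comp_neg
        refine (this.mono_measure ?_).congr (Eventually.of_forall fun p => ?_)
        · exact Measure.prod_mono Measure.restrict_le_self le_rfl
        · simp only [ContinuousLinearMap.mul_apply', Function.uncurry, neg_sub]
          ring
    rw [hF]
    refine (intervalIntegral.integral_hasDerivAt_right
      (hu.continuous.intervalIntegrable _ _) (hu.continuous.stronglyMeasurableAtFilter _ _)
      hu.continuous.continuousAt).const_sub _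
  · refine integral_eq_zero_of_ae (Eventually.of_forall fun u => ?_)
    rcases le_or_gt u 0 with h | h
    · simp [hP.kern_of_le (by linarith : u - s ≤ -P.T)]
    · simp [hg0 u h]

theorem exists_isSmoothPast_pastAfter {f f' x : ℝ → ℝ} (hf : P.IsSmoothPast f f')
    (hx : Continuous x) {t : ℝ} (ht : 0 ≤ t) : ∃ f'', P.IsSmoothPast (P.pastAfter f x t) f'' := by
  set g := (Ioc (-t) 0).indicator fun u => x (t + u) with hg
  have hxc : Continuous fun u => x (t + u) := by fun_prop
  have hgL : MemLp g 2 := by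
    refine (memLp_indicator_iff_restrict measurableSet_Ioc).2 ?_
    exact (memLp_two_restrict_Icc hxc.continuousOn).mono_measure
      (Measure.restrict_mono Ioc_subset_Icc_self le_rfl)
  have hg1 : Integrable g := (integrable_indicator_iff measurableSet_Ioc).2
    (hxc.continuousOn.integrableOn_Icc.mono_set Ioc_subset_Icc_self)
  obtain ⟨f₁, hf₁⟩ := hP.exists_isSmoothPast_pastOf hgL hg1
    (fun u hu => indicator_of_notMem (fun h => by linarith [h.2]) _)
  have e : P.pastAfter f x t = fun s => f (t + s) + P.pastOf g s := by
    funext s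
    simp only [pastAfter, pastOf]
    congr 1
    have e1 : ∀ u, P.kern (u - s) * g u =
        (Ioc (-t) 0).indicator (fun u => P.kern (u - s) * x (t + u)) u := fun u => by
      by_cases h : u ∈ Ioc (-t) 0 <;> simp [hg, h]
    simp only [e1]
    rw [integral_indicator measurableSet_Ioc, ← intervalIntegral.integral_of_le (by linarith)]
    have := intervalIntegral.integral_comp_add_left
      (fun u => P.kern (u - t - s) * x u) t (a := -t) (b := 0)
    rw [add_neg_cancel, add_zero] at this
    rw [← this]
    simp only [add_sub_cancel_left]
  rw [e]
  refine ⟨fun s => f' (t + s) + f₁ s, fun s => ?_, ?_, fun s hs => ?_⟩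
  · exact ((hf.deriv (t + s)).comp_const_add t s).add (hf₁.deriv s)
  · exact (hf.unif.comp (uniformContinuous_const.add uniformContinuous_id)).add hf₁.unif
  · rw [hf.zero _ (by linarith), hf₁.zero s hs, add_zero]

end Standing

/-! ### Verification along a feedback trajectory -/

/-- The right-hand slope criterion applied after time reversal. Slopes from the left are the ones
needed, because a support at `z t` bounds the value at earlier states from above. -/
theorem le_of_left_slope {Ψ : ℝ → ℝ} {b : ℝ} (hb : 0 ≤ b) (hc : ContinuousOn Ψ (Icc 0 b))
    (h : ∀ t ∈ Ioc 0 b, ∀ r, 0 < r → ∀ᶠ s in 𝓝[<] t, Ψ s - Ψ t < r * (t - s)) : Ψ 0 ≤ Ψ b := by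
  have hcg : ContinuousOn (fun τ => Ψ (b - τ)) (Icc 0 b) :=
    hc.comp (by fun_prop) fun τ hτ => ⟨by linarith [hτ.2], by linarith [hτ.1]⟩
  have := image_le_of_liminf_slope_right_le_deriv_boundary (f := fun τ => Ψ (b - τ)) (a := 0)
    (b := b) (B := fun _ => Ψ b) (B' := fun _ => 0) hcg (by simp) continuousOn_const
    (fun τ _ => hasDerivWithinAt_const _ _ _) (fun τ hτ r hr => ?_) (right_mem_Icc.2 hb)
  · simpa using this
  have hlim : Tendsto (fun z => b - z) (𝓝[>] τ) (𝓝[<] (b - τ)) := by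
    refine tendsto_nhdsWithin_iff.2 ⟨?_, ?_⟩
    · exact ((continuous_sub_left b).tendsto τ).mono_left nhdsWithin_le_nhds
    · filter_upwards [self_mem_nhdsWithin] with z hz
      have : τ < z := hz
      simp only [mem_Iio]
      linarith
  have hev := hlim.eventually (h (b - τ) ⟨by linarith [hτ.2], by linarith [hτ.1]⟩ r hr)
  refine Eventually.frequently ?_
  filter_upwards [hev, self_mem_nhdsWithin] with z hz hz'
  have h0 : 0 < z - τ := sub_pos.2 hz'
  rw [slope_def_field, div_lt_iff₀ h0]
  linarith

/-- Continuity of the slopes of a family of supporting lines of `v` along a curve, at a point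
where `v` is differentiable in the direction of the lines. -/
theorem continuousWithinAt_slope {E : Type*} [NormedAddCommGroup E] [NormedSpace ℝ E] {D : Set E}
    {v : E → ℝ} {e : E} {z : ℝ → E} {p : ℝ → ℝ} {s : Set ℝ} {t : ℝ} (hD : IsOpen D)
    (hv : ContinuousOn v D) (hz : ContinuousWithinAt z s t) (hzt : z t ∈ D)
    (hsup : ∀ u ∈ s, ∀ τ : ℝ, z u + τ • e ∈ D → v (z u + τ • e) ≤ v (z u) + p u * τ)
    (hd : HasDerivAt (fun τ : ℝ => v (z t + τ • e)) (p t) 0) : ContinuousWithinAt p s t := by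
  have hlim0 : Tendsto (fun τ : ℝ => z t + τ • e) (𝓝 0) (𝓝 (z t)) := by
    have : Continuous fun τ : ℝ => z t + τ • e := by fun_prop
    simpa using this.tendsto 0
  have hDev : ∀ᶠ τ : ℝ in 𝓝 0, z t + τ • e ∈ D := hlim0.eventually (hD.mem_nhds hzt)
  have hq : ∀ τ : ℝ, z t + τ • e ∈ D →
      Tendsto (fun u => τ⁻¹ * (v (z u + τ • e) - v (z u))) (𝓝[s] t)
        (𝓝 (τ⁻¹ * (v (z t + τ • e) - v (z t)))) ∧ ∀ᶠ u in 𝓝[s] t, z u + τ • e ∈ D := fun τ hτ => by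
    have h1 : Tendsto (fun u => z u + τ • e) (𝓝[s] t) (𝓝 (z t + τ • e)) := hz.add_const _
    refine ⟨Tendsto.const_mul _ (Tendsto.sub ?_ ?_), h1.eventually (hD.mem_nhds hτ)⟩
    · exact (hv.continuousAt (hD.mem_nhds hτ)).tendsto.comp h1
    · exact (hv.continuousAt (hD.mem_nhds hzt)).tendsto.comp hz
  -- For a fixed step `τ`, the difference quotient of `v` at `z u` is continuous in `u`. It bounds
  -- the slope `p u` from below if `τ > 0` and from above if `τ < 0`; differentiability at `z t`
  -- brings both quotients close to `p t`.
  refine tendsto_order.2 ⟨fun a ha => ?_, fun b hb => ?_⟩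
  · have h1 := hd.tendsto_slope_zero_right.eventually_const_lt ha
    obtain ⟨τ, hτ, hτ0, hτD⟩ := (h1.and (eventually_mem_nhdsWithin.and
      (hDev.filter_mono nhdsWithin_le_nhds))).exists
    have hτ0 : 0 < τ := hτ0
    simp only [zero_add, zero_smul, add_zero, smul_eq_mul] at hτ
    obtain ⟨hl, hm⟩ := hq τ hτD
    filter_upwards [hl.eventually_const_lt hτ, hm, self_mem_nhdsWithin] with u h2 h3 h4
    refine h2.trans_le ?_
    rw [inv_mul_le_iff₀ hτ0]
    linarith [hsup u h4 τ h3]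
  · have h1 := hd.tendsto_slope_zero_left.eventually_lt_const hb
    obtain ⟨τ, hτ, hτ0, hτD⟩ := (h1.and (eventually_mem_nhdsWithin.and
      (hDev.filter_mono nhdsWithin_le_nhds))).exists
    have hτ0 : τ < 0 := hτ0
    simp only [zero_add, zero_smul, add_zero, smul_eq_mul] at hτ
    obtain ⟨hl, hm⟩ := hq τ hτD
    filter_upwards [hl.eventually_lt_const hτ, hm, self_mem_nhdsWithin] with u h2 h3 h4
    refine lt_of_le_of_lt ?_ h2
    rw [inv_mul_eq_div, le_div_iff_of_neg hτ0]
    linarith [hsup u h4 τ h3]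

namespace Standing
variable (hP : P.Standing)
include hP

theorem continuousWithinAt_of_deriv_U₁ {c : ℝ → ℝ} {s : Set ℝ} {t : ℝ} (ht : t ∈ s)
    (hc : ∀ u ∈ s, 0 < c u) (h : ContinuousWithinAt (fun u => deriv P.U₁ (c u)) s t) :
    ContinuousWithinAt c s t := by
  have hanti := hP.strictAntiOn_deriv_U₁
  refine tendsto_order.2 ⟨fun a ha => ?_, fun b hb => ?_⟩
  · rcases le_or_gt a 0 with ha0 | ha0
    · filter_upwards [self_mem_nhdsWithin] with u hu using ha0.trans_lt (hc u hu)
    · filter_upwards [h.tendsto.eventually_lt_const (hanti ha0 (hc t ht) ha),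
        self_mem_nhdsWithin] with u h1 hu
      exact (hanti.lt_iff_gt (hc u hu) ha0).1 h1
  · have hb0 : 0 < b := (hc t ht).trans hb
    filter_upwards [h.tendsto.eventually_const_lt (hanti (hc t ht) hb0 hb),
      self_mem_nhdsWithin] with u h1 hu
    exact (hanti.lt_iff_gt hb0 (hc u hu)).1 h1

/-- The state at time `t` along the trajectory `x`. -/
def along {f x : ℝ → ℝ} (hf : Continuous f) (hx : Continuous x) (t : ℝ) : P.State :=
  (x t, P.restr _ (hP.continuous_pastAfter hf hx t))

variable {f f' c x : ℝ → ℝ}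

theorem continuous_along (hf : Continuous f) (hx : Continuous x) : Continuous (hP.along hf hx) := by
  have hk := hP.continuous_kern
  refine hx.prodMk (ContinuousMap.continuous_of_continuous_uncurry _ ?_)
  have h1 : Continuous fun q : ℝ × ℝ => ∫ u in (0 : ℝ)..q.1, P.kern (u - q.1 - q.2) * x u :=
    intervalIntegral.continuous_parametric_intervalIntegral_of_continuous (by fun_prop)
      continuous_fst
  have h2 : Continuous fun q : ℝ × ℝ => P.pastAfter f x q.1 q.2 := by
    unfold pastAfter
    exact (by fun_prop : Continuous fun q : ℝ × ℝ => f (q.1 + q.2)).add h1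
  exact h2.comp (f := fun q : ℝ × Icc (0 : ℝ) P.horizon => (q.1, (q.2 : ℝ))) (by fun_prop)

theorem pastAfter_sub (hx : Continuous x) (t h s : ℝ) :
    P.pastAfter f x (t - h) s = P.pastAfter f x t (s - h) -
      ∫ u in (0 : ℝ)..h, P.kern (u - s) * x (t - h + u) := by
  have hk := hP.continuous_kern
  have hi : ∀ a b, IntervalIntegrable (fun u => P.kern (u - (t - h) - s) * x u) volume a b :=
    fun a b => Continuous.intervalIntegrable (by fun_prop) _ _
  have h1 := intervalIntegral.integral_add_adjacent_intervals (hi 0 (t - h)) (hi (t - h) t)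
  have h2 := intervalIntegral.integral_comp_add_left
    (fun u => P.kern (u - (t - h) - s) * x u) (t - h) (a := 0) (b := h)
  simp only [add_sub_cancel_left, add_zero, sub_add_cancel] at h2
  have h3 : ∀ u, u - t - (s - h) = u - (t - h) - s := fun u => by ring
  simp only [pastAfter, h3]
  rw [h2, ← h1, show t - h + s = t + (s - h) by ring]
  ring

/-- The state at `s < t` is obtained by rewinding the state at `t` along the trajectory, so
`backward_increment` gives the derivative of the past in the supremum norm. -/
theorem hasDerivWithinAt_along {t d : ℝ} (hf : P.IsSmoothPast f f')
    (hx : Continuous x) (hd : HasDerivAt x d t) {f₁ : ℝ → ℝ}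
    (hf₁ : P.IsSmoothPast (P.pastAfter f x t) f₁) :
    HasDerivWithinAt (hP.along hf.continuous hx)
      (d, P.restr _ (hP.continuous_pastRate (x₀ := x t) hf₁)) (Iio t) t := by
  refine hd.hasDerivWithinAt.prodMk ?_
  rw [hasDerivWithinAt_iff_isLittleO, Asymptotics.isLittleO_iff]
  intro ε hε
  obtain ⟨A, hA, hback⟩ := hP.backward_increment (x₀ := x t) hf₁
  obtain ⟨δ, hδ, hxδ⟩ := Metric.continuousAt_iff.1 hx.continuousAt (ε / (2 * A)) (by positivity)
  have hlim : Tendsto (fun s => t - s) (𝓝[<] t) (𝓝[>] 0) := by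
    refine tendsto_nhdsWithin_iff.2 ⟨?_, ?_⟩
    · have := ((continuous_sub_left t).tendsto t).mono_left (nhdsWithin_le_nhds (s := Iio t))
      simpa using this
    · filter_upwards [self_mem_nhdsWithin] with s hs
      exact sub_pos.2 (mem_Iio.1 hs)
  filter_upwards [hlim.eventually (hback (ε / 2) (half_pos hε)),
    hlim.eventually (Ioo_mem_nhdsGT hδ)] with s hs hsδ
  have hxs : Continuous fun u => x (s + u) := by fun_prop
  have key := hs (ε / (2 * A)) (fun u => x (s + u)) hxs fun u hu => by
    rw [← Real.dist_eq]
    refine (hxδ ?_).le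
    rw [Real.dist_eq, abs_lt]
    constructor <;> linarith [hu.1, hu.2, hsδ.1, hsδ.2]
  have e : P.restr _ (hP.continuous_backward hf₁.continuous hxs (t - s)) =
      P.restr _ (hP.continuous_pastAfter hf.continuous hx s) := by
    refine restr_congr fun u _ => ?_
    have := hP.pastAfter_sub (f := f) hx t (t - s) u
    rw [sub_sub_cancel] at this
    rw [this]
  have e2 : A * (ε / (2 * A)) + ε / 2 = ε := by field_simp; norm_num
  rw [e, e2] at key
  rw [Real.norm_eq_abs, abs_sub_comm, abs_of_pos hsδ.1, mul_comm]
  have e3 : ∀ w w' w'' : C(Icc (0 : ℝ) P.horizon, ℝ),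
      w - w' - (s - t) • w'' = w - w' + (t - s) • w'' := fun w w' w'' => by
    rw [← neg_sub t s, neg_smul, sub_neg_eq_add]
  exact (congrArg norm (e3 _ _ _)).trans_le key

theorem exists_support_along (hf : P.IsSmoothPast f f') (hx : Continuous x) {t k : ℝ} (ht : 0 ≤ t)
    (hdom : hP.along hf.continuous hx t ∈ P.dom)
    (hk : deriv P.U₁ k = deriv (fun s => P.val (s, (hP.along hf.continuous hx t).2)) (x t)) :
    ∃ L : StrongDual ℝ P.State, (∀ y ∈ P.dom, P.val y ≤ P.val (hP.along hf.continuous hx t) +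
      L (y - hP.along hf.continuous hx t)) ∧ L P.dir = deriv P.U₁ k ∧
      HasDerivAt (fun s => P.val (s, (hP.along hf.continuous hx t).2)) (deriv P.U₁ k) (x t) := by
  obtain ⟨f₁, hf₁⟩ := hP.exists_isSmoothPast_pastAfter hf hx ht
  obtain ⟨L, hL, hd⟩ := hP.exists_hasDerivAt_val_of_past (x₀ := x t) hf₁ hdom
  have e : L P.dir = deriv P.U₁ k := by
    rw [hk]
    exact hd.deriv.symm
  exact ⟨L, hL, e, e ▸ hd⟩

/-- The control given by the slope of the value along a trajectory is continuous. -/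
theorem continuousOn_of_deriv_val (hf : P.IsSmoothPast f f') (hx : Continuous x)
    (hdom : ∀ t, 0 ≤ t → hP.along hf.continuous hx t ∈ P.dom) (hc : ∀ t, 0 ≤ t → 0 < c t)
    (hcV : ∀ t, 0 ≤ t → deriv P.U₁ (c t) =
      deriv (fun s => P.val (s, (hP.along hf.continuous hx t).2)) (x t)) :
    ContinuousOn c (Ici 0) := fun t ht => by
  refine hP.continuousWithinAt_of_deriv_U₁ ht (fun u hu => hc u hu) ?_
  refine continuousWithinAt_slope hP.isOpen_dom hP.continuousOn_val (e := P.dir)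
    (hP.continuous_along hf.continuous hx).continuousWithinAt (hdom t ht) (fun u hu τ hτ => ?_) ?_
  · obtain ⟨L, hL, e, -⟩ := hP.exists_support_along hf hx hu (hdom u hu) (hcV u hu)
    have := hL _ hτ
    rwa [add_sub_cancel_left, map_smul, e, smul_eq_mul, mul_comm τ] at this
  · obtain ⟨-, -, -, hd⟩ := hP.exists_support_along hf hx ht (hdom t ht) (hcV t ht)
    have h2 := HasDerivAt.comp_const_add
      (f := fun s => P.val (s, (hP.along hf.continuous hx t).2)) (x t) 0 (by rwa [add_zero])
    simp only [add_smul_dir]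
    exact h2

/-- A trajectory that follows the feedback given by the slope of the value is feasible and attains
the value. -/
theorem isFeasible_and_integral_pay_eq_val (hf : P.IsSmoothPast f f') (hx : Continuous x)
    (hdom : ∀ t, 0 ≤ t → hP.along hf.continuous hx t ∈ P.dom) (hc : ∀ t, 0 ≤ t → 0 < c t)
    (hcV : ∀ t, 0 ≤ t → deriv P.U₁ (c t) =
      deriv (fun s => P.val (s, (hP.along hf.continuous hx t).2)) (x t))
    (heq : ∀ t, 0 ≤ t → x t = x 0 + ∫ s in (0 : ℝ)..t, (P.growth (x s) (P.mem f x s) - c s)) :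
    P.IsFeasible (x 0) f c x ∧ IntegrableOn (P.pay c x) (Ioi 0) ∧
      ∫ t in Ioi 0, P.pay c x t = P.val (hP.along hf.continuous hx 0) := by
  have hcc := hP.continuousOn_of_deriv_val hf hx hdom hc hcV
  set z := hP.along hf.continuous hx with hz
  have hzc : Continuous z := hP.continuous_along hf.continuous hx
  have hpos : ∀ t, 0 ≤ t → 0 < x t := fun t ht => pos_of_mem_dom (hdom t ht)
  have hmax : Continuous fun t : ℝ => max t 0 := by fun_prop
  have hcm : Continuous fun t => c (max t 0) :=
    hcc.comp_continuous hmax fun t => mem_Ici.2 (le_max_right _ _)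
  have hgm := hP.continuous_growth_mem hf.continuous hx
  have hfeas : P.IsFeasible (x 0) f c x := fun h hh =>
    { cont := hx
      pos := fun t ht => hpos t ht.1
      nonneg := fun t ht => (hc t ht.1).le
      int := ContinuousOn.intervalIntegrable (hcc.mono (by
        rw [uIcc_of_le hh]; exact Icc_subset_Ici_self))
      eq := fun t ht => heq t ht.1 }
  set q : ℝ → ℝ := fun t => P.pay c x (max t 0) with hq
  have hqc : Continuous q := by
    refine Continuous.mul (by fun_prop) (Continuous.add ?_ ?_)
    · exact hP.U₁_cont.comp_continuous hcm fun t => (hc _ (le_max_right _ _)).le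
    · exact hP.U₂_cont.comp_continuous (hx.comp hmax) fun t => hpos _ (le_max_right _ _)
  have hqint : ∀ t, 0 ≤ t → ∫ s in (0 : ℝ)..t, q s = ∫ s in (0 : ℝ)..t, P.pay c x s :=
    fun t ht => intervalIntegral.integral_congr fun s hs => by
      rw [uIcc_of_le ht] at hs
      simp only [hq, max_eq_left hs.1]
  have hxd : ∀ t, 0 < t → HasDerivAt x (P.growth (x t) (P.mem f x t) - c t) t := fun t ht => by
    set d : ℝ → ℝ := fun s => P.growth (x s) (P.mem f x s) - c (max s 0) with hd
    have hdc : Continuous d := hgm.sub hcm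
    have h1 : HasDerivAt (fun u => x 0 + ∫ s in (0 : ℝ)..u, d s) (d t) t :=
      (intervalIntegral.integral_hasDerivAt_right (hdc.intervalIntegrable _ _)
        (hdc.stronglyMeasurableAtFilter _ _) hdc.continuousAt).const_add _
    have h2 : d t = P.growth (x t) (P.mem f x t) - c t := by simp only [hd, max_eq_left ht.le]
    rw [← h2]
    refine h1.congr_of_eventuallyEq ?_
    filter_upwards [Ioi_mem_nhds ht] with u hu
    have hu : 0 < u := hu
    rw [heq u hu.le]
    congr 1
    refine intervalIntegral.integral_congr fun s hs => ?_
    rw [uIcc_of_le hu.le] at hs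
    simp only [hd, max_eq_left hs.1]
  -- Discounted value plus accumulated payoff, to be shown nondecreasing.
  set Ψ : ℝ → ℝ := fun t => Real.exp (-P.ρ * t) * P.val (z t) + ∫ s in (0 : ℝ)..t, q s with hΨ
  have hQd : ∀ t, HasDerivAt (fun t => ∫ s in (0 : ℝ)..t, q s) (q t) t := fun t =>
    intervalIntegral.integral_hasDerivAt_right (hqc.intervalIntegrable _ _)
      (hqc.stronglyMeasurableAtFilter _ _) hqc.continuousAt
  have hexpd : ∀ t, HasDerivAt (fun t => Real.exp (-P.ρ * t)) (-P.ρ * Real.exp (-P.ρ * t)) t :=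
    fun t => by
      have := ((hasDerivAt_id t).const_mul (-P.ρ)).exp
      simpa [mul_comm] using this
  have hmono : ∀ b, 0 ≤ b → Ψ 0 ≤ Ψ b := fun b hb => by
    refine le_of_left_slope hb (ContinuousOn.add (ContinuousOn.mul (by fun_prop) ?_) ?_)
      fun t ht r hr => ?_
    · exact hP.continuousOn_val.comp hzc.continuousOn fun t ht => hdom t ht.1
    · exact (continuous_iff_continuousAt.2 fun t => (hQd t).continuousAt).continuousOn
    · obtain ⟨L, hL, hLd, -⟩ := hP.exists_support_along hf hx ht.1.le (hdom t ht.1.le)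
        (hcV t ht.1.le)
      obtain ⟨f₁, hf₁⟩ := hP.exists_isSmoothPast_pastAfter hf hx ht.1.le
      have hzd := hP.hasDerivWithinAt_along hf hx (hxd t ht.1) hf₁
      rw [← hz] at hzd
      have hjb := hP.hjb_le (x₀ := x t) hf₁ (hdom t ht.1.le) hL (hc t ht.1.le) hLd.symm
      have hmem : P.pastAfter f x t 0 = P.mem f x t := by
        simp only [pastAfter, mem, add_zero, sub_zero]
      rw [hmem] at hjb
      set b₀ := P.growth (x t) (P.mem f x t) with hb₀
      set σ := P.restr _ (hP.continuous_pastRate (x₀ := x t) hf₁) with hσ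
      -- Replacing the value by its affine majorant at `z t` gives a differentiable function that
      -- lies above `Ψ` at nearby times and touches it at `t`. By `hjb_le` its left derivative is
      -- nonnegative.
      set Φ : ℝ → ℝ := fun s => Real.exp (-P.ρ * s) * (P.val (z t) + L (z s - z t)) +
        ∫ u in (0 : ℝ)..s, q u with hΦ
      set D := Real.exp (-P.ρ * t) * (-P.ρ * P.val (z t) + ((b₀ - c t) * L P.dir + L (0, σ)) +
        (P.U₁ (c t) + P.U₂ (x t))) with hD
      have hD0 : 0 ≤ D := by
        refine mul_nonneg (Real.exp_pos _).le ?_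
        change P.ρ * P.val (z t) - P.U₂ (x t) ≤ _ at hjb
        linarith
      have hΦd : HasDerivWithinAt Φ D (Iio t) t := by
        have h1 := L.hasFDerivAt.comp_hasDerivWithinAt t (hzd.sub_const (z t))
        have h2 := ((hexpd t).hasDerivWithinAt (s := Iio t)).mul (h1.const_add (P.val (z t)))
        refine (h2.add (hQd t).hasDerivWithinAt).congr_deriv ?_
        have e1 : q t = Real.exp (-P.ρ * t) * (P.U₁ (c t) + P.U₂ (x t)) := by
          simp only [hq, max_eq_left ht.1.le, pay]
        rw [e1, functional_prod]
        simp only [Function.comp_apply, sub_self, map_zero, add_zero]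
        rw [hD]
        ring
      have hslope : Tendsto (slope Φ t) (𝓝[<] t) (𝓝 D) := by
        have := hasDerivWithinAt_iff_tendsto_slope.1 hΦd
        rwa [sdiff_singleton_eq_self (by simp)] at this
      have hzdom : ∀ᶠ s in 𝓝[<] t, z s ∈ P.dom :=
        (hzc.tendsto t).mono_left nhdsWithin_le_nhds |>.eventually
          (hP.isOpen_dom.mem_nhds (hdom t ht.1.le))
      filter_upwards [hslope.eventually_const_lt (by linarith : -r < D), hzdom,
        self_mem_nhdsWithin] with s hs hsD hst
      have hst : s - t < 0 := sub_neg.2 hst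
      rw [slope_def_field, lt_div_iff_of_neg hst] at hs
      have h1 : Ψ s ≤ Φ s := by
        simp only [hΨ, hΦ]
        gcongr
        exact hL _ hsD
      have h2 : Φ t = Ψ t := by simp [hΨ, hΦ]
      linarith
  obtain ⟨K, hK, hKle⟩ := hP.exists_gain_le
  have hval : ∀ t, 0 ≤ t → P.val (z 0) ≤
      Real.exp (-P.ρ * t) * K + ∫ s in (0 : ℝ)..t, P.pay c x s := fun t ht => by
    have h1 := hmono t ht
    simp only [hΨ, mul_zero, Real.exp_zero, one_mul, intervalIntegral.integral_same, add_zero,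
      hqint t ht] at h1
    have h2 := mul_le_mul_of_nonneg_left (val_le (hdom t ht) fun j hj => hKle _ _ j hj)
      (Real.exp_pos (-P.ρ * t)).le
    linarith
  obtain ⟨M, hM, -, hB⟩ := hP.exists_utility_bounds
  have hρ := hP.ρ_pos
  have hexpi : IntegrableOn (fun t => Real.exp (-P.ρ * t) * M) (Ioi 0) :=
    (integrableOn_exp_mul_Ioi (by linarith) 0).mul_const _
  have hle : ∀ t, 0 ≤ t → P.pay c x t ≤ Real.exp (-P.ρ * t) * M := fun t ht =>
    mul_le_mul_of_nonneg_left (hB _ _ (hc t ht).le (hpos t ht)) (Real.exp_pos _).le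
  -- The shortfall below `M e^{-ρt}` is nonnegative and has bounded integrals by `hval`, so it is
  -- integrable, and therefore so is the payoff.
  have hdef : IntegrableOn (fun t => Real.exp (-P.ρ * t) * M - P.pay c x t) (Ioi 0) := by
    have hi : ∀ n : ℕ, IntervalIntegrable (fun t => Real.exp (-P.ρ * t) * M - P.pay c x t) volume
        0 n := fun n => (Continuous.intervalIntegrable (by fun_prop) _ _).sub
          (hfeas.integrable_pay hP le_rfl n.cast_nonneg)
    refine integrableOn_Ioi_of_intervalIntegral_norm_bounded
      ((∫ t in Ioi 0, Real.exp (-P.ρ * t) * M) + K - P.val (z 0)) 0 (l := atTop)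
      (b := fun n : ℕ => (n : ℝ)) (fun n => ?_) tendsto_natCast_atTop_atTop
      (Eventually.of_forall fun n => ?_)
    · exact (intervalIntegrable_iff_integrableOn_Ioc_of_le n.cast_nonneg).1 (hi n)
    · have h1 : ∫ t in (0 : ℝ)..n, ‖Real.exp (-P.ρ * t) * M - P.pay c x t‖ =
          (∫ t in (0 : ℝ)..n, Real.exp (-P.ρ * t) * M) - ∫ t in (0 : ℝ)..n, P.pay c x t := by
        rw [← intervalIntegral.integral_sub (Continuous.intervalIntegrable (by fun_prop) _ _)
          (hfeas.integrable_pay hP le_rfl n.cast_nonneg)]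
        refine intervalIntegral.integral_congr fun t ht => ?_
        rw [uIcc_of_le n.cast_nonneg] at ht
        exact Real.norm_of_nonneg (sub_nonneg.2 (hle t ht.1))
      have h2 : ∫ t in (0 : ℝ)..n, Real.exp (-P.ρ * t) * M ≤
          ∫ t in Ioi 0, Real.exp (-P.ρ * t) * M := by
        rw [intervalIntegral.integral_of_le n.cast_nonneg]
        exact setIntegral_mono_set hexpi (Eventually.of_forall fun t => by positivity)
          Ioc_subset_Ioi_self.eventuallyLE
      have h3 := hval n n.cast_nonneg
      have h4 : Real.exp (-P.ρ * n) * K ≤ K :=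
        mul_le_of_le_one_left hK.le (Real.exp_le_one_iff.2 (by
          have := mul_nonneg hρ.le (n.cast_nonneg : (0 : ℝ) ≤ n)
          linarith))
      rw [h1]
      linarith
  have hint : IntegrableOn (P.pay c x) (Ioi 0) := by
    have := hexpi.sub hdef
    refine this.congr (Eventually.of_forall fun t => ?_)
    simp
  refine ⟨hfeas, hint, le_antisymm ?_ ?_⟩
  · refine hP.le_val ?_
    have : P.IsGain (x 0) f (∫ t in Ioi 0, P.pay c x t) := ⟨c, x, hfeas, hint, rfl⟩
    refine this.congr fun s hs => ?_
    rw [hz, along, forcing_restr (hP.continuous_pastAfter hf.continuous hx 0) _ hs]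
    · simp [pastAfter]
    · exact fun u hu => hP.pastAfter_eq_zero le_rfl le_rfl hf.zero (by
        rw [hP.horizon_eq] at hu; linarith)
  · have h1 := intervalIntegral_tendsto_integral_Ioi 0 hint tendsto_id
    have h2 : Tendsto (fun t => Real.exp (-P.ρ * t) * K) atTop (𝓝 (0 * K)) := by
      refine Tendsto.mul_const K (Real.tendsto_exp_atBot.comp ?_)
      exact tendsto_id.const_mul_atTop_of_neg (by linarith)
    have h3 := h2.add h1
    rw [zero_mul, zero_add] at h3
    exact ge_of_tendsto h3 (by
      filter_upwards [eventually_ge_atTop 0] with t ht using hval t ht)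

end Standing

/-! ### From square integrable pasts to their contributions -/

variable (P) in
/-- The contribution of the past `η₁` to the delayed term. -/
def past (η : H P.T) : ℝ → ℝ := P.pastOf ((Icc (-P.T) 0).indicator η.snd)

/-- The past `η₁` followed by `x` on `(0, t]`, extended by zero. -/
def extendPast {T : ℝ} (η : H T) (x : ℝ → ℝ) (t u : ℝ) : ℝ :=
  (Icc (-T) 0).indicator η.snd u + (Ioc 0 t).indicator x u

theorem memLp_indicator_snd {T : ℝ} (η : H T) : MemLp ((Icc (-T) 0).indicator η.snd) 2 :=
  (memLp_indicator_iff_restrict measurableSet_Icc).2 (Lp.memLp η.snd)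

theorem integrable_indicator_snd {T : ℝ} (η : H T) :
    Integrable ((Icc (-T) 0).indicator η.snd) :=
  (integrable_indicator_iff measurableSet_Icc).2 ((Lp.memLp η.snd).integrable (by norm_num))

theorem memLp_extendPast {T : ℝ} (η : H T) {x : ℝ → ℝ} (hx : Continuous x) (t : ℝ) :
    MemLp (extendPast η x t) 2 :=
  (memLp_indicator_snd η).add ((memLp_indicator_iff_restrict measurableSet_Ioc).2
    ((memLp_two_restrict_Icc hx.continuousOn).mono_measure
      (Measure.restrict_mono Ioc_subset_Icc_self le_rfl)))

theorem ae_comp_add_eq_extendPast {T : ℝ} {η : H T} {x X : ℝ → ℝ}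
    (hX : ∀ᵐ s ∂(delayMeasure T), X s = η.snd s) (hxX : ∀ t, 0 ≤ t → x t = X t) {t : ℝ}
    (ht : 0 ≤ t) : ∀ᵐ ξ ∂(delayMeasure T), X (t + ξ) = extendPast η x t (t + ξ) := by
  have h1 : ∀ᵐ u : ℝ, u ∈ Icc (-T) t → X u = extendPast η x t u := by
    filter_upwards [(ae_restrict_iff' measurableSet_Icc).1 hX] with u hu hut
    rcases le_or_gt u 0 with h | h
    · have h2 : u ∉ Ioc 0 t := fun h' => absurd h'.1 (not_lt.2 h)
      rw [extendPast, indicator_of_mem (s := Icc (-T) 0) ⟨hut.1, h⟩, indicator_of_notMem h2,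
        add_zero, hu ⟨hut.1, h⟩]
    · have h2 : u ∉ Icc (-T) 0 := fun h' => absurd h'.2 (not_le.2 h)
      rw [extendPast, indicator_of_mem (s := Ioc 0 t) ⟨h, hut.2⟩, indicator_of_notMem h2,
        zero_add, hxX u h.le]
  refine (ae_restrict_iff' measurableSet_Icc).2 ?_
  filter_upwards [(measurePreserving_add_left volume t).quasiMeasurePreserving.ae h1] with ξ h2 hξ
  exact h2 ⟨by linarith [hξ.1], by linarith [hξ.2]⟩

theorem memLp_comp_add {T : ℝ} {η : H T} {x X : ℝ → ℝ} (hx : Continuous x)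
    (hX : ∀ᵐ s ∂(delayMeasure T), X s = η.snd s) (hxX : ∀ t, 0 ≤ t → x t = X t) {t : ℝ}
    (ht : 0 ≤ t) : MemLp (fun ξ => X (t + ξ)) 2 (delayMeasure T) := by
  have h1 := ((memLp_extendPast η hx t).comp_measurePreserving
    (measurePreserving_add_left volume t)).restrict (Icc (-T) 0)
  exact h1.ae_eq ((ae_comp_add_eq_extendPast hX hxX ht).mono fun ξ h => h.symm)

theorem stateSegment_snd {T : ℝ} {η : H T} {x X : ℝ → ℝ} (hx : Continuous x)
    (hX : ∀ᵐ s ∂(delayMeasure T), X s = η.snd s) (hxX : ∀ t, 0 ≤ t → x t = X t) {t : ℝ}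
    (ht : 0 ≤ t) : ∀ᵐ ξ ∂(delayMeasure T), (stateSegment T X t).snd ξ = X (t + ξ) := by
  have h := memLp_comp_add hx hX hxX ht
  have e : (stateSegment T X t).snd = h.toLp _ := by
    simp only [stateSegment, dif_pos h]
    rfl
  rw [e]
  exact h.coeFn_toLp

namespace Standing
variable (hP : P.Standing)
include hP

theorem exists_isSmoothPast_past (η : H P.T) : ∃ f', P.IsSmoothPast (P.past η) f' :=
  hP.exists_isSmoothPast_pastOf (memLp_indicator_snd η) (integrable_indicator_snd η)
    fun _ hu => indicator_of_notMem (fun h => absurd h.2 (not_le.2 hu)) _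

theorem continuous_past (η : H P.T) : Continuous (P.past η) := by
  obtain ⟨f', hf'⟩ := hP.exists_isSmoothPast_past η
  exact hf'.continuous

theorem past_eq_zero (η : H P.T) {s : ℝ} (hs : P.horizon ≤ s) : P.past η s = 0 := by
  obtain ⟨f', hf'⟩ := hP.exists_isSmoothPast_past η
  exact hf'.zero s (by rw [hP.horizon_eq] at hs; linarith)

/-- One change of variables serves twice: `s = 0` gives the delayed term of the state equation, and
general `s` gives the contribution of the segment seen at time `t`. -/
theorem setIntegral_kern_eq_pastAfter {η : H P.T} {x X : ℝ → ℝ} (hx : Continuous x)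
    (hX : ∀ᵐ s ∂(delayMeasure P.T), X s = η.snd s) (hxX : ∀ t, 0 ≤ t → x t = X t) {s t : ℝ}
    (ht : 0 ≤ t) (hs : 0 ≤ s) :
    ∫ ξ in Icc (-P.T) 0, P.kern (ξ - s) * X (t + ξ) = P.pastAfter (P.past η) x t s := by
  have hk := hP.continuous_kern
  have hind : Integrable ((Ioc 0 t).indicator x) :=
    (integrable_indicator_iff measurableSet_Ioc).2
      (hx.continuousOn.integrableOn_Icc.mono_set Ioc_subset_Icc_self)
  have h1 : ∫ ξ in Icc (-P.T) 0, P.kern (ξ - s) * X (t + ξ) =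
      ∫ ξ in Icc (-P.T) 0, P.kern (ξ - s) * extendPast η x t (t + ξ) :=
    integral_congr_ae ((ae_comp_add_eq_extendPast hX hxX ht).mono fun ξ h => by simp only [h])
  have h2 : ∫ ξ in Icc (-P.T) 0, P.kern (ξ - s) * extendPast η x t (t + ξ) =
      ∫ ξ, P.kern (ξ - s) * extendPast η x t (t + ξ) := by
    refine setIntegral_eq_integral_of_forall_compl_eq_zero fun ξ hξ => ?_
    rcases lt_or_ge ξ (-P.T) with h | h
    · rw [hP.kern_of_le (by linarith), zero_mul]
    · have h0 : 0 < ξ := lt_of_not_ge fun h' => hξ ⟨h, h'⟩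
      have a1 : t + ξ ∉ Icc (-P.T) 0 := fun h' => by linarith [h'.2]
      have a2 : t + ξ ∉ Ioc 0 t := fun h' => by linarith [h'.2]
      rw [extendPast, indicator_of_notMem a1, indicator_of_notMem a2, add_zero, mul_zero]
  have h3 : ∫ ξ, P.kern (ξ - s) * extendPast η x t (t + ξ) =
      ∫ u, P.kern (u - (t + s)) * extendPast η x t u := by
    rw [← integral_add_left_eq_self (fun u => P.kern (u - (t + s)) * extendPast η x t u) t]
    simp only [add_sub_add_left_eq_sub]
  have h4 : ∫ u, P.kern (u - (t + s)) * (Ioc 0 t).indicator x u =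
      ∫ u in (0 : ℝ)..t, P.kern (u - t - s) * x u := by
    rw [intervalIntegral.integral_of_le ht, ← integral_indicator measurableSet_Ioc]
    refine integral_congr_ae (Eventually.of_forall fun u => ?_)
    by_cases h : u ∈ Ioc 0 t <;> simp [h, sub_sub]
  rw [h1, h2, h3]
  simp only [extendPast, mul_add]
  rw [integral_add (hP.integrable_kern_mul (integrable_indicator_snd η) _)
    (hP.integrable_kern_mul hind _), h4]
  rfl

theorem integral_a_eq_mem {η : H P.T} {x X : ℝ → ℝ} (hx : Continuous x)
    (hX : ∀ᵐ s ∂(delayMeasure P.T), X s = η.snd s) (hxX : ∀ t, 0 ≤ t → x t = X t) {t : ℝ}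
    (ht : 0 ≤ t) : ∫ ξ in (-P.T)..0, P.a ξ * X (t + ξ) = P.mem (P.past η) x t := by
  have h1 := hP.setIntegral_kern_eq_pastAfter hx hX hxX ht le_rfl
  simp only [pastAfter, add_zero, sub_zero] at h1
  rw [mem, ← h1, intervalIntegral.integral_of_le (by linarith [hP.T_pos]),
    ← integral_Icc_eq_integral_Ioc]
  exact setIntegral_congr_fun measurableSet_Icc fun ξ hξ => by simp only [kern_eq hξ]

theorem past_stateSegment {η : H P.T} {x X : ℝ → ℝ} (hx : Continuous x)
    (hX : ∀ᵐ s ∂(delayMeasure P.T), X s = η.snd s) (hxX : ∀ t, 0 ≤ t → x t = X t) {s t : ℝ}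
    (ht : 0 ≤ t) (hs : 0 ≤ s) :
    P.past (stateSegment P.T X t) s = P.pastAfter (P.past η) x t s := by
  rw [← hP.setIntegral_kern_eq_pastAfter hx hX hxX ht hs]
  have e : ∀ u, P.kern (u - s) * (Icc (-P.T) 0).indicator (stateSegment P.T X t).snd u =
      (Icc (-P.T) 0).indicator (fun u => P.kern (u - s) * (stateSegment P.T X t).snd u) u :=
    fun u => by by_cases h : u ∈ Icc (-P.T) 0 <;> simp [h]
  simp only [past, pastOf, e]
  rw [integral_indicator measurableSet_Icc]
  exact integral_congr_ae ((stateSegment_snd hx hX hxX ht).mono fun ξ h => by simp only [h])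

theorem equation_rhs_eq {η : H P.T} {c x X : ℝ → ℝ} (hx : Continuous x)
    (hX : ∀ᵐ s ∂(delayMeasure P.T), X s = η.snd s) (hxX : ∀ t, 0 ≤ t → x t = X t)
    (hpos : ∀ t, 0 ≤ t → 0 < x t) {t : ℝ} (ht : 0 ≤ t) (hc : IntervalIntegrable c volume 0 t) :
    η.fst + (∫ s in (0 : ℝ)..t, P.r * X s)
      + (∫ s in (0 : ℝ)..t, P.f₀ (X s) (∫ ξ in (-P.T)..0, P.a ξ * X (s + ξ)))
      - ∫ s in (0 : ℝ)..t, c s =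
    η.fst + ∫ s in (0 : ℝ)..t, (P.growth (x s) (P.mem (P.past η) x s) - c s) := by
  have hg := hP.continuous_growth_mem (hP.continuous_past η) hx
  have h1 : ∫ s in (0 : ℝ)..t, P.r * X s = ∫ s in (0 : ℝ)..t, P.r * x s :=
    intervalIntegral.integral_congr fun s hs => by
      rw [uIcc_of_le ht] at hs
      simp only [hxX s hs.1]
  have h2 : ∫ s in (0 : ℝ)..t, P.f₀ (X s) (∫ ξ in (-P.T)..0, P.a ξ * X (s + ξ)) =
      ∫ s in (0 : ℝ)..t, (P.growth (x s) (P.mem (P.past η) x s) - P.r * x s) :=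
    intervalIntegral.integral_congr fun s hs => by
      rw [uIcc_of_le ht] at hs
      simp only [hP.integral_a_eq_mem hx hX hxX hs.1, growth, max_eq_left (hpos s hs.1).le,
        ← hxX s hs.1]
      ring
  rw [h1, h2, intervalIntegral.integral_sub (hg.intervalIntegrable _ _)
    (Continuous.intervalIntegrable (by fun_prop) _ _),
    intervalIntegral.integral_sub (hg.intervalIntegrable _ _) hc]
  ring

end Standing

/-! ### Identification of controls, payoffs, value and feedback -/

theorem intervalIntegrable_of_locallyIntegrableOn {c : ℝ → ℝ} (hc : LocallyIntegrableOn c (Ici 0))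
    {t : ℝ} (ht : 0 ≤ t) : IntervalIntegrable c volume 0 t :=
  (intervalIntegrable_iff_integrableOn_Icc_of_le ht).2
    (hc.integrableOn_compact_subset Icc_subset_Ici_self isCompact_Icc)

theorem IsFeasible.locallyIntegrableOn {x₀ : ℝ} {f c x : ℝ → ℝ} (hx : P.IsFeasible x₀ f c x) :
    LocallyIntegrableOn c (Ici 0) := by
  refine (locallyIntegrableOn_iff isClosed_Ici.isLocallyClosed).2 fun k hk hkc => ?_
  obtain ⟨b, hb⟩ := hkc.bddAbove
  have h1 : IntegrableOn c (Icc 0 (max b 0)) :=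
    (intervalIntegrable_iff_integrableOn_Icc_of_le (le_max_right _ _)).1
      (hx.int le_rfl (le_max_right b 0))
  exact h1.mono_set fun u hu => ⟨hk hu, (hb hu).trans (le_max_left _ _)⟩

namespace Standing
variable (hP : P.Standing)
include hP

/-- The state with the past replaced by its contribution to the delayed term. -/
def toState (η : H P.T) : P.State := (η.fst, P.restr _ (hP.continuous_past η))

theorem forcing_toState (η : H P.T) {s : ℝ} (hs : 0 ≤ s) :
    forcing (hP.toState η).2 s = P.past η s :=
  forcing_restr (hP.continuous_past η) (fun _ h => hP.past_eq_zero η h) hs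

theorem isGain_toState_iff {η : H P.T} {j : ℝ} :
    P.IsGain (hP.toState η).1 (forcing (hP.toState η).2) j ↔ P.IsGain η.fst (P.past η) j :=
  ⟨fun h => h.congr fun _ hs => hP.forcing_toState η hs,
    fun h => h.congr fun _ hs => (hP.forcing_toState η hs).symm⟩

theorem isFeasible_of_isPositiveSolution {η : H P.T} {c X : ℝ → ℝ} (hX : P.IsPositiveSolution η c X)
    (hc0 : ∀ t, 0 ≤ t → 0 ≤ c t) (hc : LocallyIntegrableOn c (Ici 0)) :
    P.IsFeasible η.fst (P.past η) c (fun t => X (max t 0)) := fun h hh => by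
  have hx : Continuous fun t => X (max t 0) :=
    hX.1.continuousOn.comp_continuous (by fun_prop) fun t => mem_Ici.2 (le_max_right _ _)
  have hxX : ∀ t, 0 ≤ t → X (max t 0) = X t := fun t ht => by rw [max_eq_left ht]
  have hpos : ∀ t, 0 ≤ t → 0 < X (max t 0) := fun t ht => hX.2 _ (le_max_right _ _)
  refine ⟨hx, fun t ht => hpos t ht.1, fun t ht => hc0 t ht.1,
    intervalIntegrable_of_locallyIntegrableOn hc hh, fun t ht => ?_⟩
  rw [← hP.equation_rhs_eq hx hX.1.initial hxX hpos ht.1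
    (intervalIntegrable_of_locallyIntegrableOn hc ht.1), ← hX.1.equation t ht.1, hxX t ht.1]

theorem isPositiveSolution_of_isFeasible {η : H P.T} {c x : ℝ → ℝ}
    (hx : P.IsFeasible η.fst (P.past η) c x) :
    P.IsPositiveSolution η c fun t => if 0 ≤ t then x t else η.snd t := by
  set X : ℝ → ℝ := fun t => if 0 ≤ t then x t else η.snd t with hXdef
  have hxX : ∀ t, 0 ≤ t → x t = X t := fun t ht => by simp [hXdef, ht]
  have hX : ∀ᵐ s ∂(delayMeasure P.T), X s = η.snd s := by
    refine (ae_restrict_iff' measurableSet_Icc).2 ?_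
    filter_upwards [Measure.ae_ne volume 0] with s hs hsT
    exact if_neg fun h => hs (le_antisymm hsT.2 h)
  refine ⟨⟨hx.cont.continuousOn.congr fun t ht => (hxX t ht).symm, hX, fun t ht => ?_⟩,
    fun t ht => hxX t ht ▸ hx.pos ht⟩
  rw [hP.equation_rhs_eq hx.cont hX hxX (fun t ht => hx.pos ht) ht (hx.int le_rfl ht), ← hxX t ht]
  exact hx.eq ht

theorem mem_admissible_iff {η : H P.T} {c : ℝ → ℝ} :
    c ∈ P.admissible η ↔ ∃ x, P.IsFeasible η.fst (P.past η) c x := by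
  constructor
  · rintro ⟨hc0, hc, X, hX⟩
    exact ⟨_, hP.isFeasible_of_isPositiveSolution hX hc0 hc⟩
  · rintro ⟨x, hx⟩
    exact ⟨fun t ht => hx.nonneg ht, hx.locallyIntegrableOn, _,
      hP.isPositiveSolution_of_isFeasible hx⟩

theorem state_eq {η : H P.T} {c x : ℝ → ℝ} (hx : P.IsFeasible η.fst (P.past η) c x) {t : ℝ}
    (ht : 0 ≤ t) : P.state η c t = x t := by
  have hs : P.IsPositiveSolution η c (P.state η c) :=
    Classical.epsilon_spec (p := P.IsPositiveSolution η c)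
      ⟨_, hP.isPositiveSolution_of_isFeasible hx⟩
  have h1 := hP.isFeasible_of_isPositiveSolution hs (fun t ht => hx.nonneg ht)
    hx.locallyIntegrableOn
  have := hP.arc_unique (hP.continuous_past η) (hx t ht) (h1 t ht) (right_mem_Icc.2 ht)
  rwa [max_eq_left ht] at this

theorem payoff_eq {η : H P.T} {c x : ℝ → ℝ} (hx : P.IsFeasible η.fst (P.past η) c x) :
    EqOn (P.payoff η c) (P.pay c x) (Ioi 0) := fun t ht => by
  simp only [payoff, pay, hP.state_eq hx (le_of_lt (mem_Ioi.1 ht))]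

theorem J_of_integrable {η : H P.T} {c x : ℝ → ℝ} (hx : P.IsFeasible η.fst (P.past η) c x)
    (hi : IntegrableOn (P.pay c x) (Ioi 0)) :
    P.J η c = ((∫ t in Ioi (0 : ℝ), P.pay c x t : ℝ) : EReal) := by
  have h := hP.payoff_eq hx
  rw [J, if_pos (hi.congr_fun h.symm measurableSet_Ioi), setIntegral_congr_fun measurableSet_Ioi h]

theorem J_of_not_integrable {η : H P.T} {c x : ℝ → ℝ} (hx : P.IsFeasible η.fst (P.past η) c x)
    (hi : ¬IntegrableOn (P.pay c x) (Ioi 0)) : P.J η c = ⊥ := by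
  have h := hP.payoff_eq hx
  rw [J, if_neg fun h' => hi (h'.congr_fun h measurableSet_Ioi)]

theorem V_of_mem_dom {η : H P.T} (hη : hP.toState η ∈ P.dom) :
    P.V η = ((P.val (hP.toState η) : ℝ) : EReal) := by
  have hle : P.V η ≤ ((P.val (hP.toState η) : ℝ) : EReal) := by
    refine iSup₂_le fun c hc => ?_
    obtain ⟨x, hx⟩ := hP.mem_admissible_iff.1 hc
    by_cases hi : IntegrableOn (P.pay c x) (Ioi 0)
    · rw [hP.J_of_integrable hx hi, EReal.coe_le_coe_iff]
      exact hP.le_val (hP.isGain_toState_iff.2 ⟨c, x, hx, hi, rfl⟩)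
    · rw [hP.J_of_not_integrable hx hi]
      exact bot_le
  have hge : ∀ j, P.IsGain η.fst (P.past η) j → (j : EReal) ≤ P.V η := by
    rintro j ⟨c, x, hx, hi, rfl⟩
    rw [← hP.J_of_integrable hx hi]
    exact le_iSup₂ (f := fun c (_ : c ∈ P.admissible η) => P.J η c) c
      (hP.mem_admissible_iff.2 ⟨x, hx⟩)
  have htop : P.V η ≠ ⊤ := (hle.trans_lt (EReal.coe_lt_top _)).ne
  have hbot : P.V η ≠ ⊥ := by
    obtain ⟨j, hj⟩ := hη
    exact ((EReal.bot_lt_coe j).trans_le (hge j (hP.isGain_toState_iff.1 hj))).ne'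
  refine le_antisymm hle ?_
  rw [← EReal.coe_toReal htop hbot, EReal.coe_le_coe_iff]
  refine val_le hη fun j hj => ?_
  have := hge j (hP.isGain_toState_iff.1 hj)
  rwa [← EReal.coe_toReal htop hbot, EReal.coe_le_coe_iff] at this

theorem V_of_notMem_dom {η : H P.T} (hη : hP.toState η ∉ P.dom) : P.V η = ⊥ := by
  refine le_bot_iff.1 (iSup₂_le fun c hc => ?_)
  obtain ⟨x, hx⟩ := hP.mem_admissible_iff.1 hc
  by_cases hi : IntegrableOn (P.pay c x) (Ioi 0)
  · exact absurd ⟨_, hP.isGain_toState_iff.2 ⟨c, x, hx, hi, rfl⟩⟩ hη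
  · rw [hP.J_of_not_integrable hx hi]

theorem toReal_V (η : H P.T) : (P.V η).toReal = P.val (hP.toState η) := by
  by_cases hη : hP.toState η ∈ P.dom
  · rw [hP.V_of_mem_dom hη, EReal.toReal_coe]
  · have : {j | P.IsGain (hP.toState η).1 (forcing (hP.toState η).2) j} = ∅ :=
      eq_empty_iff_forall_notMem.2 fun j hj => hη ⟨j, hj⟩
    -- Off the domain both conventions give `0`: the real part of `⊥` and the supremum of the empty
    -- set. The two functions thus agree everywhere, and so do their derivatives.
    rw [hP.V_of_notMem_dom hη, EReal.toReal_bot, val, this, Real.sSup_empty]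

theorem toState_mem_dom {η : H P.T} (hη : η ∈ P.domV) : hP.toState η ∈ P.dom := by
  by_contra h
  have := hη.2
  rw [hP.V_of_notMem_dom h] at this
  exact lt_irrefl _ this

theorem V₀_eq (η : H P.T) :
    P.V₀ η = deriv (fun s => P.val (s, (hP.toState η).2)) (hP.toState η).1 := by
  unfold V₀
  congr 1
  funext s
  exact hP.toReal_V _

/-- On the domain of the value function, the feedback map is positive and solves the first order
condition. -/
theorem feedback_spec {η : H P.T} (hη : η ∈ P.domV) :
    0 < P.feedback η ∧ deriv P.U₁ (P.feedback η) = P.V₀ η := by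
  obtain ⟨f', hf'⟩ := hP.exists_isSmoothPast_past η
  have hz := hP.toState_mem_dom hη
  obtain ⟨L, hL, hd⟩ := hP.exists_hasDerivAt_val_of_past hf' hz
  have hV : P.V₀ η = L P.dir := (hP.V₀_eq η).trans hd.deriv
  obtain ⟨k, hk, hkL⟩ := hP.exists_deriv_U₁_eq (hP.support_slope_pos hz hL)
  have hspec : P.IsFeedbackValue η (P.feedback η) :=
    Classical.epsilon_spec (p := P.IsFeedbackValue η)
      ⟨k, hk.le, (hP.isMaxOn_U₁_sub_iff hk.le).2 ⟨hk, hkL.trans hV.symm⟩⟩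
  exact (hP.isMaxOn_U₁_sub_iff hspec.1).1 hspec.2

theorem toState_stateSegment {η : H P.T} {x X : ℝ → ℝ} (hx : Continuous x)
    (hX : ∀ᵐ s ∂(delayMeasure P.T), X s = η.snd s) (hxX : ∀ t, 0 ≤ t → x t = X t) {t : ℝ}
    (ht : 0 ≤ t) :
    hP.toState (stateSegment P.T X t) = hP.along (hP.continuous_past η) hx t := by
  refine Prod.ext (hxX t ht).symm (restr_congr (hf := hP.continuous_past _)
    (hg := hP.continuous_pastAfter (hP.continuous_past η) hx t) fun s hs => ?_)
  exact hP.past_stateSegment hx hX hxX ht hs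

/-- The feedback strategy along a closed-loop trajectory is optimal. -/
theorem isOptimal_feedbackStrategy {η : H P.T} {X : ℝ → ℝ} (hη : η ∈ Hplus P.T)
    (hX : P.IsClosedLoopSolution η X) (hpos : ∀ t, 0 ≤ t → 0 < X t) :
    P.IsOptimal η (P.feedbackStrategy X) := by
  obtain ⟨f', hf'⟩ := hP.exists_isSmoothPast_past η
  set c := P.feedbackStrategy X with hc
  set x : ℝ → ℝ := fun t => X (max t 0) with hxdef
  have hx : Continuous x :=
    hX.isSolution.continuousOn.comp_continuous (by fun_prop) fun t => mem_Ici.2 (le_max_right _ _)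
  have hxX : ∀ t, 0 ≤ t → x t = X t := fun t ht => by simp only [hxdef, max_eq_left ht]
  have hxpos : ∀ t, 0 ≤ t → 0 < x t := fun t ht => hpos _ (le_max_right _ _)
  have hstate := fun {t : ℝ} (ht : 0 ≤ t) =>
    hP.toState_stateSegment hx hX.isSolution.initial hxX ht
  have hdom : ∀ t, 0 ≤ t → hP.along hf'.continuous hx t ∈ P.dom := fun t ht =>
    hstate ht ▸ hP.toState_mem_dom (hX.mem_domV t ht)
  have hc0 : ∀ t, 0 ≤ t → 0 < c t := fun t ht => (hP.feedback_spec (hX.mem_domV t ht)).1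
  have hcV : ∀ t, 0 ≤ t → deriv P.U₁ (c t) =
      deriv (fun s => P.val (s, (hP.along hf'.continuous hx t).2)) (x t) := fun t ht => by
    have h1 := (hP.feedback_spec (hX.mem_domV t ht)).2
    rw [hP.V₀_eq, hstate ht] at h1
    exact h1
  -- Integrability of the feedback strategy is not assumed; continuity supplies it, and only then
  -- can the integrals in the closed-loop equation be combined.
  have hcc := hP.continuousOn_of_deriv_val hf' hx hdom hc0 hcV
  have hx0 : x 0 = η.fst := by
    rw [hxX 0 le_rfl, hX.isSolution.equation 0 le_rfl]
    simp
  obtain ⟨hfeas, hint, hval⟩ := hP.isFeasible_and_integral_pay_eq_val hf' hx hdom hc0 hcV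
    fun t ht => by
      rw [hx0, ← hP.equation_rhs_eq hx hX.isSolution.initial hxX hxpos ht
        (hcc.mono (by rw [uIcc_of_le ht]; exact Icc_subset_Ici_self)).intervalIntegrable, hxX t ht]
      exact hX.isSolution.equation t ht
  rw [hx0] at hfeas
  have hz : hP.along hf'.continuous hx 0 = hP.toState η :=
    Prod.ext hx0 (restr_congr (hf := hP.continuous_pastAfter (hP.continuous_past η) hx 0)
      (hg := hP.continuous_past η) fun s _ => by simp [pastAfter])
  have hηdom : hP.toState η ∈ P.dom := hz ▸ hdom 0 le_rfl
  have hV := hP.V_of_mem_dom hηdom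
  refine ⟨⟨hη, ?_⟩, hP.mem_admissible_iff.2 ⟨x, hfeas⟩, ?_⟩
  · rw [hV]
    exact EReal.bot_lt_coe _
  · rw [hP.J_of_integrable hfeas hint, hval, hz, hV]

end Standing

end DelayControl.Problem

end

theorem theorem3p5 (P : DelayControl.Problem) (hP : P.Standing)
    (η : DelayControl.H P.T) (hη : η ∈ DelayControl.Hplus P.T)
    (x : ℝ → ℝ) (hx : P.IsClosedLoopSolution η x) (hx_pos : ∀ t, 0 ≤ t → 0 < x t) :
    P.feedbackStrategy x ∈ P.admissible η ∧ P.IsOptimal η (P.feedbackStrategy x) := by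
  have h := hP.isOptimal_feedbackStrategy hη hx hx_pos
  exact ⟨h.2.1, h⟩
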